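/- **Setting.** Let $\ell_1,\dots,\ell_n:\mathbb R^d\to\mathbb R$ be differentiable, $L=\frac1n\sum_i\ell_i$, $H=\nabla^2L$, $S=\lambda_{\max}(H)$, $\eta>0$, $1\le b\le n$, and let $\mathcal M=\{\theta: S(\theta)\le 2/\eta,\ \nabla L(\theta)\perp\text{ the top eigenvector(s) of }H(\theta)\}$. Let $\mathscr T\in\mathbb N$. The reference trajectory $\theta^\dagger_0,\dots,\theta^\dagger_{\mathscr T}$ starts at a point $\theta_0^\dagger\in\mathcal M$ with $S(\theta^\dagger_0)=2/\eta$, and $\theta^\dagger_{t+1}$ is a nearest point of $\mathcal M$ to $\theta^\dagger_t-\eta\nabla L(\theta_t^\dagger)$. Along it let $u_t$ be a unit top eigenvector of $H_t=H(\theta_t^\dagger)$, $\nabla L_t=\nabla L(\theta_t^\dagger)$, $\nabla S_t=\nabla S(\theta_t^\dagger)$, $P_u^\perp=I-uu^\top$, $\nabla S_t^\perp=P_{u_t}^\perp\nabla S_t$, $\kappa_t=\langle\nabla S_t,u_t\rangle$, $\alpha_t=-\langle\nabla L_t,\nabla S_t\rangle$, $\beta_t=\|\nabla S_t^\perp\|^2$,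 $\delta_t=\sqrt{2\alpha_t/\beta_t}$, $\delta=\max_{t\le\mathscr T}\delta_t$, $\epsilon=\max_{t\le\mathscr T}\eta\sqrt{\alpha_t}$. SGD: $\theta_{t+1}=\theta_t-\eta g_{B_t}(\theta_t)$ with $g_B=\frac1b\sum_{i\in B}\nabla\ell_i$, where $B_t$ is uniform among the subsets of $\{1,\dots,n\}$ of size $b$ and independent of $(\theta_0,B_0,\dots,B_{t-1})$; $\theta_0$ may be random. Write $\xi_t=g_{B_t}(\theta_t)-\nabla L(\theta_t)$, $v_t=\theta_t-\theta_t^\dagger$, let $\Sigma_b(\theta)$ be the covariance matrix of $g_B(\theta)$ for a uniform batch $B$ of size $b$. The predicted dynamics are $\hat v_0=v_0$ and $$\hat v_{t+1}=P_{u_{t+1}}^\perp\Big[(I-\eta H_t)P_{u_t}^\perp\hat v_t+\eta\nabla S_t^\perp\tfrac{\delta_t^2-\hat x_t^2}2\Big]-\Big((1+\eta\hat y_t)\hat x_t+\tfrac\eta2\kappa_t\hat x_t^2\Big)u_{t+1}-\eta\xi_t,$$ with $\hat x_t=\langle u_t,\hat v_t\rangle$, $\hat y_t=\langle\nabla S_t^\perp,\hat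 v_t\rangle$. **Assumptions**, with fixed constants $c_{\rm gap}<2$, $c_\alpha,c_\beta>0$, $C_{\rm nw},C_\xi,C_4,c_{\mathscr T},c_0,c_\kappa,C_{\rm dec}$, for all $t\le\mathscr T$ (for all $t<\mathscr T$ in the case of the noise bound in (5)): 1. every eigenvalue of $H_t$ on $u_t^\perp$ is $<c_{\rm gap}/\eta$; 2. there are $\rho_3>0$, $\rho_4$ and an open set $N$ containing the balls $B\big(\theta_t^\dagger,\frac{2-c_{\rm gap}}{4\eta\rho_3}\big)$ on which all $\ell_i$ are $C^4$, $\|\nabla^3L\|\le\rho_3$, and $\nabla^3L$ is $\rho_4$-Lipschitz; 3. $\alpha_t\ge c_\alpha\|\nabla L_t\|\|\nabla S_t^\perp\|$ and $\|\nabla S_t^\perp\|\ge c_\beta\rho_3$; 4. $\|\nabla^3L(\theta_t^\dagger)(v,w)\|\le C_{\rm nw}\epsilon\rho_3\|v\|\|w\|$ and $|v^\top H_tv|\le C_{\rm nw}\epsilon\|H_t\|\|v\|^2$ for $v,w\perp u_t$, and $|\lambda_{\min}(H_t)|\le C_{\rm nw}\epsilon\|H_t\|$; 5. $\mathscr T\le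 c_{\mathscr T}/\epsilon$, $\mathbb E\|\xi_t\|^2\le C_\xi\,\epsilon\delta^2/\eta^2$, $\rho_4\le C_4\eta\rho_3^2$, and $\|v_0\|^2\le c_0\delta^2$ almost surely; 6. (frozen coefficients) $H_t=H$, $u_t=u$, $\nabla S_t^\perp=\nabla S^\perp$, $\alpha_t=\alpha>0$, $\beta_t=\beta>0$, $\kappa_t=\kappa$ do not depend on $t\le\mathscr T$, $|\kappa|\le c_\kappa\epsilon\rho_3$, and $\nabla S^\perp\in\ker(H|_{u^\perp})$. **Theorem.** For every $\omega\in(0,1)$ there is $K_0>0$, and for every $K\ge K_0$ there are $C,\epsilon_0>0$, such that $K_0$ depends only on $\omega$ and the constants above, $C,\epsilon_0$ only on these and on $K$, and whenever the assumptions hold and $\epsilon\le\epsilon_0$: (a) The events $G_t=\{\|v_s\|\le K\delta,\ \|\hat v_s\|\le K\delta,\ \|v_s-\hat v_s\|\le K\epsilon\delta\ \text{ for all } s\le t\}$ satisfy $\mathbb P(G_{\mathscr T})\ge1-\omega$ (hence $\mathbb P(G_t)\ge 1-\omega$ for all $t\le\mathscr T$). (b) Let $t+1\le\mathscr T$, and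 write $\mathbb E_t=\mathbb E[\,\cdot\mid G_t]$. Suppose that, conditionally on $G_t$, the predicted dynamics are at a stationary distribution, i.e. $(\hat x_{t+1},\hat y_{t+1})$ has the same law as $(\hat x_t,\hat y_t)$, and decorrelated: $$\big|\mathbb E_t[(1+\eta\hat y_t)^2\hat x_t^2]-(1+\eta\,\mathbb E_t\hat y_t)^2\,\mathbb E_t\hat x_t^2\big|\le C_{\rm dec}\,\epsilon^2\delta^2 .$$ Put $\sigma_u^2=\mathbb E_t[u^\top\Sigma_b(\theta_t)u]$. Then $\hat x_t^2$, $\hat y_t$ and $S(\theta_t)$ are integrable given $G_t$, and $$\mathbb E_t[\hat x_t^2]=\delta^2=\frac{2\alpha}\beta,\qquad \Big|\mathbb E_t[\hat y_t]+\frac{\eta\beta\sigma_u^2}{4\alpha}\Big|\le C\frac{\epsilon^2}\eta,\qquad \Big|\mathbb E_t[S(\theta_t)]-\Big(\frac2\eta-\frac{\eta\beta\sigma_u^2}{4\alpha}\Big)\Big|\le C\frac{\epsilon^2}\eta .$$ -/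

import Mathlib

open MeasureTheory ProbabilityTheory

namespace StochasticSelfStabilization

/-- Parameter space `ℝ^d` with the Euclidean norm. -/
abbrev Param (d : ℕ) : Type := EuclideanSpace ℝ (Fin d)

/-! ### Loss landscape -/

/-- Empirical loss `L = (1/n) ∑ ℓ_i`. -/
noncomputable def loss {d n : ℕ} (ℓ : Fin n → Param d → ℝ) (θ : Param d) : ℝ :=
  (n : ℝ)⁻¹ * ∑ i, ℓ i θ

/-- Hessian `H(θ) = ∇²L(θ)` as an operator. -/
noncomputable def hess {d : ℕ} (L : Param d → ℝ) (θ : Param d) : Param d →L[ℝ] Param d :=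
  fderiv ℝ (gradient L) θ

/-- Third derivative; `third L θ v w` is the vector `∇³L(θ)(v, w)`. -/
noncomputable def third {d : ℕ} (L : Param d → ℝ) (θ : Param d) :
    Param d →L[ℝ] Param d →L[ℝ] Param d :=
  fderiv ℝ (hess L) θ

/-- Sharpness `S(θ)`: the largest eigenvalue of the Hessian. -/
noncomputable def sharpness {d : ℕ} (L : Param d → ℝ) (θ : Param d) : ℝ :=
  sSup {μ : ℝ | Module.End.HasEigenvalue (hess L θ).toLinearMap μ}

/-- The smallest eigenvalue of the Hessian. -/
noncomputable def minEig {d : ℕ} (L : Param d → ℝ) (θ : Param d) : ℝ :=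
  sInf {μ : ℝ | Module.End.HasEigenvalue (hess L θ).toLinearMap μ}

/-- Stable set: sharpness at most `2/η`, and the gradient is orthogonal to the top eigenvector(s)
of the Hessian. -/
def stableSet {d : ℕ} (L : Param d → ℝ) (η : ℝ) : Set (Param d) :=
  {θ | sharpness L θ ≤ 2 / η ∧
    ∀ w : Param d, hess L θ w = sharpness L θ • w → inner ℝ (gradient L θ) w = 0}

/-- `q` is an orthogonal projection (a nearest point) of `p` in `M`. -/
def IsProjection {d : ℕ} (M : Set (Param d)) (p q : Param d) : Prop :=
  q ∈ M ∧ ∀ m ∈ M, ‖p - q‖ ≤ ‖p - m‖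

/-- `P_u^⊥ v` for a unit vector `u`. -/
noncomputable def perp {d : ℕ} (u v : Param d) : Param d := v - (inner ℝ u v : ℝ) • u

/-! ### Mini-batch SGD -/

/-- Mini-batch gradient `g_A(θ)` for a batch `A` of size `b`. -/
noncomputable def batchGrad {d n : ℕ} (ℓ : Fin n → Param d → ℝ) (b : ℕ) (A : Finset (Fin n))
    (θ : Param d) : Param d :=
  (b : ℝ)⁻¹ • ∑ i ∈ A, gradient (ℓ i) θ

/-- Gradient noise `g_A(θ) - ∇L(θ)`. -/
noncomputable def gradNoise {d n : ℕ} (ℓ : Fin n → Param d → ℝ) (b : ℕ) (A : Finset (Fin n))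
    (θ : Param d) : Param d :=
  batchGrad ℓ b A θ - gradient (loss ℓ) θ

/-- Projected noise variance `uᵀ Σ_b(θ) u`, with `Σ_b(θ)` the covariance of the mini-batch gradient
at `θ` for a uniformly drawn batch of size `b`. -/
noncomputable def noiseVar {d n : ℕ} (ℓ : Fin n → Param d → ℝ) (b : ℕ) (u θ : Param d) : ℝ :=
  ((n.choose b : ℕ) : ℝ)⁻¹ *
    ∑ A ∈ (Finset.univ : Finset (Fin n)).powersetCard b, (inner ℝ u (gradNoise ℓ b A θ)) ^ 2

/-- SGD iterates started at `θ₀` with batches `B 0, B 1, …`. -/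
noncomputable def sgd {d n : ℕ} (ℓ : Fin n → Param d → ℝ) (b : ℕ) (η : ℝ) (θ₀ : Param d)
    (B : ℕ → Finset (Fin n)) : ℕ → Param d
  | 0 => θ₀
  | t + 1 => sgd ℓ b η θ₀ B t - η • batchGrad ℓ b (B t) (sgd ℓ b η θ₀ B t)

/-! ### The deterministic data of a problem -/

/-- The deterministic data: sample losses, batch size, step size, horizon `T`, reference trajectory
`ref t`, top eigenvectors `u t` along it, a neighbourhood `N` of it and regularity constants. -/
structure Problem (d n : ℕ) where
  ℓ : Fin n → Param d → ℝ
  b : ℕ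
  η : ℝ
  T : ℕ
  ref : ℕ → Param d
  u : ℕ → Param d
  N : Set (Param d)
  ρ3 : ℝ
  ρ4 : ℝ

namespace Problem

variable {d n : ℕ}

/-- The training loss. -/
noncomputable def L (p : Problem d n) : Param d → ℝ := loss p.ℓ

/-- `∇S_t`. -/
noncomputable def gradS (p : Problem d n) (t : ℕ) : Param d := gradient (sharpness p.L) (p.ref t)

/-- `∇S_t^⊥`. -/
noncomputable def gradSperp (p : Problem d n) (t : ℕ) : Param d := perp (p.u t) (p.gradS t)

/-- `κ_t`. -/
noncomputable def kappa (p : Problem d n) (t : ℕ) : ℝ := inner ℝ (p.gradS t) (p.u t)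

/-- `α_t`. -/
noncomputable def alpha (p : Problem d n) (t : ℕ) : ℝ :=
  -inner ℝ (gradient p.L (p.ref t)) (p.gradS t)

/-- `β_t`. -/
noncomputable def beta (p : Problem d n) (t : ℕ) : ℝ := ‖p.gradSperp t‖ ^ 2

/-- `δ_t`. -/
noncomputable def deltaAt (p : Problem d n) (t : ℕ) : ℝ := √(2 * p.alpha t / p.beta t)

/-- `ε_t`. -/
noncomputable def epsAt (p : Problem d n) (t : ℕ) : ℝ := p.η * √(p.alpha t)

/-- `δ = sup_{t ≤ T} δ_t`. -/
noncomputable def δ (p : Problem d n) : ℝ := ⨆ t : Fin (p.T + 1), p.deltaAt t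

/-- `ε = sup_{t ≤ T} ε_t`. -/
noncomputable def ε (p : Problem d n) : ℝ := ⨆ t : Fin (p.T + 1), p.epsAt t

/-- The stochastic predicted dynamics `v̂_t`, driven by a noise sequence `ξ`. -/
noncomputable def predicted (p : Problem d n) (v₀ : Param d) (ξ : ℕ → Param d) : ℕ → Param d
  | 0 => v₀
  | t + 1 =>
    let v := p.predicted v₀ ξ t
    let x : ℝ := inner ℝ (p.u t) v
    let y : ℝ := inner ℝ (p.gradSperp t) v
    let w := perp (p.u t) v
    perp (p.u (t + 1))
        ((w - p.η • hess p.L (p.ref t) w)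
          + (p.η * ((p.deltaAt t ^ 2 - x ^ 2) / 2)) • p.gradSperp t)
      - ((1 + p.η * y) * x + p.η / 2 * p.kappa t * x ^ 2) • p.u (t + 1)
      - p.η • ξ t

end Problem

/-- The absolute constants hidden in the assumptions. -/
structure Constants where
  cgap : ℝ
  cα : ℝ
  cβ : ℝ
  Cnw : ℝ
  Cξ : ℝ
  C4 : ℝ
  cT : ℝ
  c0 : ℝ
  cκ : ℝ
  Cdec : ℝ

/-- Setting and landscape assumptions along the reference trajectory, `t ≤ T`. -/
structure Landscape {d n : ℕ} (c : Constants) (p : Problem d n) : Prop where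
  η_pos : 0 < p.η
  one_le_b : 1 ≤ p.b
  b_le_n : p.b ≤ n
  /-- the gradients used by SGD exist -/
  differentiable : ∀ i, Differentiable ℝ (p.ℓ i)
  /-- the reference trajectory starts at the edge of stability … -/
  ref_zero_mem : p.ref 0 ∈ stableSet p.L p.η
  sharpness_zero : sharpness p.L (p.ref 0) = 2 / p.η
  /-- … and follows projected gradient descent on the stable set -/
  pgd : ∀ t < p.T, IsProjection (stableSet p.L p.η)
    (p.ref t - p.η • gradient p.L (p.ref t)) (p.ref (t + 1))
  u_unit : ∀ t ≤ p.T, ‖p.u t‖ = 1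
  u_top : ∀ t ≤ p.T, hess p.L (p.ref t) (p.u t) = sharpness p.L (p.ref t) • p.u t
  /-- eigengap: all eigenvalues of `H_t` on `u_t^⊥` are below `cgap / η` -/
  eigengap : ∀ t ≤ p.T, ∀ (μ : ℝ) (w : Param d), w ≠ 0 → inner ℝ (p.u t) w = 0 →
    hess p.L (p.ref t) w = μ • w → μ < c.cgap / p.η
  /-- regularity of higher derivatives on a neighbourhood `N` of the reference trajectory -/
  ρ3_pos : 0 < p.ρ3
  N_open : IsOpen p.N
  N_ball : ∀ t ≤ p.T, Metric.ball (p.ref t) ((2 - c.cgap) / (4 * p.η * p.ρ3)) ⊆ p.N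
  contDiff : ∀ i, ContDiffOn ℝ 4 (p.ℓ i) p.N
  third_bound : ∀ θ ∈ p.N, ‖third p.L θ‖ ≤ p.ρ3
  third_lipschitz : ∀ θ ∈ p.N, ∀ θ' ∈ p.N, ‖third p.L θ - third p.L θ'‖ ≤ p.ρ4 * ‖θ - θ'‖
  /-- progressive sharpening -/
  alpha_ge : ∀ t ≤ p.T, c.cα * (‖gradient p.L (p.ref t)‖ * ‖p.gradSperp t‖) ≤ p.alpha t
  gradSperp_ge : ∀ t ≤ p.T, c.cβ * p.ρ3 ≤ ‖p.gradSperp t‖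
  /-- non-worst-case bounds -/
  nonworst_third : ∀ t ≤ p.T, ∀ v w : Param d, inner ℝ (p.u t) v = 0 → inner ℝ (p.u t) w = 0 →
    ‖third p.L (p.ref t) v w‖ ≤ c.Cnw * p.ε * (p.ρ3 * ‖v‖ * ‖w‖)
  nonworst_hess : ∀ t ≤ p.T, ∀ v : Param d, inner ℝ (p.u t) v = 0 →
    |inner ℝ v (hess p.L (p.ref t) v)| ≤ c.Cnw * p.ε * (‖hess p.L (p.ref t)‖ * ‖v‖ ^ 2)
  nonworst_min : ∀ t ≤ p.T, |minEig p.L (p.ref t)| ≤ c.Cnw * p.ε * ‖hess p.L (p.ref t)‖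
  /-- scaling -/
  T_le : (p.T : ℝ) ≤ c.cT / p.ε
  ρ4_le : p.ρ4 ≤ c.C4 * (p.η * p.ρ3 ^ 2)

/-- Frozen coefficients on the window `0 ≤ t ≤ T`. -/
structure Frozen {d n : ℕ} (c : Constants) (p : Problem d n) : Prop where
  hess_const : ∀ t ≤ p.T, hess p.L (p.ref t) = hess p.L (p.ref 0)
  u_const : ∀ t ≤ p.T, p.u t = p.u 0
  gradSperp_const : ∀ t ≤ p.T, p.gradSperp t = p.gradSperp 0
  alpha_const : ∀ t ≤ p.T, p.alpha t = p.alpha 0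
  kappa_const : ∀ t ≤ p.T, p.kappa t = p.kappa 0
  alpha_pos : 0 < p.alpha 0
  beta_pos : 0 < p.beta 0
  kappa_le : |p.kappa 0| ≤ c.cκ * (p.ε * p.ρ3)
  /-- `∇S^⊥ ∈ ker (H|_{u^⊥})` -/
  gradSperp_ker : hess p.L (p.ref 0) (p.gradSperp 0) = 0

/-! ### The random trajectories -/

section Random

variable {d n : ℕ} {Ω : Type*}

/-- SGD trajectory `θ_t`. -/
noncomputable def iter (p : Problem d n) (θ₀ : Ω → Param d) (B : ℕ → Ω → Finset (Fin n))
    (t : ℕ) (ω : Ω) : Param d :=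
  sgd p.ℓ p.b p.η (θ₀ ω) (fun s => B s ω) t

/-- Gradient noise `ξ_t` along the SGD trajectory. -/
noncomputable def xi (p : Problem d n) (θ₀ : Ω → Param d) (B : ℕ → Ω → Finset (Fin n))
    (t : ℕ) (ω : Ω) : Param d :=
  gradNoise p.ℓ p.b (B t ω) (iter p θ₀ B t ω)

/-- Displacement `v_t = θ_t - ref_t`. -/
noncomputable def disp (p : Problem d n) (θ₀ : Ω → Param d) (B : ℕ → Ω → Finset (Fin n))
    (t : ℕ) (ω : Ω) : Param d :=
  iter p θ₀ B t ω - p.ref t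

/-- Predicted displacement `v̂_t`, started at `v̂_0 = v_0` and driven by the SGD noise. -/
noncomputable def dispHat (p : Problem d n) (θ₀ : Ω → Param d) (B : ℕ → Ω → Finset (Fin n))
    (t : ℕ) (ω : Ω) : Param d :=
  p.predicted (disp p θ₀ B 0 ω) (fun s => xi p θ₀ B s ω) t

/-- `x̂_t`. -/
noncomputable def xHat (p : Problem d n) (θ₀ : Ω → Param d) (B : ℕ → Ω → Finset (Fin n))
    (t : ℕ) (ω : Ω) : ℝ :=
  inner ℝ (p.u t) (dispHat p θ₀ B t ω)

/-- `ŷ_t`. -/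
noncomputable def yHat (p : Problem d n) (θ₀ : Ω → Param d) (B : ℕ → Ω → Finset (Fin n))
    (t : ℕ) (ω : Ω) : ℝ :=
  inner ℝ (p.gradSperp t) (dispHat p θ₀ B t ω)

/-- The event that the coupling bounds hold with constant `K` at all times `s ≤ t`. -/
def good (p : Problem d n) (θ₀ : Ω → Param d) (B : ℕ → Ω → Finset (Fin n)) (K : ℝ) (t : ℕ) :
    Set Ω :=
  {ω | ∀ s ≤ t, ‖disp p θ₀ B s ω‖ ≤ K * p.δ ∧ ‖dispHat p θ₀ B s ω‖ ≤ K * p.δ ∧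
    ‖disp p θ₀ B s ω - dispHat p θ₀ B s ω‖ ≤ K * (p.ε * p.δ)}

/-- The information `σ(θ₀, B_0, …, B_{t-1})` available before step `t`. -/
abbrev past (θ₀ : Ω → Param d) (B : ℕ → Ω → Finset (Fin n)) (t : ℕ) : MeasurableSpace Ω :=
  MeasurableSpace.comap θ₀ inferInstance ⊔ ⨆ s : Fin t, MeasurableSpace.comap (B s) ⊤

/-- Mini-batch sampling (each `B t` is uniform among the batches of size `b` and independent of the
past), initialization at distance `O(δ)` from the reference trajectory, and the noise scaling. -/
structure Sampling [MeasurableSpace Ω] (c : Constants) (p : Problem d n) (P : Measure Ω)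
    (θ₀ : Ω → Param d) (B : ℕ → Ω → Finset (Fin n)) : Prop where
  measurable_init : Measurable θ₀
  measurable_batch : ∀ t A, MeasurableSet {ω | B t ω = A}
  uniform_indep : ∀ (t : ℕ) (A : Finset (Fin n)), A.card = p.b → ∀ E : Set Ω,
    MeasurableSet[past θ₀ B t] E →
      P ({ω | B t ω = A} ∩ E) = P E / ((n.choose p.b : ℕ) : ENNReal)
  init_le : ∀ᵐ ω ∂P, ‖disp p θ₀ B 0 ω‖ ^ 2 ≤ c.c0 * p.δ ^ 2
  noise_le : ∀ t < p.T, ∫⁻ ω, ‖xi p θ₀ B t ω‖ₑ ^ 2 ∂P ≤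
    ENNReal.ofReal (c.Cξ * (p.ε * p.δ ^ 2 / p.η ^ 2))

/-- Stationarity at time `t` under `Q`: one step of the predicted dynamics leaves the joint law of
`(x̂_t, ŷ_t)` invariant. -/
def Stationary [MeasurableSpace Ω] (p : Problem d n) (Q : Measure Ω)
    (θ₀ : Ω → Param d) (B : ℕ → Ω → Finset (Fin n)) (t : ℕ) : Prop :=
  Q.map (fun ω => (xHat p θ₀ B (t + 1) ω, yHat p θ₀ B (t + 1) ω)) =
    Q.map (fun ω => (xHat p θ₀ B t ω, yHat p θ₀ B t ω))

/-- Mean-field decorrelation at time `t` under `Q`. -/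
def Decorrelated [MeasurableSpace Ω] (c : Constants) (p : Problem d n) (Q : Measure Ω)
    (θ₀ : Ω → Param d) (B : ℕ → Ω → Finset (Fin n)) (t : ℕ) : Prop :=
  |(∫ ω, (1 + p.η * yHat p θ₀ B t ω) ^ 2 * xHat p θ₀ B t ω ^ 2 ∂Q)
      - (1 + p.η * ∫ ω, yHat p θ₀ B t ω ∂Q) ^ 2 * ∫ ω, xHat p θ₀ B t ω ^ 2 ∂Q|
    ≤ c.Cdec * (p.ε ^ 2 * p.δ ^ 2)

/-- The equilibrium noise variance `σ_u²`: the mean of `uᵀ Σ_b(θ_t) u` under `Q`. -/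
noncomputable def sigmaSq [MeasurableSpace Ω] (p : Problem d n) (Q : Measure Ω)
    (θ₀ : Ω → Param d) (B : ℕ → Ω → Finset (Fin n)) (t : ℕ) : ℝ :=
  ∫ ω, noiseVar p.ℓ p.b (p.u t) (iter p θ₀ B t ω) ∂Q

end Random

end StochasticSelfStabilization

/-! Everything rests on the scales `η ‖∇S^⊥‖ δ = √2 ε` and `η ρ₃ δ = O(ε)`: a displacement of size
`δ` changes the Hessian by `O(ε / η)`, far less than the eigengap. Since the Hessian is frozen along
the reference trajectory, its sharpness stays equal to `2 / η`, and perturbation theory around the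
simple top eigenvalue gives `S(θ† + v) = 2/η + ⟨∇³L(u,u), v⟩ + O(η ρ₃² ‖v‖²)`; in particular `∇S =
∇³L(u,u)`.

Reference step. The nearest point of the stable set differs from the gradient step by `-(η δ²/2)
∇S^⊥ + O(ε² δ)` (`exists_reference_step_bound`). An explicit point of the stable set bounds the
distance from above, and equality of the Hessians at consecutive reference points forces a component
of almost that length along `-∇S^⊥`.

Coupling. A second-order Taylor expansion of the gradient then shows that one step of SGD agrees
with one step of the predicted dynamics up to `O(ε² δ)` (`exists_dispStep_bound`). Both are driven
by the same noise, which cancels in the difference, and the noiseless predicted step is `(1 +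
O(ε))`-Lipschitz on balls of radius `O(δ)`. Over `O(1/ε)` steps a discrete Grönwall argument gives a
total error `O(ε δ)` (`exists_coupling_bound`).

Confinement. The function `V = x²/2 + ‖v^⊥‖²` is chosen so that the cubic interaction terms between
`x̂` and `ŷ` cancel. Thus `V` grows in mean by a factor `1 + A ε` plus `O(ε δ²)` per step, with `A`
independent of the radius `K δ` of the region. Stopping `V` at the exit from this region and using
Markov's inequality bounds the exit probability by a constant over `K²`
(`exists_predictedBounded_prob`).

Equilibrium. The event `G_t` belongs to the past of step `t`, so the noise stays centred after
conditioning. Invariance of `E ŷ` gives `E x̂² = δ²`. Invariance of `E x̂²`, with decorrelation,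
gives `2 η E[ŷ] δ² + η² σ_u² = O(ε² δ²)`, hence the shift of `ŷ` (`stationary_moments`). On `G_t`
the sharpness is `2/η + ŷ_t + O(ε²/η)`, which transfers the shift to `S(θ_t)`. -/

namespace StochasticSelfStabilization

open scoped InnerProductSpace

/-! ### Perturbation theory of the top eigenvalue of a symmetric operator -/

section SymmetricOperators

/-- Largest eigenvalue of an operator. -/
noncomputable def topEig {d : ℕ} (T : Param d →L[ℝ] Param d) : ℝ :=
  sSup {μ : ℝ | Module.End.HasEigenvalue T.toLinearMap μ}

variable {d : ℕ} {T A B : Param d →L[ℝ] Param d}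

theorem sharpness_eq_topEig (L : Param d → ℝ) (θ : Param d) :
    sharpness L θ = topEig (hess L θ) := rfl

/-- In finite dimension the supremum of the Rayleigh quotient is an eigenvalue, and every eigenvalue
is a Rayleigh quotient. The vector `u` only witnesses that the space is nontrivial. -/
theorem exists_topEig_eigenvector_and_rayleigh_le
    (hT : ∀ v w, ⟪T v, w⟫_ℝ = ⟪v, T w⟫_ℝ) {u : Param d} (hu : u ≠ 0) :
    (∃ w, ‖w‖ = 1 ∧ T w = topEig T • w) ∧ ∀ v, ⟪T v, v⟫_ℝ ≤ topEig T * ‖v‖ ^ 2 := by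
  have : Nontrivial (Param d) := ⟨⟨u, 0, hu⟩⟩
  have hsym : T.toLinearMap.IsSymmetric := hT
  have hbdd : BddAbove (Set.range fun x : {x : Param d // x ≠ 0} =>
      (⟪T.toLinearMap x, x⟫_ℝ / ‖(x : Param d)‖ ^ 2 : ℝ)) := by
    refine ⟨‖T‖, ?_⟩
    rintro _ ⟨x, rfl⟩
    have hx : 0 < ‖(x : Param d)‖ := norm_pos_iff.2 x.2
    refine (div_le_iff₀ (by positivity)).2 ?_
    calc ⟪T.toLinearMap x, (x : Param d)⟫_ℝ ≤ ‖T x‖ * ‖(x : Param d)‖ := real_inner_le_norm _ _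
      _ ≤ ‖T‖ * ‖(x : Param d)‖ * ‖(x : Param d)‖ := by gcongr; exact T.le_opNorm _
      _ = _ := by ring
  set s : ℝ := ⨆ x : {x : Param d // x ≠ 0}, ⟪T.toLinearMap x, x⟫_ℝ / ‖(x : Param d)‖ ^ 2 with hs
  have heig : Module.End.HasEigenvalue T.toLinearMap s := by
    exact hsym.hasEigenvalue_iSup_of_finiteDimensional
  have hray : ∀ v, ⟪T v, v⟫_ℝ ≤ s * ‖v‖ ^ 2 := by
    intro v
    rcases eq_or_ne v 0 with rfl | hv
    · simp
    · have hv' : 0 < ‖v‖ := norm_pos_iff.2 hv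
      exact (div_le_iff₀ (by positivity)).1 (le_ciSup hbdd ⟨v, hv⟩)
  have htop : topEig T = s := by
    refine IsGreatest.csSup_eq ⟨heig, ?_⟩
    intro μ hμ
    obtain ⟨w, hw⟩ := Module.End.HasEigenvalue.exists_hasEigenvector hμ
    have h1 : T w = μ • w := hw.apply_eq_smul
    have h2 := hray w
    have hw' : 0 < ‖w‖ := norm_pos_iff.2 hw.2
    rw [h1, real_inner_smul_left, real_inner_self_eq_norm_sq] at h2
    exact le_of_mul_le_mul_right h2 (by positivity)
  rw [htop]
  refine ⟨?_, hray⟩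
  obtain ⟨w, hw⟩ := heig.exists_hasEigenvector
  have h1 : T w = s • w := hw.apply_eq_smul
  have hw' : ‖w‖ ≠ 0 := norm_ne_zero_iff.2 hw.2
  refine ⟨‖w‖⁻¹ • w, ?_, ?_⟩
  · rw [norm_smul, norm_inv, norm_norm, inv_mul_cancel₀ hw']
  · rw [map_smul, h1, smul_comm]

theorem inner_le_topEig (hT : ∀ v w, ⟪T v, w⟫_ℝ = ⟪v, T w⟫_ℝ) (v : Param d) :
    ⟪T v, v⟫_ℝ ≤ topEig T * ‖v‖ ^ 2 := by
  rcases eq_or_ne v 0 with rfl | hv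
  · simp
  · exact (exists_topEig_eigenvector_and_rayleigh_le hT hv).2 v

theorem topEig_le_of_rayleigh_le (hT : ∀ v w, ⟪T v, w⟫_ℝ = ⟪v, T w⟫_ℝ) {u : Param d} (hu : u ≠ 0)
    {c : ℝ} (h : ∀ v, ⟪T v, v⟫_ℝ ≤ c * ‖v‖ ^ 2) : topEig T ≤ c := by
  obtain ⟨w, hw1, hw⟩ := (exists_topEig_eigenvector_and_rayleigh_le hT hu).1
  have := h w
  rwa [hw, real_inner_smul_left, real_inner_self_eq_norm_sq, hw1, one_pow, mul_one, mul_one] at this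

theorem inner_map_le_opNorm (M : Param d →L[ℝ] Param d) (v w : Param d) :
    |⟪M v, w⟫_ℝ| ≤ ‖M‖ * ‖v‖ * ‖w‖ :=
  (abs_real_inner_le_norm _ _).trans (by gcongr; exact M.le_opNorm v)

/-- Weyl's inequality: the Rayleigh quotients of the two operators differ by at most `‖A - B‖`. -/
theorem abs_topEig_sub_le (hA : ∀ v w, ⟪A v, w⟫_ℝ = ⟪v, A w⟫_ℝ)
    (hB : ∀ v w, ⟪B v, w⟫_ℝ = ⟪v, B w⟫_ℝ) {u : Param d} (hu : u ≠ 0) :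
    |topEig A - topEig B| ≤ ‖A - B‖ := by
  have key : ∀ A B : Param d →L[ℝ] Param d, (∀ v w, ⟪A v, w⟫_ℝ = ⟪v, A w⟫_ℝ) →
      (∀ v w, ⟪B v, w⟫_ℝ = ⟪v, B w⟫_ℝ) → topEig A ≤ topEig B + ‖A - B‖ := by
    intro A B hA hB
    refine topEig_le_of_rayleigh_le hA hu fun v => ?_
    have h1 := inner_le_topEig hB v
    have h2 := (abs_le.1 (inner_map_le_opNorm (A - B) v v)).2
    have h3 : ⟪A v, v⟫_ℝ = ⟪B v, v⟫_ℝ + ⟪(A - B) v, v⟫_ℝ := by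
      rw [← inner_add_left]; simp
    rw [h3]; nlinarith
  rw [abs_sub_le_iff]
  constructor
  · linarith [key A B hA hB]
  · have := key B A hB hA
    rw [norm_sub_rev] at this
    linarith

/-- Decomposition along a unit vector. -/
theorem inner_perp_right {u : Param d} (hu : ‖u‖ = 1) (v : Param d) : ⟪u, perp u v⟫_ℝ = 0 := by
  simp [perp, inner_sub_right, real_inner_smul_right, hu]

theorem inner_smul_add_perp (u v : Param d) : v = ⟪u, v⟫_ℝ • u + perp u v := by
  simp [perp]

theorem norm_sq_eq_inner_sq_add {u : Param d} (hu : ‖u‖ = 1) (v : Param d) :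
    ‖v‖ ^ 2 = ⟪u, v⟫_ℝ ^ 2 + ‖perp u v‖ ^ 2 := by
  rw [perp, norm_sub_sq_real, norm_smul, real_inner_smul_right, hu, real_inner_comm,
    Real.norm_eq_abs, mul_one, sq_abs, real_inner_comm]
  ring

theorem perp_eq_self {u w : Param d} (hw : ⟪u, w⟫_ℝ = 0) : perp u w = w := by
  simp [perp, hw]

theorem norm_perp_le {u : Param d} (hu : ‖u‖ = 1) (v : Param d) : ‖perp u v‖ ≤ ‖v‖ := by
  refine (sq_le_sq₀ (norm_nonneg _) (norm_nonneg _)).1 ?_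
  rw [norm_sq_eq_inner_sq_add hu v]
  nlinarith [sq_nonneg (⟪u, v⟫_ℝ)]

/-- A symmetric operator `A` with a simple top eigenvalue `s` (unit eigenvector `u`), the rest of the
spectrum being at most `t`, and operators `m`-close to it with remaining gap at least `k`. -/
structure SpectralGap (A : Param d →L[ℝ] Param d) (u : Param d) (s t m k : ℝ) : Prop where
  symm : ∀ v w, ⟪A v, w⟫_ℝ = ⟪v, A w⟫_ℝ
  unit : ‖u‖ = 1
  eig : A u = s • u
  le_perp : ∀ w, ⟪u, w⟫_ℝ = 0 → ⟪A w, w⟫_ℝ ≤ t * ‖w‖ ^ 2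
  m_nonneg : 0 ≤ m
  k_pos : 0 < k
  gap : k ≤ s - t - 2 * m

namespace SpectralGap

variable {u : Param d} {s t m k : ℝ}

theorem ne_zero (h : SpectralGap A u s t m k) : u ≠ 0 := by
  intro h0; have := h.unit; simp [h0] at this

theorem inner_self_ge (h : SpectralGap A u s t m k) (hm : ‖B - A‖ ≤ m) : s - m ≤ ⟪B u, u⟫_ℝ := by
  have h1 := (abs_le.1 (inner_map_le_opNorm (B - A) u u)).1
  have h3 : ⟪B u, u⟫_ℝ = ⟪A u, u⟫_ℝ + ⟪(B - A) u, u⟫_ℝ := by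
    rw [← inner_add_left]; simp
  rw [h3, h.eig, real_inner_smul_left, real_inner_self_eq_norm_sq, h.unit]
  rw [h.unit] at h1
  linarith

theorem inner_perp_le (h : SpectralGap A u s t m k) (hm : ‖B - A‖ ≤ m) {w : Param d}
    (hw : ⟪u, w⟫_ℝ = 0) : ⟪B w, w⟫_ℝ ≤ (t + m) * ‖w‖ ^ 2 := by
  have h1 := (abs_le.1 (inner_map_le_opNorm (B - A) w w)).2
  have h2 := h.le_perp w hw
  have h3 : ⟪B w, w⟫_ℝ = ⟪A w, w⟫_ℝ + ⟪(B - A) w, w⟫_ℝ := by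
    rw [← inner_add_left]; simp
  rw [h3]; nlinarith [mul_le_mul_of_nonneg_right hm (sq_nonneg ‖w‖)]

theorem abs_inner_cross_le (h : SpectralGap A u s t m k) (hm : ‖B - A‖ ≤ m) {w : Param d}
    (hw : ⟪u, w⟫_ℝ = 0) : |⟪B u, w⟫_ℝ| ≤ m * ‖w‖ := by
  have h1 := inner_map_le_opNorm (B - A) u w
  have h3 : ⟪B u, w⟫_ℝ = ⟪A u, w⟫_ℝ + ⟪(B - A) u, w⟫_ℝ := by
    rw [← inner_add_left]; simp
  rw [h3, h.eig, real_inner_smul_left, hw, mul_zero, zero_add]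
  rw [h.unit, mul_one] at h1
  exact h1.trans (by gcongr)

theorem inner_self_le_topEig (h : SpectralGap A u s t m k)
    (hB : ∀ v w, ⟪B v, w⟫_ℝ = ⟪v, B w⟫_ℝ) : ⟪B u, u⟫_ℝ ≤ topEig B := by
  simpa [h.unit] using inner_le_topEig hB u

/-- The cross term between `u` and its complement is at most `m`, and the gap absorbs it at the cost
of `m² / k`. The error being quadratic in the perturbation, `⟪B u, u⟫` gives the top eigenvalue to
first order. -/
theorem topEig_le (h : SpectralGap A u s t m k) (hB : ∀ v w, ⟪B v, w⟫_ℝ = ⟪v, B w⟫_ℝ)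
    (hm : ‖B - A‖ ≤ m) : topEig B ≤ ⟪B u, u⟫_ℝ + m ^ 2 / k := by
  refine topEig_le_of_rayleigh_le hB h.ne_zero fun v => ?_
  set a := ⟪u, v⟫_ℝ
  set w := perp u v with hwdef
  have hw : ⟪u, w⟫_ℝ = 0 := inner_perp_right h.unit v
  have hv : v = a • u + w := inner_smul_add_perp u v
  have hn : ‖v‖ ^ 2 = a ^ 2 + ‖w‖ ^ 2 := norm_sq_eq_inner_sq_add h.unit v
  have h1 := h.inner_self_ge hm
  have h2 := h.inner_perp_le hm hw
  have h3 := h.abs_inner_cross_le hm hw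
  have h4 : ⟪B v, v⟫_ℝ = a ^ 2 * ⟪B u, u⟫_ℝ + 2 * a * ⟪B u, w⟫_ℝ + ⟪B w, w⟫_ℝ := by
    conv_lhs => rw [hv]
    rw [map_add, map_smul, inner_add_left, inner_add_right, inner_add_right, real_inner_smul_left,
      real_inner_smul_left, real_inner_smul_right, real_inner_smul_right, hB w u,
      real_inner_comm (B u) w]
    ring
  rw [h4, hn]
  have hk := h.k_pos
  have hg := h.gap
  -- Weighted AM-GM, with weights such that `k ‖w‖²` is exactly what the gap can absorb.
  have h5 : 2 * a * ⟪B u, w⟫_ℝ ≤ m ^ 2 / k * a ^ 2 + k * ‖w‖ ^ 2 := by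
    have h6 : 2 * a * ⟪B u, w⟫_ℝ ≤ 2 * (|a| * (m * ‖w‖)) := by
      have : a * ⟪B u, w⟫_ℝ ≤ |a| * (m * ‖w‖) := by
        refine (le_abs_self _).trans ?_
        rw [abs_mul]; gcongr
      linarith
    refine h6.trans ?_
    have h7 : m ^ 2 / k * a ^ 2 + k * ‖w‖ ^ 2 - 2 * (|a| * (m * ‖w‖)) =
        (m * |a| - k * ‖w‖) ^ 2 / k := by
      field_simp
      rw [← sq_abs a]; ring
    have h8 : 0 ≤ (m * |a| - k * ‖w‖) ^ 2 / k := by positivity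
    linarith
  have h9 : 0 ≤ m ^ 2 / k := by positivity
  nlinarith [mul_nonneg h9 (sq_nonneg ‖w‖), mul_nonneg (sub_nonneg.2 h1) (sq_nonneg ‖w‖),
    mul_nonneg (sub_nonneg.2 hg) (sq_nonneg ‖w‖)]

/-- Two perturbations of `A` have close normalized top eigenvectors. -/
theorem norm_eigenvector_sub_le {B' : Param d →L[ℝ] Param d} (h : SpectralGap A u s t m k)
    (hB : ∀ v w, ⟪B v, w⟫_ℝ = ⟪v, B w⟫_ℝ) (hB' : ∀ v w, ⟪B' v, w⟫_ℝ = ⟪v, B' w⟫_ℝ)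
    (hm : ‖B - A‖ ≤ m)
    {w w' : Param d} (hw : B w = topEig B • w) (hw' : B' w' = topEig B' • w')
    (h1 : ⟪u, w⟫_ℝ = 1) (h1' : ⟪u, w'⟫_ℝ = 1) :
    k * ‖w - w'‖ ≤ 2 * ‖B - B'‖ * ‖w'‖ := by
  set z := w - w' with hz
  have hzu : ⟪u, z⟫_ℝ = 0 := by rw [hz, inner_sub_right, h1, h1', sub_self]
  have h2 := h.inner_perp_le hm hzu
  have h3 := (h.inner_self_ge hm).trans (h.inner_self_le_topEig hB)
  have h4 := abs_topEig_sub_le hB hB' h.ne_zero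
  -- Subtracting the two eigenvector equations expresses `(topEig B - B) z` through `B - B'`; on `z
  -- ⊥ u` this operator is bounded below by the gap.
  have h5 : topEig B * ‖z‖ ^ 2 - ⟪B z, z⟫_ℝ =
      ⟪(B - B') w', z⟫_ℝ - (topEig B - topEig B') * ⟪w', z⟫_ℝ := by
    have e1 : B z = topEig B • z + topEig B • w' - B w' := by
      rw [hz, map_sub, hw, smul_sub]; abel
    have e2 : (B - B') w' = B w' - topEig B' • w' := by rw [sub_apply, hw']
    rw [e1, e2, inner_sub_left, inner_sub_left, inner_add_left, real_inner_smul_left,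
      real_inner_smul_left, real_inner_smul_left, real_inner_self_eq_norm_sq]
    ring
  have h6 := (abs_le.1 (inner_map_le_opNorm (B - B') w' z)).2
  have h7 : -((topEig B - topEig B') * ⟪w', z⟫_ℝ) ≤ ‖B - B'‖ * (‖w'‖ * ‖z‖) := by
    refine (neg_le_abs _).trans ?_
    rw [abs_mul]
    gcongr
    exact abs_real_inner_le_norm _ _
  have h8 : k * ‖z‖ ^ 2 ≤ (2 * ‖B - B'‖ * ‖w'‖) * ‖z‖ := by
    have hg := h.gap
    nlinarith [mul_nonneg (sub_nonneg.2 h3) (sq_nonneg ‖z‖),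
      mul_nonneg (sub_nonneg.2 hg) (sq_nonneg ‖z‖)]
  rcases (norm_nonneg z).eq_or_lt with h0 | h0
  · rw [← h0]; simp; positivity
  · rw [pow_two, ← mul_assoc] at h8
    exact le_of_mul_le_mul_right h8 h0

/-- A top eigenvector of `B` orthogonal to `u` would have a Rayleigh quotient at most `t + m < s -
m`, so the top eigenspace is a line transversal to `u`. The normalization `⟪u, w⟫ = 1`, unlike unit
length, leaves no sign to choose; this permits a continuous choice along a path. -/
theorem exists_eigenvector (h : SpectralGap A u s t m k)
    (hB : ∀ v w, ⟪B v, w⟫_ℝ = ⟪v, B w⟫_ℝ) (hm : ‖B - A‖ ≤ m) :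
    ∃ w, ⟪u, w⟫_ℝ = 1 ∧ B w = topEig B • w ∧ k * ‖w - u‖ ≤ m ∧
      ∀ w', B w' = topEig B • w' → w' = ⟪u, w'⟫_ℝ • w := by
  have hne : ∀ w', B w' = topEig B • w' → ⟪u, w'⟫_ℝ = 0 → w' = 0 := by
    intro w' hw' h0
    by_contra hne
    have hp : 0 < ‖w'‖ := norm_pos_iff.2 hne
    have h2 := h.inner_perp_le hm h0
    rw [hw', real_inner_smul_left, real_inner_self_eq_norm_sq] at h2
    have h3 := (h.inner_self_ge hm).trans (h.inner_self_le_topEig hB)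
    have h4 := le_of_mul_le_mul_right h2 (by positivity)
    linarith [h.gap, h.k_pos, h.m_nonneg]
  obtain ⟨w0, hw0, hw0e⟩ := (exists_topEig_eigenvector_and_rayleigh_le hB h.ne_zero).1
  have hc : ⟪u, w0⟫_ℝ ≠ 0 := by
    intro h0
    have := hne w0 hw0e h0
    simp [this] at hw0
  set w := (⟪u, w0⟫_ℝ)⁻¹ • w0 with hwdef
  have hw1 : ⟪u, w⟫_ℝ = 1 := by rw [hwdef, real_inner_smul_right, inv_mul_cancel₀ hc]
  have hwe : B w = topEig B • w := by rw [hwdef, map_smul, hw0e, smul_comm]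
  refine ⟨w, hw1, hwe, ?_, ?_⟩
  · set z := w - u with hz
    have hzu : ⟪u, z⟫_ℝ = 0 := by
      rw [hz, inner_sub_right, hw1, real_inner_self_eq_norm_sq, h.unit]; norm_num
    have h2 := h.inner_perp_le hm hzu
    have h3 := (h.inner_self_ge hm).trans (h.inner_self_le_topEig hB)
    have h5 : topEig B * ‖z‖ ^ 2 - ⟪B z, z⟫_ℝ = ⟪B u, z⟫_ℝ := by
      have e1 : B z = topEig B • z + topEig B • u - B u := by
        rw [hz, map_sub, hwe, smul_sub]; abel
      rw [e1, inner_sub_left, inner_add_left, real_inner_smul_left,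
        real_inner_smul_left, real_inner_self_eq_norm_sq, hzu]
      ring
    have h6 := (abs_le.1 (h.abs_inner_cross_le hm hzu)).2
    have h8 : k * ‖z‖ ^ 2 ≤ m * ‖z‖ := by
      have hg := h.gap
      nlinarith [mul_nonneg (sub_nonneg.2 h3) (sq_nonneg ‖z‖),
        mul_nonneg (sub_nonneg.2 hg) (sq_nonneg ‖z‖)]
    rcases (norm_nonneg z).eq_or_lt with h0 | h0
    · rw [← h0]; simp; exact h.m_nonneg
    · rw [pow_two, ← mul_assoc] at h8
      exact le_of_mul_le_mul_right h8 h0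
  · intro w' hw'
    have : w' - ⟪u, w'⟫_ℝ • w = 0 := by
      apply hne
      · rw [map_sub, map_smul, hw', hwe, smul_sub, smul_comm]
      · rw [inner_sub_right, real_inner_smul_right, hw1, mul_one, sub_self]
    exact sub_eq_zero.1 this

end SpectralGap

end SymmetricOperators

/-! ### Symmetry of the derivatives and Taylor estimates for the gradient -/

section Calculus

variable {d : ℕ} {L : Param d → ℝ} {s : Set (Param d)} {θ : Param d}

theorem inner_gradient (x w : Param d) : ⟪gradient L x, w⟫_ℝ = fderiv ℝ L x w := by
  rw [gradient, InnerProductSpace.toDual_symm_apply]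

theorem contDiffOn_gradient (hs : IsOpen s) (hL : ContDiffOn ℝ 4 L s) :
    ContDiffOn ℝ 3 (gradient L) s := by
  have h : ContDiffOn ℝ 3 (fderiv ℝ L) s := hL.fderiv_of_isOpen hs (by norm_num)
  exact (InnerProductSpace.toDual ℝ (Param d)).symm.contDiff.comp_contDiffOn h

theorem contDiffOn_hess (hs : IsOpen s) (hL : ContDiffOn ℝ 4 L s) :
    ContDiffOn ℝ 2 (hess L) s :=
  (contDiffOn_gradient hs hL).fderiv_of_isOpen hs (by norm_num)

theorem hasFDerivAt_gradient (hs : IsOpen s) (hL : ContDiffOn ℝ 4 L s) (hθ : θ ∈ s) :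
    HasFDerivAt (gradient L) (hess L θ) θ :=
  (((contDiffOn_gradient hs hL).contDiffAt (hs.mem_nhds hθ)).differentiableAt
    (by norm_num)).hasFDerivAt

theorem hasFDerivAt_hess (hs : IsOpen s) (hL : ContDiffOn ℝ 4 L s) (hθ : θ ∈ s) :
    HasFDerivAt (hess L) (third L θ) θ :=
  (((contDiffOn_hess hs hL).contDiffAt (hs.mem_nhds hθ)).differentiableAt
    (by norm_num)).hasFDerivAt

theorem hess_symm (hs : IsOpen s) (hL : ContDiffOn ℝ 4 L s) (hθ : θ ∈ s) (v w : Param d) :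
    ⟪hess L θ v, w⟫_ℝ = ⟪v, hess L θ w⟫_ℝ := by
  have hsym : IsSymmSndFDerivAt ℝ L θ :=
    (hL.contDiffAt (hs.mem_nhds hθ)).isSymmSndFDerivAt (by simp; norm_num)
  have hd : DifferentiableAt ℝ (fderiv ℝ L) θ :=
    ((hL.fderiv_of_isOpen hs (m := 3) (by norm_num)).contDiffAt
      (hs.mem_nhds hθ)).differentiableAt (by norm_num)
  have key : ∀ v w, ⟪hess L θ v, w⟫_ℝ = fderiv ℝ (fderiv ℝ L) θ v w := by
    intro v w
    have h1 : HasFDerivAt (fun x => ⟪gradient L x, w⟫_ℝ)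
        ((innerSL ℝ w).comp (hess L θ)) θ := by
      have := (innerSL ℝ w).hasFDerivAt.comp θ (hasFDerivAt_gradient hs hL hθ)
      refine this.congr_of_eventuallyEq (Filter.Eventually.of_forall fun x => ?_)
      simp
    have h2 : HasFDerivAt (fun x => fderiv ℝ L x w)
        ((ContinuousLinearMap.apply ℝ ℝ w).comp (fderiv ℝ (fderiv ℝ L) θ)) θ :=
      (ContinuousLinearMap.apply ℝ ℝ w).hasFDerivAt.comp θ hd.hasFDerivAt
    have h3 : (fun x => ⟪gradient L x, w⟫_ℝ) = fun x => fderiv ℝ L x w :=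
      funext fun x => inner_gradient x w
    rw [h3] at h1
    have := DFunLike.congr_fun (h1.unique h2) v
    simpa [real_inner_comm] using this
  rw [key, hsym.eq, ← key, real_inner_comm]

theorem third_comm (hs : IsOpen s) (hL : ContDiffOn ℝ 4 L s) (hθ : θ ∈ s) (v w : Param d) :
    third L θ v w = third L θ w v := by
  have hsym : IsSymmSndFDerivAt ℝ (gradient L) θ :=
    ((contDiffOn_gradient hs hL).contDiffAt (hs.mem_nhds hθ)).isSymmSndFDerivAt
      (by simp; norm_num)
  exact hsym.eq v w

/-- Obtained by differentiating the symmetry of the Hessian; together with `third_comm` it makes the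
third derivative fully symmetric. -/
theorem third_symm (hs : IsOpen s) (hL : ContDiffOn ℝ 4 L s) (hθ : θ ∈ s) (v w z : Param d) :
    ⟪third L θ v w, z⟫_ℝ = ⟪w, third L θ v z⟫_ℝ := by
  have key : ∀ w z, HasFDerivAt (fun x => ⟪hess L x w, z⟫_ℝ)
      ((innerSL ℝ z).comp ((ContinuousLinearMap.apply ℝ (Param d) w).comp (third L θ))) θ := by
    intro w z
    have := (innerSL ℝ z).hasFDerivAt.comp θ
      ((ContinuousLinearMap.apply ℝ (Param d) w).hasFDerivAt.comp θ (hasFDerivAt_hess hs hL hθ))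
    refine this.congr_of_eventuallyEq (Filter.Eventually.of_forall fun x => ?_)
    simp [real_inner_comm]
  have h1 := key w z
  have h2 := key z w
  have h3 : (fun x => ⟪hess L x w, z⟫_ℝ) =ᶠ[nhds θ] fun x => ⟪hess L x z, w⟫_ℝ := by
    filter_upwards [hs.mem_nhds hθ] with x hx
    rw [hess_symm hs hL hx, real_inner_comm]
  have := DFunLike.congr_fun (h1.unique (h2.congr_of_eventuallyEq h3)) v
  simpa [real_inner_comm] using this

/-- Quantitative `C⁴` regularity of `L` on a ball: third derivative bounded by `ρ` and
`a`-Lipschitz. -/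
structure SmoothBall (L : Param d → ℝ) (θ : Param d) (R ρ a : ℝ) : Prop where
  ρ_pos : 0 < ρ
  a_nonneg : 0 ≤ a
  R_pos : 0 < R
  contDiffOn : ContDiffOn ℝ 4 L (Metric.ball θ R)
  third_bound : ∀ x ∈ Metric.ball θ R, ‖third L x‖ ≤ ρ
  third_lipschitz : ∀ x ∈ Metric.ball θ R, ∀ y ∈ Metric.ball θ R,
    ‖third L x - third L y‖ ≤ a * ‖x - y‖

namespace SmoothBall

variable {R ρ a : ℝ}

theorem self_mem (h : SmoothBall L θ R ρ a) : θ ∈ Metric.ball θ R := Metric.mem_ball_self h.R_pos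

theorem add_mem {v : Param d} (hv : ‖v‖ < R) : θ + v ∈ Metric.ball θ R := by simpa using hv

theorem hess_symm (h : SmoothBall L θ R ρ a) {x : Param d} (hx : x ∈ Metric.ball θ R)
    (v w : Param d) : ⟪hess L x v, w⟫_ℝ = ⟪v, hess L x w⟫_ℝ :=
  StochasticSelfStabilization.hess_symm Metric.isOpen_ball h.contDiffOn hx v w

theorem third_comm (h : SmoothBall L θ R ρ a) (v w : Param d) :
    third L θ v w = third L θ w v :=
  StochasticSelfStabilization.third_comm Metric.isOpen_ball h.contDiffOn h.self_mem v w

theorem third_symm (h : SmoothBall L θ R ρ a) (v w z : Param d) :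
    ⟪third L θ v w, z⟫_ℝ = ⟪w, third L θ v z⟫_ℝ :=
  StochasticSelfStabilization.third_symm Metric.isOpen_ball h.contDiffOn h.self_mem v w z

theorem closedBall_subset {v : Param d} (hv : ‖v‖ < R) :
    Metric.closedBall θ ‖v‖ ⊆ Metric.ball θ R :=
  Metric.closedBall_subset_ball hv

theorem norm_third_le (h : SmoothBall L θ R ρ a) (v w : Param d) :
    ‖third L θ v w‖ ≤ ρ * ‖v‖ * ‖w‖ := by
  refine ((third L θ).le_opNorm₂ v w).trans ?_
  gcongr
  exact h.third_bound θ h.self_mem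

theorem norm_hess_sub_le (h : SmoothBall L θ R ρ a) {x y : Param d} (hx : x ∈ Metric.ball θ R)
    (hy : y ∈ Metric.ball θ R) : ‖hess L y - hess L x‖ ≤ ρ * ‖y - x‖ :=
  (convex_ball θ R).norm_image_sub_le_of_norm_hasFDerivWithin_le
    (fun _ hz => (hasFDerivAt_hess Metric.isOpen_ball h.contDiffOn hz).hasFDerivWithinAt)
    h.third_bound hx hy

theorem norm_hess_add_sub_le (h : SmoothBall L θ R ρ a) {v : Param d} (hv : ‖v‖ < R) :
    ‖hess L (θ + v) - hess L θ‖ ≤ ρ * ‖v‖ := by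
  simpa using h.norm_hess_sub_le h.self_mem (add_mem hv)

/-- Uniform in `w` on the ball of radius `‖v‖`, so that the mean value inequality can be applied
once more in `norm_gradient_taylor_two_le`. -/
theorem norm_hess_taylor_le (h : SmoothBall L θ R ρ a) {v : Param d} (hv : ‖v‖ < R) {w : Param d}
    (hw : ‖w‖ ≤ ‖v‖) : ‖hess L (θ + w) - hess L θ - third L θ w‖ ≤ a * ‖v‖ ^ 2 := by
  have key := (convex_closedBall θ ‖v‖).norm_image_sub_le_of_norm_hasFDerivWithin_le'
    (f := hess L) (f' := third L) (φ := third L θ) (C := a * ‖v‖) (x := θ) (y := θ + w)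
    (fun z hz => (hasFDerivAt_hess Metric.isOpen_ball h.contDiffOn
      (closedBall_subset hv hz)).hasFDerivWithinAt)
    (fun z hz => (h.third_lipschitz z (closedBall_subset hv hz) θ h.self_mem).trans
      (by have := h.a_nonneg; gcongr; simpa [dist_eq_norm] using hz))
    (by simp) (by simpa using hw)
  rw [add_sub_cancel_left] at key
  refine key.trans ?_
  have := h.a_nonneg
  calc a * ‖v‖ * ‖w‖ ≤ a * ‖v‖ * ‖v‖ := by gcongr
    _ = _ := by ring

theorem norm_gradient_taylor_le (h : SmoothBall L θ R ρ a) {v : Param d} (hv : ‖v‖ < R) :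
    ‖gradient L (θ + v) - gradient L θ - hess L θ v‖ ≤ ρ * ‖v‖ ^ 2 := by
  have key := (convex_closedBall θ ‖v‖).norm_image_sub_le_of_norm_hasFDerivWithin_le'
    (f := gradient L) (f' := hess L) (φ := hess L θ) (C := ρ * ‖v‖) (x := θ) (y := θ + v)
    (fun z hz => (hasFDerivAt_gradient Metric.isOpen_ball h.contDiffOn
      (closedBall_subset hv hz)).hasFDerivWithinAt)
    (fun _ hz => (h.norm_hess_sub_le h.self_mem (closedBall_subset hv hz)).trans
      (by have := h.ρ_pos; gcongr; simpa [dist_eq_norm] using hz))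
    (by simp) (by simp)
  rw [add_sub_cancel_left] at key
  refine key.trans (le_of_eq (by ring))

/-- The mean value inequality is applied to the gradient minus its quadratic Taylor term; by
symmetry the derivative of that term is `third L θ (z - θ)`, so `norm_hess_taylor_le` controls the
difference. -/
theorem norm_gradient_taylor_two_le (h : SmoothBall L θ R ρ a) {v : Param d} (hv : ‖v‖ < R) :
    ‖gradient L (θ + v) - gradient L θ - hess L θ v - (1 / 2 : ℝ) • third L θ v v‖
      ≤ a * ‖v‖ ^ 3 := by
  have hder : ∀ z, HasFDerivAt (fun x => (1 / 2 : ℝ) • third L θ (x - θ) (x - θ))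
      (third L θ (z - θ)) z := by
    intro z
    have h1 : HasFDerivAt (fun x : Param d => x - θ) (ContinuousLinearMap.id ℝ (Param d)) z :=
      (hasFDerivAt_id z).sub_const θ
    have h2 := (((third L θ).hasFDerivAt.comp z h1).clm_apply h1).const_smul (1 / 2 : ℝ)
    refine h2.congr_fderiv ?_
    ext1 w
    simp only [smul_apply, add_apply,
      ContinuousLinearMap.comp_apply, ContinuousLinearMap.flip_apply,
      ContinuousLinearMap.id_apply, Function.comp_apply]
    rw [h.third_comm w (z - θ), ← two_smul ℝ, smul_smul]
    norm_num
  have key := (convex_closedBall θ ‖v‖).norm_image_sub_le_of_norm_hasFDerivWithin_le'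
    (f := fun x => gradient L x - (1 / 2 : ℝ) • third L θ (x - θ) (x - θ))
    (f' := fun x => hess L x - third L θ (x - θ))
    (φ := hess L θ) (C := a * ‖v‖ ^ 2) (x := θ) (y := θ + v)
    (fun z hz => ((hasFDerivAt_gradient Metric.isOpen_ball h.contDiffOn
      (closedBall_subset hv hz)).sub (hder z)).hasFDerivWithinAt)
    (fun z hz => by
      have := h.norm_hess_taylor_le hv (w := z - θ) (by simpa [dist_eq_norm] using hz)
      rw [add_sub_cancel] at this
      rwa [sub_right_comm] at this)
    (by simp) (by simp)
  rw [add_sub_cancel_left, sub_self] at key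
  simp only [map_zero, smul_zero, sub_zero] at key
  refine le_trans (le_of_eq ?_) (key.trans (le_of_eq (by ring)))
  congr 1; abel

end SmoothBall

end Calculus

/-! ### First-order expansion of the sharpness at the edge of stability -/

section Edge

variable {d : ℕ} {L : Param d → ℝ} {θ u : Param d} {η R ρ a ν : ℝ}

/-- A point at the edge of stability: `L` is regular on a ball around `θ`, the Hessian has the top
eigenvalue `2 / η` along `u` and is of size `ν / η` on the complement, and the gradient is
orthogonal to `u`. -/
structure Edge (L : Param d → ℝ) (θ u : Param d) (η R ρ a ν : ℝ) : Prop
    extends SmoothBall L θ R ρ (a * (η * ρ ^ 2)) where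
  η_pos : 0 < η
  lip_nonneg : 0 ≤ a
  unit : ‖u‖ = 1
  eig : hess L θ u = (2 / η) • u
  hess_perp : ∀ w, ⟪u, w⟫_ℝ = 0 → ‖hess L θ w‖ ≤ ν / η * ‖w‖
  ν_le : ν ≤ 1
  grad_perp : ⟪gradient L θ, u⟫_ℝ = 0

namespace Edge

/-- As `ν ≤ 1`, the complement has quadratic form at most `1/η`, leaving a gap `1/η`. Perturbations
up to `1/(4η)` use half of it. -/
theorem spectralGap (h : Edge L θ u η R ρ a ν) {m : ℝ} (hm0 : 0 ≤ m) (hm : η * m ≤ 1 / 4) :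
    SpectralGap (hess L θ) u (2 / η) (1 / η) m (1 / (2 * η)) where
  symm := h.hess_symm h.self_mem
  unit := h.unit
  eig := h.eig
  le_perp w hw := by
    have hη := h.η_pos
    have h1 := h.hess_perp w hw
    have h2 : ν / η * ‖w‖ ≤ 1 / η * ‖w‖ := by
      have := h.ν_le
      gcongr
    calc ⟪hess L θ w, w⟫_ℝ ≤ ‖hess L θ w‖ * ‖w‖ := real_inner_le_norm _ _
      _ ≤ 1 / η * ‖w‖ * ‖w‖ := by gcongr; exact h1.trans h2
      _ = _ := by ring
  m_nonneg := hm0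
  k_pos := by have := h.η_pos; positivity
  gap := by
    have hη := h.η_pos
    have : m ≤ 1 / (4 * η) := by
      rw [le_div_iff₀ (by positivity)]; linarith
    have e1 : 2 / η - 1 / η - 2 * (1 / (4 * η)) = 1 / (2 * η) := by field_simp; norm_num
    linarith

theorem hess_gap (h : Edge L θ u η R ρ a ν) {v : Param d} (hv : η * ρ * ‖v‖ ≤ 1 / 4) :
    SpectralGap (hess L θ) u (2 / η) (1 / η) (ρ * ‖v‖) (1 / (2 * η)) :=
  h.spectralGap (by have := h.ρ_pos; positivity) (by linarith)

theorem sharpness_eq (h : Edge L θ u η R ρ a ν) : sharpness L θ = 2 / η := by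
  have hg := h.spectralGap le_rfl (by norm_num)
  have hs := h.hess_symm h.self_mem
  have h1 := hg.topEig_le hs (by simp)
  have h2 := hg.inner_self_le_topEig hs
  have h3 : ⟪hess L θ u, u⟫_ℝ = 2 / η := by
    rw [h.eig, real_inner_smul_left, real_inner_self_eq_norm_sq, h.unit]; ring
  rw [h3] at h1 h2
  rw [sharpness_eq_topEig]
  refine le_antisymm (h1.trans (by simp)) h2

theorem norm_hess_apply_le (h : Edge L θ u η R ρ a ν) (v : Param d) :
    ‖hess L θ v‖ ≤ 3 / η * ‖v‖ := by
  have hη := h.η_pos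
  have e : hess L θ v = (⟪u, v⟫_ℝ * (2 / η)) • u + hess L θ (perp u v) := by
    conv_lhs => rw [inner_smul_add_perp u v]
    rw [map_add, map_smul, h.eig, smul_smul]
  have h1 := h.hess_perp _ (inner_perp_right h.unit v)
  have h2 := norm_perp_le h.unit v
  have h3 : |⟪u, v⟫_ℝ| ≤ ‖v‖ := by simpa [h.unit] using abs_real_inner_le_norm u v
  rw [e]
  refine (norm_add_le _ _).trans ?_
  rw [norm_smul, h.unit, mul_one, Real.norm_eq_abs, abs_mul, abs_of_pos (by positivity : 0 < 2 / η)]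
  have h4 : ν / η * ‖perp u v‖ ≤ 1 / η * ‖v‖ := by
    have := h.ν_le
    calc ν / η * ‖perp u v‖ ≤ 1 / η * ‖perp u v‖ := by gcongr
      _ ≤ _ := by gcongr
  have h5 : |⟪u, v⟫_ℝ| * (2 / η) ≤ ‖v‖ * (2 / η) := by gcongr
  have e3 : 3 / η * ‖v‖ = ‖v‖ * (2 / η) + 1 / η * ‖v‖ := by ring
  linarith

theorem inner_third_self (h : Edge L θ u η R ρ a ν) (v : Param d) :
    ⟪third L θ v u, u⟫_ℝ = ⟪third L θ u u, v⟫_ℝ := by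
  rw [h.third_comm, h.third_symm, real_inner_comm]

theorem norm_third_self_le (h : Edge L θ u η R ρ a ν) : ‖third L θ u u‖ ≤ ρ := by
  simpa [h.unit] using h.norm_third_le u u

theorem abs_inner_hess_sub_le (h : Edge L θ u η R ρ a ν) {v : Param d} (hv : ‖v‖ < R) :
    |⟪hess L (θ + v) u, u⟫_ℝ - (2 / η + ⟪third L θ u u, v⟫_ℝ)| ≤ a * (η * ρ ^ 2) * ‖v‖ ^ 2 := by
  have h1 := h.norm_hess_taylor_le hv le_rfl
  have h2 := inner_map_le_opNorm (hess L (θ + v) - hess L θ - third L θ v) u u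
  rw [h.unit, mul_one, mul_one] at h2
  refine le_trans (le_of_eq ?_) (h2.trans h1)
  rw [sub_apply, sub_apply, inner_sub_left, inner_sub_left, h.inner_third_self, h.eig,
    real_inner_smul_left, real_inner_self_eq_norm_sq, h.unit]
  congr 1; ring

/-- The constant `a` comes from expanding `⟪H u, u⟫`, and `2` from the second-order eigenvalue error
`m² / k` with `m = ρ ‖v‖` and `k = 1/(2η)`. -/
theorem abs_sharpness_sub_le (h : Edge L θ u η R ρ a ν) {v : Param d} (hv : ‖v‖ < R)
    (hv' : η * ρ * ‖v‖ ≤ 1 / 4) :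
    |sharpness L (θ + v) - (2 / η + ⟪third L θ u u, v⟫_ℝ)| ≤ (a + 2) * (η * ρ ^ 2) * ‖v‖ ^ 2 := by
  have hη := h.η_pos
  have hg := h.hess_gap hv'
  have hs := h.hess_symm (SmoothBall.add_mem hv)
  have h1 := hg.topEig_le hs (h.norm_hess_add_sub_le hv)
  have h2 := hg.inner_self_le_topEig hs
  have h3 := abs_le.1 (h.abs_inner_hess_sub_le hv)
  have e : (ρ * ‖v‖) ^ 2 / (1 / (2 * η)) = 2 * (η * ρ ^ 2) * ‖v‖ ^ 2 := by field_simp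
  rw [e] at h1
  rw [sharpness_eq_topEig, abs_le]
  have h4 : 0 ≤ (η * ρ ^ 2) * ‖v‖ ^ 2 := by positivity
  constructor <;> nlinarith [h3.1, h3.2]

/-- The remainder in `abs_sharpness_sub_le` is quadratic, so differentiability of the sharpness at
`θ` comes with the expansion. -/
theorem gradient_sharpness (h : Edge L θ u η R ρ a ν) :
    gradient (sharpness L) θ = third L θ u u := by
  have hη := h.η_pos
  have hρ := h.ρ_pos
  refine HasGradientAt.gradient ?_
  rw [hasGradientAt_iff_isLittleO_nhds_zero]
  have hO : (fun v => sharpness L (θ + v) - sharpness L θ - ⟪third L θ u u, v⟫_ℝ)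
      =O[nhds 0] fun v : Param d => ‖v‖ ^ 2 := by
    refine Asymptotics.IsBigO.of_bound ((a + 2) * (η * ρ ^ 2)) ?_
    have hpos : 0 < min R (1 / (4 * η * ρ)) := lt_min h.R_pos (by positivity)
    filter_upwards [Metric.ball_mem_nhds (0 : Param d) hpos] with v hv
    rw [mem_ball_zero_iff, lt_min_iff] at hv
    have h1 : η * ρ * ‖v‖ ≤ 1 / 4 := by
      have := hv.2.le
      rw [le_div_iff₀ (by positivity)] at this
      linarith
    have := h.abs_sharpness_sub_le hv.1 h1
    rw [h.sharpness_eq, Real.norm_eq_abs, norm_pow, norm_norm, sub_sub]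
    exact this
  refine hO.trans_isLittleO ?_
  exact Asymptotics.isLittleO_norm_pow_id one_lt_two

/-- `∇S^⊥`. -/
noncomputable abbrev sperp (L : Param d → ℝ) (θ u : Param d) : Param d := perp u (third L θ u u)

theorem inner_sperp_of_perp {w : Param d} (hw : ⟪u, w⟫_ℝ = 0) :
    ⟪sperp L θ u, w⟫_ℝ = ⟪third L θ u u, w⟫_ℝ := by
  rw [sperp, perp, inner_sub_left, real_inner_smul_left, hw, mul_zero, sub_zero]

theorem inner_sperp_third (h : Edge L θ u η R ρ a ν) :
    ⟪third L θ u u, sperp L θ u⟫_ℝ = ‖sperp L θ u‖ ^ 2 := by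
  rw [← inner_sperp_of_perp (inner_perp_right h.unit _), real_inner_self_eq_norm_sq]

theorem inner_gradient_sperp (h : Edge L θ u η R ρ a ν) :
    ⟪gradient L θ, sperp L θ u⟫_ℝ = ⟪gradient L θ, third L θ u u⟫_ℝ := by
  rw [real_inner_comm, inner_sperp_of_perp (by rw [real_inner_comm]; exact h.grad_perp),
    real_inner_comm]

theorem abs_inner_third_unit_le (h : Edge L θ u η R ρ a ν) : |⟪third L θ u u, u⟫_ℝ| ≤ ρ := by
  refine (abs_real_inner_le_norm _ _).trans ?_
  rw [h.unit, mul_one]; exact h.norm_third_self_le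

theorem abs_inner_gradient_add_sub_le (h : Edge L θ u η R ρ a ν) {v : Param d} (hv : ‖v‖ < R) :
    |⟪gradient L (θ + v), u⟫_ℝ - 2 / η * ⟪u, v⟫_ℝ| ≤ ρ * ‖v‖ ^ 2 := by
  have h1 := abs_real_inner_le_norm (gradient L (θ + v) - gradient L θ - hess L θ v) u
  rw [h.unit, mul_one, inner_sub_left, inner_sub_left, h.grad_perp, h.hess_symm h.self_mem, h.eig,
    real_inner_smul_right, sub_zero, real_inner_comm u v] at h1
  exact h1.trans (h.norm_gradient_taylor_le hv)

end Edge

end Edge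

/-! ### One step of projected gradient descent on the stable set -/

section Projection

variable {d : ℕ} {L : Param d → ℝ} {θ u : Param d} {η R ρ a ν e c : ℝ}

namespace Edge

/-- Replaces `u` by the perturbed top eigenvector `w`, in the condition that defines the stable set.
Of the constant, `9` is the Taylor error at `‖v‖ ≤ 3e`, and `66 = 11 · 6` bounds the gradient times
`‖w - u‖`. -/
theorem abs_inner_gradient_eigenvector_sub_le (h : Edge L θ u η R ρ a ν)
    (heta : η * ‖gradient L θ‖ ≤ e) (hq : η * ρ * e ≤ 1 / 80)
    {v : Param d} (hvR : ‖v‖ < R) (hv : ‖v‖ ≤ 3 * e) {w : Param d}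
    (hw : 1 / (2 * η) * ‖w - u‖ ≤ ρ * ‖v‖) :
    |⟪gradient L (θ + v), w⟫_ℝ - 2 / η * ⟪u, v⟫_ℝ| ≤ 75 * (ρ * e ^ 2) := by
  have hη := h.η_pos
  have hρ := h.ρ_pos
  have he : 0 ≤ e := le_trans (by positivity) heta
  have h1 := h.abs_inner_gradient_add_sub_le hvR
  have hv2 : ρ * ‖v‖ ^ 2 ≤ 9 * (ρ * e ^ 2) := by
    calc ρ * ‖v‖ ^ 2 ≤ ρ * (3 * e) ^ 2 := by gcongr
      _ = _ := by ring
  have hz : ‖w - u‖ ≤ 6 * η * ρ * e := by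
    have h2 : 1 / (2 * η) * ‖w - u‖ ≤ ρ * (3 * e) := hw.trans (by gcongr)
    rw [one_div, inv_mul_le_iff₀ (by positivity)] at h2
    linarith
  have hG : ‖gradient L (θ + v)‖ ≤ 11 / η * e := by
    have h2 := h.norm_gradient_taylor_le hvR
    have h3 := h.norm_hess_apply_le v
    have h4 : ‖gradient L θ‖ ≤ 1 / η * e := by
      rw [one_div, ← div_eq_inv_mul, le_div_iff₀ hη]; linarith
    have h5 : 3 / η * ‖v‖ ≤ 9 / η * e := by
      calc 3 / η * ‖v‖ ≤ 3 / η * (3 * e) := by gcongr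
        _ = _ := by ring
    have h6 : 9 * (ρ * e ^ 2) ≤ 1 / η * e := by
      have : 9 * (ρ * e ^ 2) = 1 / η * e * (9 * (η * ρ * e)) := by field_simp
      rw [this]
      exact mul_le_of_le_one_right (by positivity) (by linarith)
    have h7 : gradient L (θ + v) = (gradient L (θ + v) - gradient L θ - hess L θ v)
        + (gradient L θ + hess L θ v) := by abel
    rw [h7]
    refine (norm_add_le _ _).trans ?_
    have h8 := norm_add_le (gradient L θ) (hess L θ v)
    have e11 : 11 / η * e = 1 / η * e + 9 / η * e + 1 / η * e := by ring
    linarith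
  have h9 : |⟪gradient L (θ + v), w - u⟫_ℝ| ≤ 66 * (ρ * e ^ 2) := by
    refine (abs_real_inner_le_norm _ _).trans ?_
    calc ‖gradient L (θ + v)‖ * ‖w - u‖ ≤ (11 / η * e) * (6 * η * ρ * e) := by gcongr
      _ = _ := by field_simp; ring
  rw [inner_sub_right] at h9
  rw [abs_le] at *
  constructor <;> linarith [h1.1, h1.2, h9.1, h9.2]

set_option maxHeartbeats 1000000 in
/-- A point of the stable set close to the gradient step, corrected against `∇S^⊥`. -/
theorem exists_mem_stableSet_near_step (h : Edge L θ u η R ρ a ν) (hc : 0 < c)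
    (hg : c * ρ ≤ ‖sperp L θ u‖) (heta : η * ‖gradient L θ‖ ≤ e) (he : 0 < e)
    (hα : 0 ≤ -⟪gradient L θ, third L θ u u⟫_ℝ)
    (hq : η * ρ * e ≤ 1 / 80) (hq' : (9 * a + 60) / c * (η * ρ * e) ≤ 1 / 2) (heR : 3 * e < R) :
    ∃ m ∈ stableSet L η, ‖(θ - η • gradient L θ) - m‖ ^ 2 ≤
      (η * -⟪gradient L θ, third L θ u u⟫_ℝ / ‖sperp L θ u‖
        + (9 * a + 60) / c * (η * ρ * e) * e) ^ 2 + (40 * (η * ρ * e) * e) ^ 2 := by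
  have hη := h.η_pos
  have hρ := h.ρ_pos
  have ha := h.lip_nonneg
  set g := sperp L θ u with hgdef
  set G := gradient L θ with hGdef
  set gS := third L θ u u with hgSdef
  set α : ℝ := -⟪G, gS⟫_ℝ with hαdef
  set γ := ‖g‖ with hγdef
  set A := 9 * a + 60 with hA
  have hγ : 0 < γ := lt_of_lt_of_le (by positivity) hg
  have hug : ⟪u, g⟫_ℝ = 0 := inner_perp_right h.unit _
  -- The additional motion `-τ g` lowers the sharpness to first order by `A η ρ² e²`. This pays for
  -- the quadratic remainder `9a + 18` at `‖D r‖ ≤ 3e` and for the `40` due to the component along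
  -- `u`.
  set τ := A * (η * ρ ^ 2 * e ^ 2) / γ ^ 2 with hτ
  -- At `±r0` the main term `2r/η` of the gradient along the eigenvector is `±80 ρ e²`, which beats
  -- the error `75 ρ e²`.
  set r0 := 40 * (η * ρ * e) * e with hr0
  have hr0pos : 0 < r0 := by positivity
  have hτ0 : 0 ≤ τ := by positivity
  have hτγ : τ * γ ≤ A / c * (η * ρ * e) * e := by
    have e1 : τ * γ = A * (η * e ^ 2) * (ρ * (ρ / γ)) := by rw [hτ]; field_simp
    have e2 : ρ / γ ≤ 1 / c := by rw [div_le_div_iff₀ hγ hc]; linarith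
    rw [e1]
    calc A * (η * e ^ 2) * (ρ * (ρ / γ)) ≤ A * (η * e ^ 2) * (ρ * (1 / c)) := by gcongr
      _ = _ := by ring
  have hτγ' : τ * γ ≤ e / 2 := by linarith [mul_le_mul_of_nonneg_right hq' he.le]
  have hr0' : r0 ≤ e / 2 := by linarith [mul_le_mul_of_nonneg_right hq he.le]
  have hαγ : η * α / γ ≤ e := by
    rw [div_le_iff₀ hγ]
    have h1 : α ≤ ‖G‖ * γ := by
      rw [hαdef, hGdef, hgSdef, ← h.inner_gradient_sperp]
      exact (neg_le_abs _).trans (abs_real_inner_le_norm _ _)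
    have h2 := mul_le_mul_of_nonneg_left h1 hη.le
    have h3 := mul_le_mul_of_nonneg_right heta hγ.le
    linarith
  -- The first summand cancels the first-order increase `η α` of the sharpness along the gradient
  -- step.
  set s : ℝ := η * α / γ ^ 2 + τ with hs
  have hs0 : 0 ≤ s := by positivity
  have hsγ : s * γ = η * α / γ + τ * γ := by rw [hs]; field_simp
  let D : ℝ → Param d := fun r => -(η • G) - s • g + r • u
  have hDu : ∀ r, ⟪u, D r⟫_ℝ = r := by
    intro r
    have h1 : ⟪u, G⟫_ℝ = 0 := by rw [real_inner_comm]; exact h.grad_perp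
    simp only [D, inner_add_right, inner_sub_right, inner_neg_right, real_inner_smul_right, h1, hug,
      real_inner_self_eq_norm_sq, h.unit]
    ring
  have hDn : ∀ r ∈ Set.Icc (-r0) r0, ‖D r‖ ≤ 3 * e := by
    intro r hr
    have h1 : ‖D r‖ ≤ η * ‖G‖ + s * γ + |r| := by
      refine (norm_add_le _ _).trans ?_
      refine add_le_add ((norm_sub_le _ _).trans ?_) ?_
      · rw [norm_neg, norm_smul, norm_smul, Real.norm_eq_abs, Real.norm_eq_abs, abs_of_pos hη,
          abs_of_nonneg hs0]
      · rw [norm_smul, h.unit, mul_one, Real.norm_eq_abs]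
    have h2 : |r| ≤ r0 := abs_le.2 hr
    rw [hsγ] at h1
    linarith
  have hDR : ∀ r ∈ Set.Icc (-r0) r0, ‖D r‖ < R := fun r hr => (hDn r hr).trans_lt heR
  have hDq : ∀ r ∈ Set.Icc (-r0) r0, η * ρ * ‖D r‖ ≤ 1 / 4 := by
    intro r hr
    have := mul_le_mul_of_nonneg_left (hDn r hr) (by positivity : 0 ≤ η * ρ)
    linarith
  have hgap : SpectralGap (hess L θ) u (2 / η) (1 / η) (ρ * (3 * e)) (1 / (2 * η)) :=
    h.spectralGap (by positivity) (by linarith)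
  have hclose : ∀ r ∈ Set.Icc (-r0) r0, ‖hess L (θ + D r) - hess L θ‖ ≤ ρ * (3 * e) := fun r hr =>
    (h.norm_hess_add_sub_le (hDR r hr)).trans (by gcongr; exact hDn r hr)
  have hsymm : ∀ r ∈ Set.Icc (-r0) r0, ∀ v w,
      ⟪hess L (θ + D r) v, w⟫_ℝ = ⟪v, hess L (θ + D r) w⟫_ℝ :=
    fun r hr => h.hess_symm (SmoothBall.add_mem (hDR r hr))
  have hex : ∀ r : ℝ, ∃ w : Param d, r ∈ Set.Icc (-r0) r0 → ⟪u, w⟫_ℝ = 1 ∧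
      hess L (θ + D r) w = topEig (hess L (θ + D r)) • w ∧
      1 / (2 * η) * ‖w - u‖ ≤ ρ * ‖D r‖ ∧
      ∀ w', hess L (θ + D r) w' = topEig (hess L (θ + D r)) • w' → w' = ⟪u, w'⟫_ℝ • w := by
    intro r
    by_cases hr : r ∈ Set.Icc (-r0) r0
    · obtain ⟨w, hw⟩ := (h.hess_gap (hDq r hr)).exists_eigenvector (hsymm r hr)
        (h.norm_hess_add_sub_le (hDR r hr))
      exact ⟨w, fun _ => hw⟩
    · exact ⟨0, fun h' => absurd h' hr⟩
  choose w hw using hex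
  have hDsub : ∀ r r', D r - D r' = (r - r') • u := by
    intro r r'
    simp only [D, sub_smul]; abel
  -- The gap `hgap` is uniform in `r`, so the normalized eigenvector is Lipschitz along the path.
  -- This continuity allows the intermediate value theorem to find `r` with gradient orthogonal to
  -- the eigenvector.
  have hwlip : ContinuousOn w (Set.Icc (-r0) r0) := by
    refine (LipschitzOnWith.of_dist_le_mul (K := (2 * η * (2 * ρ * 2)).toNNReal) ?_).continuousOn
    intro r hr r' hr'
    rw [dist_eq_norm, Real.dist_eq, Real.coe_toNNReal _ (by positivity)]
    have h1 := hgap.norm_eigenvector_sub_le (hsymm r hr) (hsymm r' hr') (hclose r hr)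
      (hw r hr).2.1 (hw r' hr').2.1 (hw r hr).1 (hw r' hr').1
    have h2 : ‖hess L (θ + D r) - hess L (θ + D r')‖ ≤ ρ * |r - r'| := by
      have := h.norm_hess_sub_le (SmoothBall.add_mem (hDR r' hr')) (SmoothBall.add_mem (hDR r hr))
      rwa [add_sub_add_left_eq_sub, hDsub, norm_smul, h.unit, mul_one, Real.norm_eq_abs] at this
    have h3 : ‖w r'‖ ≤ 2 := by
      have h4 := (hw r' hr').2.2.1
      rw [one_div, inv_mul_le_iff₀ (by positivity)] at h4
      have h5 := hDq r' hr'
      have h6 : ‖w r'‖ ≤ ‖w r' - u‖ + ‖u‖ := by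
        simpa using norm_add_le (w r' - u) u
      rw [h.unit] at h6
      linarith
    rw [one_div, inv_mul_le_iff₀ (by positivity)] at h1
    refine h1.trans ?_
    calc 2 * η * (2 * ‖hess L (θ + D r) - hess L (θ + D r')‖ * ‖w r'‖)
        ≤ 2 * η * (2 * (ρ * |r - r'|) * 2) := by gcongr
      _ = _ := by ring
  have hDcont : Continuous D := by fun_prop
  have hfcont : ContinuousOn (fun r => ⟪gradient L (θ + D r), w r⟫_ℝ) (Set.Icc (-r0) r0) := by
    refine ContinuousOn.inner (𝕜 := ℝ) ?_ hwlip
    refine (contDiffOn_gradient Metric.isOpen_ball h.contDiffOn).continuousOn.comp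
      (by fun_prop) (fun r hr => SmoothBall.add_mem (hDR r hr))
  have hfb : ∀ r ∈ Set.Icc (-r0) r0, |⟪gradient L (θ + D r), w r⟫_ℝ - 2 / η * r|
      ≤ 75 * (ρ * e ^ 2) := by
    intro r hr
    have := h.abs_inner_gradient_eigenvector_sub_le heta hq (hDR r hr) (hDn r hr) (hw r hr).2.2.1
    rwa [hDu] at this
  have h80 : 2 / η * r0 = 80 * (ρ * e ^ 2) := by rw [hr0]; field_simp; norm_num
  have hpe : 0 ≤ ρ * e ^ 2 := by positivity
  have hl : -r0 ∈ Set.Icc (-r0) r0 := ⟨le_rfl, by linarith⟩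
  have hr : r0 ∈ Set.Icc (-r0) r0 := ⟨by linarith, le_rfl⟩
  have h0 : (0 : ℝ) ∈ Set.Icc ⟪gradient L (θ + D (-r0)), w (-r0)⟫_ℝ
      ⟪gradient L (θ + D r0), w r0⟫_ℝ := by
    have h1 := (abs_le.1 (hfb _ hl)).2
    have h2 := (abs_le.1 (hfb _ hr)).1
    rw [mul_neg, h80] at h1
    rw [h80] at h2
    exact ⟨by linarith, by linarith⟩
  obtain ⟨r, hrI, hfr⟩ := intermediate_value_Icc (by linarith) hfcont h0
  refine ⟨θ + D r, ⟨?_, ?_⟩, ?_⟩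
  · have h1 := (abs_le.1 (h.abs_sharpness_sub_le (hDR r hrI) (hDq r hrI))).2
    have h2 : ⟪gS, D r⟫_ℝ = -(τ * γ ^ 2) + r * ⟪gS, u⟫_ℝ := by
      have h3 : ⟪gS, g⟫_ℝ = γ ^ 2 := h.inner_sperp_third
      have h4 : ⟪gS, G⟫_ℝ = -α := by rw [hαdef, neg_neg, real_inner_comm]
      have h5 : s * γ ^ 2 = η * α + τ * γ ^ 2 := by rw [hs]; field_simp
      simp only [D, inner_add_right, inner_sub_right, inner_neg_right, real_inner_smul_right, h3, h4]
      linarith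
    have h3 : r * ⟪gS, u⟫_ℝ ≤ r0 * ρ := by
      refine (le_abs_self _).trans ?_
      rw [abs_mul]
      exact mul_le_mul (abs_le.2 hrI) h.abs_inner_third_unit_le (abs_nonneg _) hr0pos.le
    have h4 : (a + 2) * (η * ρ ^ 2) * ‖D r‖ ^ 2 ≤ (a + 2) * (η * ρ ^ 2) * (3 * e) ^ 2 := by
      have := hDn r hrI
      gcongr
    have h5 : τ * γ ^ 2 = A * (η * ρ ^ 2 * e ^ 2) := by rw [hτ]; field_simp
    have h6 : r0 * ρ = 40 * (η * ρ ^ 2 * e ^ 2) := by rw [hr0]; ring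
    have h7 : 0 ≤ η * ρ ^ 2 * e ^ 2 := by positivity
    have h8 : (a + 2) * (η * ρ ^ 2) * (3 * e) ^ 2 = (9 * a + 18) * (η * ρ ^ 2 * e ^ 2) := by ring
    rw [h2, h5] at h1
    rw [h8] at h4
    rw [h6] at h3
    rw [hA] at h1
    linarith
  · intro w' hw'
    rw [(hw r hrI).2.2.2 w' hw', real_inner_smul_right]
    change _ * (fun r => ⟪gradient L (θ + D r), w r⟫_ℝ) r = 0
    rw [hfr, mul_zero]
  · have e1 : θ - η • G - (θ + D r) = s • g - r • u := by simp only [D]; abel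
    have e2 : ‖s • g - r • u‖ ^ 2 = (s * γ) ^ 2 + r ^ 2 := by
      rw [norm_sub_sq_real, real_inner_smul_left, real_inner_smul_right, real_inner_comm, hug,
        norm_smul, norm_smul, h.unit, Real.norm_eq_abs, Real.norm_eq_abs, mul_one, sq_abs,
        mul_pow, sq_abs, mul_pow]
      ring
    rw [e1, e2]
    have h1 : s * γ ≤ η * α / γ + A / c * (η * ρ * e) * e := by rw [hsγ]; linarith
    have h2 : r ^ 2 ≤ r0 ^ 2 := sq_le_sq' hrI.1 hrI.2
    have h3 : 0 ≤ s * γ := by positivity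
    gcongr

set_option maxHeartbeats 1000000 in
/-- One step of projected gradient descent between points with the same Hessian is, to leading
order, a gradient step corrected along `∇S^⊥`. -/
theorem norm_projection_sub_le (h : Edge L θ u η R ρ a ν) (hc : 0 < c)
    (hg : c * ρ ≤ ‖sperp L θ u‖) (heta : η * ‖gradient L θ‖ ≤ e) (he : 0 < e)
    (hα : 0 ≤ -⟪gradient L θ, third L θ u u⟫_ℝ)
    (hq : η * ρ * e ≤ 1 / 80) (hq' : (9 * a + 60) / c * (η * ρ * e) ≤ 1 / 2) (heR : 3 * e < R)
    {θ' : Param d} (hproj : IsProjection (stableSet L η) (θ - η • gradient L θ) θ')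
    (hhess : hess L θ' = hess L θ) :
    ‖θ' - (θ - η • gradient L θ) + (η * -⟪gradient L θ, third L θ u u⟫_ℝ / ‖sperp L θ u‖ ^ 2) •
      sperp L θ u‖ ^ 2 ≤ (5 * (9 * a + 60) / c + 20) * (η * ρ * e) * e ^ 2 := by
  obtain ⟨m, hm, hmn⟩ := h.exists_mem_stableSet_near_step hc hg heta he hα hq hq' heR
  have hZm := hproj.2 m hm
  have hη := h.η_pos
  have hρ := h.ρ_pos
  have ha := h.lip_nonneg
  set g := sperp L θ u with hgdef
  set G := gradient L θ with hGdef
  set gS := third L θ u u with hgSdef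
  set α : ℝ := -⟪G, gS⟫_ℝ with hαdef
  set γ := ‖g‖ with hγdef
  set A := 9 * a + 60 with hA
  have hγ : 0 < γ := lt_of_lt_of_le (by positivity) hg
  set Z := θ' - (θ - η • G) with hZ
  set r := η * α / γ with hr
  set q := η * ρ * e with hqdef
  have hq0 : 0 < q := by positivity
  have hr0 : 0 ≤ r := by positivity
  have hre : r ≤ e := by
    rw [hr, div_le_iff₀ hγ]
    have h1 : α ≤ ‖G‖ * γ := by
      rw [hαdef, hGdef, hgSdef, ← h.inner_gradient_sperp]
      exact (neg_le_abs _).trans (abs_real_inner_le_norm _ _)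
    have h2 := mul_le_mul_of_nonneg_left h1 hη.le
    have h3 := mul_le_mul_of_nonneg_right heta hγ.le
    linarith
  set t := A / c * q * e with ht
  have ht0 : 0 ≤ t := by positivity
  have hte : t ≤ e / 2 := by linarith [mul_le_mul_of_nonneg_right hq' he.le]
  -- Minimality of `θ'` against the constructed point of the stable set.
  have hZn : ‖Z‖ ^ 2 ≤ (r + t) ^ 2 + (40 * q * e) ^ 2 := by
    refine le_trans ?_ hmn
    rw [hZ, norm_sub_rev]
    gcongr
  have h40 : 40 * q * e ≤ e / 2 := by linarith [mul_le_mul_of_nonneg_right hq he.le]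
  have h40' : (40 * q * e) ^ 2 ≤ 20 * q * e ^ 2 := by
    have : (40 * q * e) ^ 2 = 40 * q * e * (40 * q * e) := by ring
    rw [this]
    linarith [mul_le_mul_of_nonneg_left h40 (by positivity : 0 ≤ 40 * q * e)]
  have hZ2 : ‖Z‖ ≤ 2 * e := by
    refine (sq_le_sq₀ (norm_nonneg _) (by positivity)).1 (hZn.trans ?_)
    have h1 : (r + t) ^ 2 ≤ (e + e / 2) ^ 2 := by gcongr
    have h2 : (40 * q * e) ^ 2 ≤ (e / 2) ^ 2 := by gcongr
    linarith [sq_nonneg e]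
  set D := Z - η • G with hDdef
  have hD3 : ‖D‖ ≤ 3 * e := by
    refine (norm_sub_le _ _).trans ?_
    rw [norm_smul, Real.norm_eq_abs, abs_of_pos hη]
    linarith
  have hDR : ‖D‖ < R := hD3.trans_lt heR
  have hθ' : θ' = θ + D := by rw [hDdef, hZ]; abel
  have hD2 : ‖D‖ ^ 2 ≤ 9 * e ^ 2 := by
    calc ‖D‖ ^ 2 ≤ (3 * e) ^ 2 := by gcongr
      _ = _ := by ring
  -- Equality of the Hessians makes `u` a top eigenvector at `θ'` too, so membership in the stable
  -- set applies to it.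
  have hGu : ⟪gradient L (θ + D), u⟫_ℝ = 0 := by
    rw [← hθ']
    apply hproj.1.2
    rw [sharpness_eq_topEig, hhess, ← sharpness_eq_topEig, h.sharpness_eq, h.eig]
  have hDu : |⟪u, D⟫_ℝ| ≤ 9 / 2 * (η * ρ * e ^ 2) := by
    have h1 := h.abs_inner_gradient_add_sub_le hDR
    rw [hGu, zero_sub, abs_neg, abs_mul, abs_of_pos (by positivity : 0 < 2 / η)] at h1
    have h2 : 2 / η * |⟪u, D⟫_ℝ| ≤ ρ * (9 * e ^ 2) := h1.trans (by gcongr)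
    rw [div_mul_eq_mul_div, div_le_iff₀ hη] at h2
    linarith
  -- The Hessian does not change from `θ` to `θ'`, so its first-order change along `u` is of second
  -- order.
  have hgSD : ⟪gS, D⟫_ℝ ≤ 9 * a * (η * ρ ^ 2 * e ^ 2) := by
    have h1 := (abs_le.1 (h.abs_inner_hess_sub_le hDR)).1
    rw [← hθ', hhess, h.eig, real_inner_smul_left, real_inner_self_eq_norm_sq, h.unit] at h1
    have h2 : a * (η * ρ ^ 2) * ‖D‖ ^ 2 ≤ a * (η * ρ ^ 2) * (9 * e ^ 2) := by gcongr
    rw [← hgSdef] at h1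
    linarith
  have hZg : ⟪Z, g⟫_ℝ ≤ -(r * γ) + A * (η * ρ ^ 2 * e ^ 2) := by
    have e1 : Z = D + η • G := by rw [hDdef]; abel
    have e2 : ⟪D, g⟫_ℝ = ⟪gS, D⟫_ℝ - ⟪gS, u⟫_ℝ * ⟪u, D⟫_ℝ := by
      rw [real_inner_comm, hgdef, sperp, perp, inner_sub_left, real_inner_smul_left,
        real_inner_comm u (third L θ u u)]
    have e3 : ⟪G, g⟫_ℝ = -α := by rw [hαdef, neg_neg]; exact h.inner_gradient_sperp
    have e4 : r * γ = η * α := by rw [hr]; field_simp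
    have h5 : -(⟪gS, u⟫_ℝ * ⟪u, D⟫_ℝ) ≤ ρ * (9 / 2 * (η * ρ * e ^ 2)) := by
      refine (neg_le_abs _).trans ?_
      rw [abs_mul]
      exact mul_le_mul h.abs_inner_third_unit_le hDu (abs_nonneg _) hρ.le
    have h7 : 0 ≤ η * ρ ^ 2 * e ^ 2 := by positivity
    rw [e1, inner_add_left, real_inner_smul_left, e2, e3, e4, hA]
    linarith
  -- The leading terms are `r²` from `‖Z‖²`, `-2r²` from the cross term and `r²`, and they cancel.
  -- What remains is at most `4rt + t²`, the source of `5 A / c`, plus the `20` from the component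
  -- along `u`.
  have e5 : ‖Z + (η * α / γ ^ 2) • g‖ ^ 2 = ‖Z‖ ^ 2 + 2 * (r / γ) * ⟪Z, g⟫_ℝ + r ^ 2 := by
    have : η * α / γ ^ 2 = r / γ := by rw [hr]; field_simp
    rw [this, norm_add_sq_real, norm_smul, Real.norm_eq_abs, abs_of_nonneg (by positivity),
      real_inner_smul_right, ← hγdef]
    field_simp
  rw [e5]
  have h6 : 2 * (r / γ) * ⟪Z, g⟫_ℝ ≤ -2 * r ^ 2 + 2 * r * t := by
    have h7 : 2 * (r / γ) * ⟪Z, g⟫_ℝ ≤ 2 * (r / γ) * (-(r * γ) + A * (η * ρ ^ 2 * e ^ 2)) := by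
      gcongr
    have h8 : 2 * (r / γ) * (-(r * γ) + A * (η * ρ ^ 2 * e ^ 2)) =
        -2 * r ^ 2 + 2 * r * (A * (η * e ^ 2) * (ρ * (ρ / γ))) := by field_simp
    have e2 : ρ / γ ≤ 1 / c := by rw [div_le_div_iff₀ hγ hc]; linarith
    have h9 : A * (η * e ^ 2) * (ρ * (ρ / γ)) ≤ t := by
      calc A * (η * e ^ 2) * (ρ * (ρ / γ)) ≤ A * (η * e ^ 2) * (ρ * (1 / c)) := by gcongr
        _ = _ := by rw [ht, hqdef]; ring
    have h10 : 2 * r * (A * (η * e ^ 2) * (ρ * (ρ / γ))) ≤ 2 * r * t := by gcongr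
    linarith
  have h11 : r * t ≤ A / c * q * e ^ 2 := by
    calc r * t ≤ e * t := by gcongr
      _ = _ := by rw [ht]; ring
  have h12 : t ^ 2 ≤ A / c * q * e ^ 2 := by
    calc t ^ 2 = t * t := by ring
      _ ≤ e * t := by gcongr; linarith
      _ = _ := by rw [ht]; ring
  have e6 : (5 * A / c + 20) * q * e ^ 2 = 5 * (A / c * q * e ^ 2) + 20 * q * e ^ 2 := by ring
  rw [e6]
  linarith

end Edge

end Projection

/-! ### Scales of the frozen window and the reference step -/

section Window

/-- Finitely many smallness conditions on `ε₀` are met at once by intersecting such eventual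
statements as `x → 0⁺`. -/
theorem eventually_mul_lt (k : ℝ) {m : ℝ} (hm : 0 < m) :
    ∀ᶠ x in nhdsWithin (0 : ℝ) (Set.Ioi 0), k * x < m := by
  have : Filter.Tendsto (fun x : ℝ => k * x) (nhdsWithin 0 (Set.Ioi 0)) (nhds (k * 0)) :=
    (Continuous.tendsto (by fun_prop) 0).mono_left nhdsWithin_le_nhds
  rw [mul_zero] at this
  exact this.eventually (gt_mem_nhds hm)

variable {d n : ℕ}

/-- Polarization with `w ± z`, where `z` is `T w` rescaled to the length of `w`: by the
parallelogram law `4 ⟪T w, z⟫ ≤ 4 C ‖w‖²`. Invariance of the complement of `u` keeps `z` admissible.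
-/
theorem norm_apply_le_of_quadratic_bound {T : Param d →L[ℝ] Param d} {u : Param d} {C : ℝ}
    (hT : ∀ v w, ⟪T v, w⟫_ℝ = ⟪v, T w⟫_ℝ) (hu : ∀ w, ⟪u, w⟫_ℝ = 0 → ⟪u, T w⟫_ℝ = 0)
    (hQ : ∀ v, ⟪u, v⟫_ℝ = 0 → |⟪v, T v⟫_ℝ| ≤ C * ‖v‖ ^ 2) {w : Param d} (hw : ⟪u, w⟫_ℝ = 0) :
    ‖T w‖ ≤ C * ‖w‖ := by
  rcases eq_or_ne (T w) 0 with h0 | h0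
  · rcases eq_or_ne w 0 with rfl | hw0
    · simp
    · have h1 := (abs_nonneg _).trans (hQ w hw)
      have hp : 0 < ‖w‖ := norm_pos_iff.2 hw0
      have hC : 0 ≤ C := nonneg_of_mul_nonneg_left h1 (by positivity)
      rw [h0, norm_zero]; positivity
  have hw0 : w ≠ 0 := by rintro rfl; simp at h0
  have hp : 0 < ‖w‖ := norm_pos_iff.2 hw0
  have hp' : 0 < ‖T w‖ := norm_pos_iff.2 h0
  set z := (‖w‖ / ‖T w‖) • T w with hz
  have hzn : ‖z‖ = ‖w‖ := by
    rw [hz, norm_smul, Real.norm_eq_abs, abs_of_pos (by positivity)]; field_simp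
  have hzu : ⟪u, z⟫_ℝ = 0 := by rw [hz, real_inner_smul_right, hu w hw, mul_zero]
  have h1 := (abs_le.1 (hQ (w + z) (by rw [inner_add_right, hw, hzu, add_zero]))).2
  have h2 := (abs_le.1 (hQ (w - z) (by rw [inner_sub_right, hw, hzu, sub_zero]))).1
  have h3 : ⟪w + z, T (w + z)⟫_ℝ - ⟪w - z, T (w - z)⟫_ℝ = 4 * ⟪T w, z⟫_ℝ := by
    simp only [map_add, map_sub, inner_add_left, inner_add_right, inner_sub_left, inner_sub_right]
    rw [← hT w z, real_inner_comm (T w) z]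
    ring
  have h4 : ‖w + z‖ ^ 2 + ‖w - z‖ ^ 2 = 4 * ‖w‖ ^ 2 := by
    rw [norm_add_sq_real, norm_sub_sq_real, hzn]; ring
  have h5 : ⟪T w, z⟫_ℝ = ‖T w‖ * ‖w‖ := by
    rw [hz, real_inner_smul_right, real_inner_self_eq_norm_sq]; field_simp
  have h6 : ‖T w‖ * ‖w‖ ≤ C * ‖w‖ * ‖w‖ := by linarith [congrArg (C * ·) h4]
  exact le_of_mul_le_mul_right h6 hp

namespace Frozen

variable {c : Constants} {p : Problem d n}

theorem deltaAt_eq (h : Frozen c p) {t : ℕ} (ht : t ≤ p.T) : p.deltaAt t = p.deltaAt 0 := by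
  rw [Problem.deltaAt, Problem.deltaAt, Problem.beta, Problem.beta, h.alpha_const t ht,
    h.gradSperp_const t ht]

theorem delta_eq (h : Frozen c p) : p.δ = p.deltaAt 0 := by
  rw [Problem.δ]
  have : (fun t : Fin (p.T + 1) => p.deltaAt t) = fun _ => p.deltaAt 0 :=
    funext fun t => h.deltaAt_eq (Nat.lt_succ_iff.1 t.2)
  rw [this, ciSup_const]

theorem eps_eq (h : Frozen c p) : p.ε = p.η * √(p.alpha 0) := by
  rw [Problem.ε]
  have : (fun t : Fin (p.T + 1) => p.epsAt t) = fun _ => p.epsAt 0 :=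
    funext fun t => by
      rw [Problem.epsAt, Problem.epsAt, h.alpha_const t (Nat.lt_succ_iff.1 t.2)]
  rw [this, ciSup_const, Problem.epsAt]

theorem norm_gradSperp_pos (h : Frozen c p) : 0 < ‖p.gradSperp 0‖ := by
  have := h.beta_pos
  rw [Problem.beta] at this
  exact (norm_nonneg _).lt_of_ne fun h0 => by simp [← h0] at this

theorem delta_sq (h : Frozen c p) : p.δ ^ 2 = 2 * p.alpha 0 / p.beta 0 := by
  have := h.beta_pos
  have := h.alpha_pos
  rw [h.delta_eq, Problem.deltaAt, Real.sq_sqrt (by positivity)]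

theorem delta_pos (h : Frozen c p) : 0 < p.δ := by
  have := h.beta_pos
  have := h.alpha_pos
  rw [h.delta_eq, Problem.deltaAt]
  positivity

theorem two_alpha_eq (h : Frozen c p) : 2 * p.alpha 0 = (p.δ * ‖p.gradSperp 0‖) ^ 2 := by
  have h1 := h.beta_pos
  rw [mul_pow, h.delta_sq, ← Problem.beta]
  field_simp

theorem eps_sq (hf : Frozen c p) :
    2 * p.ε ^ 2 = (p.η * ‖p.gradSperp 0‖ * p.δ) ^ 2 := by
  rw [hf.eps_eq, mul_pow, Real.sq_sqrt hf.alpha_pos.le]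
  linear_combination p.η ^ 2 * hf.two_alpha_eq

end Frozen

namespace Landscape

variable {c : Constants} {p : Problem d n}

theorem eps_pos (h : Landscape c p) (hf : Frozen c p) : 0 < p.ε := by
  have := h.η_pos
  have := hf.alpha_pos
  rw [hf.eps_eq]; positivity

theorem eta_gradSperp_delta_le (h : Landscape c p) (hf : Frozen c p) :
    p.η * ‖p.gradSperp 0‖ * p.δ ≤ 2 * p.ε := by
  have h0 := h.eps_pos hf
  refine abs_le_of_sq_le_sq' ?_ (by positivity) |>.2
  rw [← hf.eps_sq]; nlinarith [sq_nonneg p.ε]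

/-- This is what makes a displacement of size `δ` a small perturbation of the Hessian. It uses
`‖∇S^⊥‖ ≥ cβ ρ₃`. -/
theorem eta_rho_delta_le (h : Landscape c p) (hf : Frozen c p) (hβ : 0 < c.cβ) :
    p.η * p.ρ3 * p.δ ≤ 2 / c.cβ * p.ε := by
  have h1 := h.eta_gradSperp_delta_le hf
  have h2 := h.gradSperp_ge 0 (Nat.zero_le _)
  have h3 : p.η * (c.cβ * p.ρ3) * p.δ ≤ p.η * ‖p.gradSperp 0‖ * p.δ := by
    have := h.η_pos
    have := hf.delta_pos
    gcongr
  rw [div_mul_eq_mul_div, le_div_iff₀ hβ]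
  linarith

/-- Progressive sharpening gives `cα η ‖∇L‖ ‖∇S^⊥‖ ≤ η α`, while `η α = η δ² ‖∇S^⊥‖² / 2 ≤ ε δ
‖∇S^⊥‖`. -/
theorem eta_norm_gradient_le (h : Landscape c p) (hf : Frozen c p) (hα : 0 < c.cα) {t : ℕ}
    (ht : t ≤ p.T) : p.η * ‖gradient p.L (p.ref t)‖ ≤ p.ε * p.δ / c.cα := by
  have hg := hf.norm_gradSperp_pos
  have hη := h.η_pos
  have h1 := h.alpha_ge t ht
  rw [hf.gradSperp_const t ht, hf.alpha_const t ht] at h1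
  have h2 := hf.two_alpha_eq
  have h3 := h.eta_gradSperp_delta_le hf
  have hδ := hf.delta_pos
  rw [le_div_iff₀ hα]
  refine le_of_mul_le_mul_right ?_ hg
  have h4 := mul_le_mul_of_nonneg_left h1 hη.le
  have h5 := mul_le_mul_of_nonneg_right h3 (by positivity : 0 ≤ p.δ * ‖p.gradSperp 0‖)
  nlinarith

theorem T_mul_eps_le (h : Landscape c p) (hf : Frozen c p) : p.T * p.ε ≤ c.cT := by
  have := h.T_le
  rwa [le_div_iff₀ (h.eps_pos hf)] at this

theorem sharpness_ref (h : Landscape c p) (hf : Frozen c p) {t : ℕ} (ht : t ≤ p.T) :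
    sharpness p.L (p.ref t) = 2 / p.η := by
  rw [sharpness_eq_topEig, hf.hess_const t ht, ← sharpness_eq_topEig, h.sharpness_zero]

theorem ref_mem (h : Landscape c p) {t : ℕ} (ht : t ≤ p.T) : p.ref t ∈ stableSet p.L p.η := by
  cases t with
  | zero => exact h.ref_zero_mem
  | succ t => exact (h.pgd t ht).1

theorem hess_u (h : Landscape c p) (hf : Frozen c p) {t : ℕ} (ht : t ≤ p.T) :
    hess p.L (p.ref t) (p.u 0) = (2 / p.η) • p.u 0 := by
  rw [← hf.u_const t ht, h.u_top t ht, h.sharpness_ref hf ht]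

theorem contDiffOn_loss (h : Landscape c p) : ContDiffOn ℝ 4 p.L p.N := by
  have : p.L = fun θ => (n : ℝ)⁻¹ * ∑ i, p.ℓ i θ := rfl
  rw [this]
  exact contDiffOn_const.mul (ContDiffOn.sum fun i _ => h.contDiff i)

/-- Radius of the balls of regularity. -/
noncomputable def radius (c : Constants) (p : Problem d n) : ℝ := (2 - c.cgap) / (4 * p.η * p.ρ3)

theorem smoothBall (h : Landscape c p) (hgap : c.cgap < 2) {t : ℕ} (ht : t ≤ p.T) :
    SmoothBall p.L (p.ref t) (radius c p) p.ρ3 (|c.C4| * (p.η * p.ρ3 ^ 2)) where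
  ρ_pos := h.ρ3_pos
  a_nonneg := by have := h.η_pos; positivity
  R_pos := by
    have := h.η_pos
    have := h.ρ3_pos
    have : 0 < 2 - c.cgap := by linarith
    unfold radius
    positivity
  contDiffOn := h.contDiffOn_loss.mono (h.N_ball t ht)
  third_bound x hx := h.third_bound x (h.N_ball t ht hx)
  third_lipschitz x hx y hy := by
    refine (h.third_lipschitz x (h.N_ball t ht hx) y (h.N_ball t ht hy)).trans ?_
    gcongr
    refine h.ρ4_le.trans ?_
    have := h.η_pos
    gcongr
    exact le_abs_self _

theorem unit (h : Landscape c p) : ‖p.u 0‖ = 1 := h.u_unit 0 (Nat.zero_le _)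

theorem hess_perp_le (h : Landscape c p) (hf : Frozen c p) (hgap : c.cgap < 2)
    (hε : 2 * |c.Cnw| * p.ε ≤ 1) {t : ℕ} (ht : t ≤ p.T) {w : Param d} (hw : ⟪p.u 0, w⟫_ℝ = 0) :
    ‖hess p.L (p.ref t) w‖ ≤ 2 * |c.Cnw| * p.ε / p.η * ‖w‖ := by
  have hη := h.η_pos
  have he := h.eps_pos hf
  have hb := h.smoothBall hgap ht
  set H := hess p.L (p.ref t) with hH
  have hsymm := hb.hess_symm hb.self_mem
  have hu := h.unit
  have hHu := h.hess_u hf ht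
  have hperp : ∀ w, ⟪p.u 0, w⟫_ℝ = 0 → ⟪p.u 0, H w⟫_ℝ = 0 := by
    intro w hw
    rw [← hsymm, hHu, real_inner_smul_left, hw, mul_zero]
  have hQ : ∀ v, ⟪p.u 0, v⟫_ℝ = 0 → |⟪v, H v⟫_ℝ| ≤ (|c.Cnw| * p.ε * ‖H‖) * ‖v‖ ^ 2 := by
    intro v hv
    rw [← hf.u_const t ht] at hv
    refine (h.nonworst_hess t ht v hv).trans ?_
    rw [← mul_assoc]
    gcongr
    exact le_abs_self _
  have key : ∀ w, ⟪p.u 0, w⟫_ℝ = 0 → ‖H w‖ ≤ |c.Cnw| * p.ε * ‖H‖ * ‖w‖ := fun w hw =>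
    norm_apply_le_of_quadratic_bound hsymm hperp hQ hw
  -- The non-worst-case bound is relative to `‖H‖`, so it is bootstrapped. On the complement it
  -- gives at most `‖H‖ / 2`, hence `‖H‖ ≤ max (2/η) (‖H‖/2)`, which forces `‖H‖ ≤ 2/η`.
  have hHn : ‖H‖ ≤ 2 / p.η := by
    have h1 : ‖H‖ ≤ max (2 / p.η) (‖H‖ / 2) := by
      refine H.opNorm_le_bound (by positivity) fun v => ?_
      set M := max (2 / p.η) (‖H‖ / 2)
      have hM : 0 ≤ M := by positivity
      have e : H v = (⟪p.u 0, v⟫_ℝ * (2 / p.η)) • p.u 0 + H (perp (p.u 0) v) := by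
        conv_lhs => rw [inner_smul_add_perp (p.u 0) v]
        rw [map_add, map_smul, hHu, smul_smul]
      have h2 : ‖H (perp (p.u 0) v)‖ ≤ M * ‖perp (p.u 0) v‖ := by
        refine (key _ (inner_perp_right hu v)).trans ?_
        gcongr
        refine le_trans ?_ (le_max_right _ _)
        nlinarith [norm_nonneg H]
      have h3 : ‖H v‖ ^ 2 = (⟪p.u 0, v⟫_ℝ * (2 / p.η)) ^ 2 + ‖H (perp (p.u 0) v)‖ ^ 2 := by
        rw [e, norm_add_sq_real, norm_smul, real_inner_smul_left,
          hperp _ (inner_perp_right hu v), hu, Real.norm_eq_abs, mul_one, sq_abs]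
        ring
      refine (sq_le_sq₀ (norm_nonneg _) (by positivity)).1 ?_
      rw [h3, mul_pow, mul_pow, norm_sq_eq_inner_sq_add hu v]
      have h4 : (2 / p.η) ^ 2 ≤ M ^ 2 := by
        have := le_max_left (2 / p.η) (‖H‖ / 2)
        gcongr
      have h5 : ‖H (perp (p.u 0) v)‖ ^ 2 ≤ (M * ‖perp (p.u 0) v‖) ^ 2 := by gcongr
      rw [mul_pow] at h5
      nlinarith [mul_le_mul_of_nonneg_left h4 (sq_nonneg ⟪p.u 0, v⟫_ℝ)]
    rcases le_max_iff.1 h1 with h2 | h2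
    · exact h2
    · have : 0 ≤ 2 / p.η := by positivity
      linarith [norm_nonneg H]
  refine (key w hw).trans ?_
  calc |c.Cnw| * p.ε * ‖H‖ * ‖w‖ ≤ |c.Cnw| * p.ε * (2 / p.η) * ‖w‖ := by gcongr
    _ = _ := by ring

theorem edge (h : Landscape c p) (hf : Frozen c p) (hgap : c.cgap < 2)
    (hε : 2 * |c.Cnw| * p.ε ≤ 1) {t : ℕ} (ht : t ≤ p.T) :
    Edge p.L (p.ref t) (p.u 0) p.η (radius c p) p.ρ3 |c.C4| (2 * |c.Cnw| * p.ε) where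
  toSmoothBall := h.smoothBall hgap ht
  η_pos := h.η_pos
  lip_nonneg := abs_nonneg _
  unit := h.unit
  eig := h.hess_u hf ht
  hess_perp _ hw := h.hess_perp_le hf hgap hε ht hw
  ν_le := hε
  grad_perp := by
    refine (h.ref_mem ht).2 _ ?_
    rw [h.hess_u hf ht, h.sharpness_ref hf ht]

theorem gradS_eq (h : Landscape c p) (hf : Frozen c p) (hgap : c.cgap < 2)
    (hε : 2 * |c.Cnw| * p.ε ≤ 1) {t : ℕ} (ht : t ≤ p.T) :
    p.gradS t = third p.L (p.ref t) (p.u 0) (p.u 0) :=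
  (h.edge hf hgap hε ht).gradient_sharpness

theorem gradSperp_eq (h : Landscape c p) (hf : Frozen c p) (hgap : c.cgap < 2)
    (hε : 2 * |c.Cnw| * p.ε ≤ 1) {t : ℕ} (ht : t ≤ p.T) :
    Edge.sperp p.L (p.ref t) (p.u 0) = p.gradSperp 0 := by
  rw [← hf.gradSperp_const t ht, Problem.gradSperp, h.gradS_eq hf hgap hε ht, hf.u_const t ht]

theorem inner_gradient_third (h : Landscape c p) (hf : Frozen c p) (hgap : c.cgap < 2)
    (hε : 2 * |c.Cnw| * p.ε ≤ 1) {t : ℕ} (ht : t ≤ p.T) :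
    -⟪gradient p.L (p.ref t), third p.L (p.ref t) (p.u 0) (p.u 0)⟫_ℝ = p.alpha 0 := by
  rw [← hf.alpha_const t ht, Problem.alpha, h.gradS_eq hf hgap hε ht]

theorem inner_third_unit (h : Landscape c p) (hf : Frozen c p) (hgap : c.cgap < 2)
    (hε : 2 * |c.Cnw| * p.ε ≤ 1) {t : ℕ} (ht : t ≤ p.T) :
    ⟪third p.L (p.ref t) (p.u 0) (p.u 0), p.u 0⟫_ℝ = p.kappa 0 := by
  rw [← hf.kappa_const t ht, Problem.kappa, h.gradS_eq hf hgap hε ht, hf.u_const t ht]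

end Landscape

/-- Along the window, a reference step is a gradient step corrected by `η δ² ∇S^⊥ / 2`, up to
`O(ε² δ)`. -/
theorem exists_reference_step_bound (c : Constants) (hgap : c.cgap < 2) (hα : 0 < c.cα)
    (hβ : 0 < c.cβ) : ∃ C ε₀ : ℝ, 0 < C ∧ 0 < ε₀ ∧ ∀ (d n : ℕ) (p : Problem d n),
      Landscape c p → Frozen c p → p.ε ≤ ε₀ → ∀ t < p.T,
        ‖p.ref (t + 1) - (p.ref t - p.η • gradient p.L (p.ref t))
          + (p.η * p.δ ^ 2 / 2) • p.gradSperp 0‖ ≤ C * (p.ε ^ 2 * p.δ) := by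
  set b := 2 / c.cβ with hb
  have hb0 : 0 < b := by positivity
  have hgap' : 0 < 2 - c.cgap := by linarith
  set A := (9 * |c.C4| + 60) / c.cβ with hA
  have hA0 : 0 < A := by positivity
  set C0 := (5 * (9 * |c.C4| + 60) / c.cβ + 20) * (b / c.cα ^ 3) with hC0
  have hC0pos : 0 < C0 := by positivity
  obtain ⟨ε₀, hε₀, hnw, hone, h80, hAq, hR⟩ : ∃ ε₀ : ℝ, 0 < ε₀ ∧ 2 * |c.Cnw| * ε₀ ≤ 1 ∧
      ε₀ ≤ 1 ∧ b / c.cα * ε₀ ≤ 1 / 80 ∧ A * (b / c.cα) * ε₀ ≤ 1 / 2 ∧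
      3 * (b / c.cα) * ε₀ < (2 - c.cgap) / 4 := by
    obtain ⟨x, ⟨⟨⟨⟨hx1, hx2⟩, hx3⟩, hx4⟩, hx5⟩, hx0⟩ := (((((eventually_mul_lt (2 * |c.Cnw|) one_pos).and
      (eventually_mul_lt 1 one_pos)).and
      (eventually_mul_lt (b / c.cα) (by norm_num : (0 : ℝ) < 1 / 80))).and
      (eventually_mul_lt (A * (b / c.cα)) (by norm_num : (0 : ℝ) < 1 / 2))).and
      (eventually_mul_lt (3 * (b / c.cα)) (by positivity : 0 < (2 - c.cgap) / 4))).and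
      self_mem_nhdsWithin |>.exists
    exact ⟨x, hx0, hx1.le, by linarith, hx3.le, hx4.le, hx5⟩
  refine ⟨√C0, ε₀, Real.sqrt_pos.2 hC0pos, hε₀, ?_⟩
  intro d n p hl hf hε t ht
  have hε0 := hl.eps_pos hf
  have hη := hl.η_pos
  have hρ := hl.ρ3_pos
  have hδ := hf.delta_pos
  have hnw' : 2 * |c.Cnw| * p.ε ≤ 1 := le_trans (by gcongr) hnw
  have hedge := hl.edge hf hgap hnw' ht.le
  have hρδ := hl.eta_rho_delta_le hf hβ
  -- With `e = ε δ / cα` the relative error `η ρ₃ e` is `O(ε²)`, so the squared error `η ρ₃ e · e²`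
  -- of the projection is `O((ε² δ)²)`.
  have hq : p.η * p.ρ3 * (p.ε * p.δ / c.cα) ≤ b / c.cα * p.ε ^ 2 := by
    calc p.η * p.ρ3 * (p.ε * p.δ / c.cα) = (p.η * p.ρ3 * p.δ) * (p.ε / c.cα) := by ring
      _ ≤ (b * p.ε) * (p.ε / c.cα) := by gcongr
      _ = _ := by ring
  have hε2 : p.ε ^ 2 ≤ ε₀ := by
    have : p.ε ≤ 1 := hε.trans hone
    nlinarith
  have hqε : p.η * p.ρ3 * (p.ε * p.δ / c.cα) ≤ b / c.cα * ε₀ := hq.trans (by gcongr)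
  have key := hedge.norm_projection_sub_le (c := c.cβ) (e := p.ε * p.δ / c.cα) hβ
    (by rw [hl.gradSperp_eq hf hgap hnw' ht.le]; exact hl.gradSperp_ge 0 (Nat.zero_le _))
    (hl.eta_norm_gradient_le hf hα ht.le) (by positivity)
    (by rw [hl.inner_gradient_third hf hgap hnw' ht.le]; exact hf.alpha_pos.le)
    (hqε.trans h80)
    (by
      calc _ ≤ A * (b / c.cα * ε₀) := by gcongr
        _ = A * (b / c.cα) * ε₀ := by ring
        _ ≤ _ := hAq)
    (by
      rw [Landscape.radius, lt_div_iff₀ (by positivity)]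
      calc 3 * (p.ε * p.δ / c.cα) * (4 * p.η * p.ρ3)
          = 4 * (3 * (p.η * p.ρ3 * (p.ε * p.δ / c.cα))) := by ring
        _ ≤ 4 * (3 * (b / c.cα * ε₀)) := by gcongr
        _ = 4 * (3 * (b / c.cα) * ε₀) := by ring
        _ < 4 * ((2 - c.cgap) / 4) := by gcongr
        _ = _ := by ring)
    (hl.pgd t ht) (by rw [hf.hess_const _ ht, hf.hess_const _ ht.le])
  rw [hl.gradSperp_eq hf hgap hnw' ht.le, hl.inner_gradient_third hf hgap hnw' ht.le] at key
  have hcoef : p.η * p.alpha 0 / ‖p.gradSperp 0‖ ^ 2 = p.η * p.δ ^ 2 / 2 := by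
    rw [hf.delta_sq, Problem.beta]; ring
  rw [hcoef] at key
  refine (sq_le_sq₀ (norm_nonneg _) (by positivity)).1 (key.trans ?_)
  rw [mul_pow, Real.sq_sqrt hC0pos.le]
  calc (5 * (9 * |c.C4| + 60) / c.cβ + 20) * (p.η * p.ρ3 * (p.ε * p.δ / c.cα)) *
        (p.ε * p.δ / c.cα) ^ 2
      ≤ (5 * (9 * |c.C4| + 60) / c.cβ + 20) * (b / c.cα * p.ε ^ 2) *
        (p.ε * p.δ / c.cα) ^ 2 := by gcongr
    _ = C0 * (p.ε ^ 2 * p.δ) ^ 2 := by rw [hC0]; field_simp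

end Window

/-! ### The noiseless predicted step: Lipschitz bound, Lyapunov function and Taylor comparison -/

section Step

variable {d n : ℕ}

/-- One noiseless step of the predicted dynamics with Hessian `H`, top eigenvector `u` and
`∇S^⊥ = g`. -/
noncomputable def noiselessStep (H : Param d →L[ℝ] Param d) (u g : Param d) (η κ δ : ℝ)
    (v : Param d) : Param d :=
  perp u ((perp u v - η • H (perp u v)) + (η * ((δ ^ 2 - ⟪u, v⟫_ℝ ^ 2) / 2)) • g)
    - ((1 + η * ⟪g, v⟫_ℝ) * ⟪u, v⟫_ℝ + η / 2 * κ * ⟪u, v⟫_ℝ ^ 2) • u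

/-- Scales of the frozen predicted dynamics. -/
structure StepScales (H : Param d →L[ℝ] Param d) (u g : Param d) (η κ ε δ ν k : ℝ) : Prop where
  η_pos : 0 < η
  ε_pos : 0 < ε
  δ_pos : 0 < δ
  ν_nonneg : 0 ≤ ν
  k_nonneg : 0 ≤ k
  unit : ‖u‖ = 1
  symm : ∀ v w, ⟪H v, w⟫_ℝ = ⟪v, H w⟫_ℝ
  eig : H u = (2 / η) • u
  orth : ⟪u, g⟫_ℝ = 0
  ker : H g = 0
  hess_perp : ∀ w, ⟪u, w⟫_ℝ = 0 → η * ‖H w‖ ≤ ν * ε * ‖w‖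
  g_le : η * ‖g‖ * δ ≤ 2 * ε
  κ_le : η * |κ| * δ ≤ k * ε ^ 2

namespace StepScales

variable {H : Param d →L[ℝ] Param d} {u g : Param d} {η κ ε δ ν k K : ℝ}

theorem inner_hess_perp (h : StepScales H u g η κ ε δ ν k) {w : Param d} (hw : ⟪u, w⟫_ℝ = 0) :
    ⟪u, H w⟫_ℝ = 0 := by
  rw [← h.symm, h.eig, real_inner_smul_left, hw, mul_zero]

/-- The outer projection is redundant, since `H` preserves the complement of `u` and `g` is
orthogonal to `u`. -/
theorem noiselessStep_eq (h : StepScales H u g η κ ε δ ν k) (v : Param d) :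
    noiselessStep H u g η κ δ v =
      (perp u v - η • H (perp u v)) + (η * ((δ ^ 2 - ⟪u, v⟫_ℝ ^ 2) / 2)) • g
        - ((1 + η * ⟪g, v⟫_ℝ) * ⟪u, v⟫_ℝ + η / 2 * κ * ⟪u, v⟫_ℝ ^ 2) • u := by
  rw [noiselessStep, perp_eq_self]
  have hw := inner_perp_right h.unit v
  rw [inner_add_right, inner_sub_right, real_inner_smul_right, real_inner_smul_right, hw,
    h.inner_hess_perp hw, h.orth]
  ring

theorem inner_g_perp (h : StepScales H u g η κ ε δ ν k) (v : Param d) :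
    ⟪g, perp u v⟫_ℝ = ⟪g, v⟫_ℝ := by
  rw [perp, inner_sub_right, real_inner_smul_right, real_inner_comm u g, h.orth, mul_zero, sub_zero]

theorem inner_u_step (h : StepScales H u g η κ ε δ ν k) (v : Param d) :
    ⟪u, noiselessStep H u g η κ δ v⟫_ℝ =
      -((1 + η * ⟪g, v⟫_ℝ) * ⟪u, v⟫_ℝ + η / 2 * κ * ⟪u, v⟫_ℝ ^ 2) := by
  have hw := inner_perp_right h.unit v
  rw [h.noiselessStep_eq, inner_sub_right, inner_add_right, inner_sub_right, real_inner_smul_right,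
    real_inner_smul_right, real_inner_smul_right, hw, h.inner_hess_perp hw, h.orth,
    real_inner_self_eq_norm_sq, h.unit]
  ring

theorem inner_g_hess (h : StepScales H u g η κ ε δ ν k) (w : Param d) : ⟪g, H w⟫_ℝ = 0 := by
  rw [← h.symm, h.ker, inner_zero_left]

/-- As `H g = 0`, the Hessian does not act on this coordinate, and only the feedback `δ² - x²` moves
it. -/
theorem inner_g_step (h : StepScales H u g η κ ε δ ν k) (v : Param d) :
    ⟪g, noiselessStep H u g η κ δ v⟫_ℝ =
      ⟪g, v⟫_ℝ + η * ((δ ^ 2 - ⟪u, v⟫_ℝ ^ 2) / 2) * ‖g‖ ^ 2 := by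
  rw [h.noiselessStep_eq, inner_sub_right, inner_add_right, inner_sub_right, real_inner_smul_right,
    real_inner_smul_right, real_inner_smul_right, h.inner_g_hess, h.inner_g_perp,
    real_inner_comm u g, h.orth, real_inner_self_eq_norm_sq]
  ring

theorem abs_inner_u_le (h : StepScales H u g η κ ε δ ν k) (v : Param d) : |⟪u, v⟫_ℝ| ≤ ‖v‖ := by
  simpa [h.unit] using abs_real_inner_le_norm u v

theorem abs_eta_inner_g_le (h : StepScales H u g η κ ε δ ν k) {v : Param d}
    (hv : ‖v‖ ≤ K * δ) : |η * ⟪g, v⟫_ℝ| ≤ 2 * K * ε := by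
  have hη := h.η_pos
  have hδ := h.δ_pos
  have hgle := h.g_le
  have hκle := h.κ_le
  have hK : 0 ≤ K := nonneg_of_mul_nonneg_left ((norm_nonneg v).trans hv) hδ
  rw [abs_mul, abs_of_pos hη]
  calc η * |⟪g, v⟫_ℝ| ≤ η * (‖g‖ * ‖v‖) := by gcongr; exact abs_real_inner_le_norm _ _
    _ ≤ η * (‖g‖ * (K * δ)) := by gcongr
    _ = K * (η * ‖g‖ * δ) := by ring
    _ ≤ K * (2 * ε) := by gcongr
    _ = _ := by ring

/-- Lipschitz bound for the noiseless step on the ball of radius `K δ`. -/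
theorem norm_step_sub_le (h : StepScales H u g η κ ε δ ν k) (hε : ε ≤ 1) {v v' : Param d}
    (hv : ‖v‖ ≤ K * δ) (hv' : ‖v'‖ ≤ K * δ) :
    ‖noiselessStep H u g η κ δ v - noiselessStep H u g η κ δ v'‖ ≤
      (1 + (ν + (6 + k) * K) * ε) * ‖v - v'‖ := by
  have hη := h.η_pos
  have hδ := h.δ_pos
  have hgle := h.g_le
  have hκle := h.κ_le
  have he := h.ε_pos
  have hk := h.k_nonneg
  have hK : 0 ≤ K := nonneg_of_mul_nonneg_left ((norm_nonneg v).trans hv) hδ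
  set e := v - v' with hedef
  set x := ⟪u, v⟫_ℝ with hx
  set x' := ⟪u, v'⟫_ℝ with hx'
  set y := ⟪g, v⟫_ℝ with hy
  set y' := ⟪g, v'⟫_ℝ with hy'
  have hxe : |x - x'| ≤ ‖e‖ := by rw [hx, hx', ← inner_sub_right]; exact h.abs_inner_u_le _
  have hye : |y - y'| ≤ ‖g‖ * ‖e‖ := by
    rw [hy, hy', ← inner_sub_right]; exact abs_real_inner_le_norm _ _
  have hxK : |x| ≤ K * δ := (h.abs_inner_u_le v).trans hv
  have hxK' : |x'| ≤ K * δ := (h.abs_inner_u_le v').trans hv'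
  have hxx : |x ^ 2 - x' ^ 2| ≤ 2 * (K * δ) * ‖e‖ := by
    have : x ^ 2 - x' ^ 2 = (x + x') * (x - x') := by ring
    rw [this, abs_mul]
    have : |x + x'| ≤ 2 * (K * δ) := (abs_add_le _ _).trans (by linarith)
    gcongr
  have hperp : perp u v - perp u v' = perp u e := by
    simp only [perp, hedef, inner_sub_right, sub_smul]; abel
  have hue : ⟪u, e⟫_ℝ = x - x' := by rw [hedef, inner_sub_right]
  have hsplit : noiselessStep H u g η κ δ v - noiselessStep H u g η κ δ v' =
      (perp u e - ⟪u, e⟫_ℝ • u) - η • H (perp u e) - (η / 2 * (x ^ 2 - x' ^ 2)) • g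
        - (η * (y * x - y' * x') + η / 2 * κ * (x ^ 2 - x' ^ 2)) • u := by
    rw [h.noiselessStep_eq, h.noiselessStep_eq, ← hperp, map_sub, hue]
    module
  -- The leading part of the step is a reflection, hence an isometry: the Lipschitz constant exceeds
  -- `1` only by terms of order `ε`.
  have h1 : ‖perp u e - ⟪u, e⟫_ℝ • u‖ = ‖e‖ := by
    refine (pow_left_inj₀ (norm_nonneg _) (norm_nonneg _) two_ne_zero).1 ?_
    rw [norm_sub_sq_real, real_inner_smul_right, real_inner_comm u (perp u e),
      inner_perp_right h.unit, norm_smul, h.unit, Real.norm_eq_abs, mul_one, sq_abs, norm_sq_eq_inner_sq_add h.unit e]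
    ring
  have h2 : ‖η • H (perp u e)‖ ≤ ν * ε * ‖e‖ := by
    rw [norm_smul, Real.norm_eq_abs, abs_of_pos hη]
    refine (h.hess_perp _ (inner_perp_right h.unit e)).trans ?_
    have := h.ν_nonneg
    gcongr
    exact norm_perp_le h.unit e
  have h3 : ‖(η / 2 * (x ^ 2 - x' ^ 2)) • g‖ ≤ 2 * K * ε * ‖e‖ := by
    rw [norm_smul, Real.norm_eq_abs, abs_mul, abs_of_pos (by positivity)]
    calc η / 2 * |x ^ 2 - x' ^ 2| * ‖g‖ ≤ η / 2 * (2 * (K * δ) * ‖e‖) * ‖g‖ := by gcongr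
      _ = K * ‖e‖ * (η * ‖g‖ * δ) := by ring
      _ ≤ K * ‖e‖ * (2 * ε) := by gcongr
      _ = _ := by ring
  have h4 : |η * (y * x - y' * x')| ≤ 4 * K * ε * ‖e‖ := by
    have : η * (y * x - y' * x') = η * y * (x - x') + η * (y - y') * x' := by ring
    rw [this]
    refine (abs_add_le _ _).trans ?_
    have h5 : |η * y * (x - x')| ≤ 2 * K * ε * ‖e‖ := by
      rw [abs_mul]
      exact mul_le_mul (h.abs_eta_inner_g_le hv) hxe (abs_nonneg _) (by positivity)
    have h6 : |η * (y - y') * x'| ≤ 2 * K * ε * ‖e‖ := by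
      rw [abs_mul, abs_mul, abs_of_pos hη]
      calc η * |y - y'| * |x'| ≤ η * (‖g‖ * ‖e‖) * (K * δ) := by gcongr
        _ = K * ‖e‖ * (η * ‖g‖ * δ) := by ring
        _ ≤ K * ‖e‖ * (2 * ε) := by gcongr
        _ = _ := by ring
    linarith
  have h5 : |η / 2 * κ * (x ^ 2 - x' ^ 2)| ≤ k * K * ε * ‖e‖ := by
    rw [abs_mul, abs_mul, abs_of_pos (by positivity : 0 < η / 2)]
    calc η / 2 * |κ| * |x ^ 2 - x' ^ 2| ≤ η / 2 * |κ| * (2 * (K * δ) * ‖e‖) := by gcongr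
      _ = K * ‖e‖ * (η * |κ| * δ) := by ring
      _ ≤ K * ‖e‖ * (k * ε ^ 2) := by gcongr
      _ = k * K * ‖e‖ * ε * ε := by ring
      _ ≤ k * K * ‖e‖ * ε * 1 := by gcongr
      _ = _ := by ring
  have h6 : ‖(η * (y * x - y' * x') + η / 2 * κ * (x ^ 2 - x' ^ 2)) • u‖ ≤
      4 * K * ε * ‖e‖ + k * K * ε * ‖e‖ := by
    rw [norm_smul, h.unit, mul_one, Real.norm_eq_abs]
    exact (abs_add_le _ _).trans (add_le_add h4 h5)
  rw [hsplit]
  refine (norm_sub_le _ _).trans ?_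
  have h7 := norm_sub_le ((perp u e - ⟪u, e⟫_ℝ • u) - η • H (perp u e))
    ((η / 2 * (x ^ 2 - x' ^ 2)) • g)
  have h8 := norm_sub_le (perp u e - ⟪u, e⟫_ℝ • u) (η • H (perp u e))
  rw [h1] at h8
  have e1 : (1 + (ν + (6 + k) * K) * ε) * ‖e‖ = ‖e‖ + ν * ε * ‖e‖ + 2 * K * ε * ‖e‖
    + (4 * K * ε * ‖e‖ + k * K * ε * ‖e‖) := by ring
  linarith

/-- Lyapunov function of the self-stabilization dynamics. -/
noncomputable def lyapunov (u v : Param d) : ℝ := ‖v‖ ^ 2 - ⟪u, v⟫_ℝ ^ 2 / 2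

set_option maxHeartbeats 1000000 in
/-- The Lyapunov function grows by a factor `1 + O(ε)` along a noiseless step, with a constant which
does not depend on the size of the region. -/
theorem lyapunov_step_le (h : StepScales H u g η κ ε δ ν k) (hε : ε ≤ 1)
    (hε1 : (2 * K + k * K) ^ 2 * ε + 2 * (k * K * ε) ≤ 1) (hε2 : (1 + K ^ 2) ^ 2 * ε ≤ 1)
    {v : Param d} (hv : ‖v‖ ≤ K * δ) :
    lyapunov u (noiselessStep H u g η κ δ v) ≤
      (1 + (2 * ν + ν ^ 2 + 2) * ε) * lyapunov u v + 2 * ε * δ ^ 2 := by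
  have hη := h.η_pos
  have hδ := h.δ_pos
  have hgle := h.g_le
  have hκle := h.κ_le
  have he := h.ε_pos
  have hk := h.k_nonneg
  have hν := h.ν_nonneg
  have hK : 0 ≤ K := nonneg_of_mul_nonneg_left ((norm_nonneg v).trans hv) hδ
  set x := ⟪u, v⟫_ℝ with hx
  set y := ⟪g, v⟫_ℝ with hy
  set w := perp u v with hw
  have huw : ⟪u, w⟫_ℝ = 0 := inner_perp_right h.unit v
  have hxK : |x| ≤ K * δ := (h.abs_inner_u_le v).trans hv
  have hxK2 : x ^ 2 ≤ (K * δ) ^ 2 := sq_le_sq' (by linarith [abs_le.1 hxK]) (abs_le.1 hxK).2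
  set p := η * y + η / 2 * κ * x with hp
  have hp1 : |η * y| ≤ 2 * K * ε := h.abs_eta_inner_g_le hv
  have hp2 : |η / 2 * κ * x| ≤ k * K * ε ^ 2 := by
    rw [abs_mul, abs_mul, abs_of_pos (by positivity : 0 < η / 2)]
    calc η / 2 * |κ| * |x| ≤ η / 2 * |κ| * (K * δ) := by gcongr
      _ = K * (η * |κ| * δ) / 2 := by ring
      _ ≤ K * (k * ε ^ 2) / 2 := by gcongr
      _ ≤ _ := by nlinarith [mul_nonneg (mul_nonneg hK hk) (sq_nonneg ε)]
  have hpb : p ^ 2 ≤ (2 * K + k * K) ^ 2 * ε ^ 2 := by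
    have h1 : |p| ≤ (2 * K + k * K) * ε := by
      refine (abs_add_le _ _).trans ((add_le_add hp1 hp2).trans ?_)
      nlinarith [mul_nonneg (mul_nonneg hk hK) he.le]
    rw [← sq_abs, ← mul_pow]
    gcongr
  have hmx : ((1 + η * y) * x + η / 2 * κ * x ^ 2) ^ 2 ≤ x ^ 2 + 2 * (η * y * x ^ 2) + ε * x ^ 2 := by
    have h1 : ((1 + η * y) * x + η / 2 * κ * x ^ 2) ^ 2 =
        (1 + 2 * (η * y) + (p ^ 2 + 2 * (η / 2 * κ * x))) * x ^ 2 := by rw [hp]; ring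
    -- All terms containing `K` are `O(ε²)`, so one factor `ε` absorbs their constants; this keeps
    -- `K` out of the growth rate.
    have h2 : p ^ 2 + 2 * (η / 2 * κ * x) ≤ ε := by
      have h3 := (abs_le.1 hp2).2
      have h4 : ((2 * K + k * K) ^ 2 * ε + 2 * (k * K * ε)) * ε ≤ 1 * ε := by gcongr
      linarith
    rw [h1]
    linarith [mul_le_mul_of_nonneg_right h2 (sq_nonneg x)]
  have hyw : y = ⟪g, w⟫_ℝ := (h.inner_g_perp v).symm
  set r := η * ((δ ^ 2 - x ^ 2) / 2) with hr
  have hperp : perp u (noiselessStep H u g η κ δ v) = (w - η • H w) + r • g := by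
    have h1 : noiselessStep H u g η κ δ v = ((w - η • H w) + r • g)
        + ⟪u, noiselessStep H u g η κ δ v⟫_ℝ • u := by
      rw [h.inner_u_step]
      conv_lhs => rw [h.noiselessStep_eq]
      module
    rw [perp]
    exact sub_eq_of_eq_add h1
  have hwH : ‖w - η • H w‖ ≤ (1 + ν * ε) * ‖w‖ := by
    refine (norm_sub_le _ _).trans ?_
    rw [norm_smul, Real.norm_eq_abs, abs_of_pos hη]
    linarith [h.hess_perp w huw]
  have hwH2 : ‖w - η • H w‖ ^ 2 ≤ ‖w‖ ^ 2 + (2 * ν + ν ^ 2) * ε * ‖w‖ ^ 2 := by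
    have h1 : ‖w - η • H w‖ ^ 2 ≤ ((1 + ν * ε) * ‖w‖) ^ 2 := by gcongr
    refine h1.trans ?_
    have h2 : ν ^ 2 * ε * ε * ‖w‖ ^ 2 ≤ ν ^ 2 * ε * 1 * ‖w‖ ^ 2 := by gcongr
    linarith
  have hmw : ‖(w - η • H w) + r • g‖ ^ 2 = ‖w - η • H w‖ ^ 2 + 2 * r * y + r ^ 2 * ‖g‖ ^ 2 := by
    rw [norm_add_sq_real, real_inner_smul_right, norm_smul, Real.norm_eq_abs, mul_pow, sq_abs,
      inner_sub_left, real_inner_smul_left, real_inner_comm, ← hyw, h.symm, h.ker, inner_zero_right]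
    ring
  have hrg : r ^ 2 * ‖g‖ ^ 2 ≤ ε * δ ^ 2 := by
    have h1 : (δ ^ 2 - x ^ 2) ^ 2 ≤ ((1 + K ^ 2) * δ ^ 2) ^ 2 := by
      rw [mul_pow] at hxK2
      have hKδ := mul_nonneg (sq_nonneg K) (sq_nonneg δ)
      refine sq_le_sq' ?_ ?_
      · linarith [sq_nonneg δ]
      · linarith [sq_nonneg x]
    have h2 : (η * ‖g‖ * δ) ^ 2 ≤ (2 * ε) ^ 2 := by
      gcongr
    calc r ^ 2 * ‖g‖ ^ 2 = (η * ‖g‖) ^ 2 * (δ ^ 2 - x ^ 2) ^ 2 / 4 := by rw [hr]; ring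
      _ ≤ (η * ‖g‖) ^ 2 * ((1 + K ^ 2) * δ ^ 2) ^ 2 / 4 := by gcongr
      _ = (η * ‖g‖ * δ) ^ 2 * ((1 + K ^ 2) ^ 2 * δ ^ 2) / 4 := by ring
      _ ≤ (2 * ε) ^ 2 * ((1 + K ^ 2) ^ 2 * δ ^ 2) / 4 := by gcongr
      _ = ((1 + K ^ 2) ^ 2 * ε) * (ε * δ ^ 2) := by ring
      _ ≤ 1 * (ε * δ ^ 2) := by gcongr
      _ = _ := one_mul _
  have hcross : η * δ ^ 2 * y ≤ ε * (δ ^ 2 + ‖w‖ ^ 2) := by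
    have h1 : y ≤ ‖g‖ * ‖w‖ := by rw [hyw]; exact real_inner_le_norm _ _
    calc η * δ ^ 2 * y ≤ η * δ ^ 2 * (‖g‖ * ‖w‖) := by gcongr
      _ = (η * ‖g‖ * δ) * (δ * ‖w‖) := by ring
      _ ≤ (2 * ε) * (δ * ‖w‖) := by gcongr
      _ ≤ ε * (δ ^ 2 + ‖w‖ ^ 2) := by linarith [mul_nonneg he.le (sq_nonneg (δ - ‖w‖))]
  have hVstep : lyapunov u (noiselessStep H u g η κ δ v) =
      ((1 + η * y) * x + η / 2 * κ * x ^ 2) ^ 2 / 2 + ‖(w - η • H w) + r • g‖ ^ 2 := by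
    rw [lyapunov, norm_sq_eq_inner_sq_add h.unit, hperp, h.inner_u_step]
    ring
  have hV : lyapunov u v = x ^ 2 / 2 + ‖w‖ ^ 2 := by
    rw [lyapunov, norm_sq_eq_inner_sq_add h.unit v]; ring
  rw [hVstep, hV, hmw]
  -- The term `-η y x²` cancels `η y x²`, which is half of the cross term in `hmx`. This is why
  -- `lyapunov` gives `x²` the weight `1/2`.
  have h9 : 2 * r * y = η * δ ^ 2 * y - η * y * x ^ 2 := by rw [hr]; ring
  have h10 : 0 ≤ ν * ε * x ^ 2 := by positivity
  have h11 : 0 ≤ ν ^ 2 * ε * x ^ 2 := by positivity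
  have h12 : 0 ≤ ε * x ^ 2 := by positivity
  have h13 : 0 ≤ ε * ‖w‖ ^ 2 := by positivity
  rw [h9]
  linarith

theorem half_norm_sq_le_lyapunov (hu : ‖u‖ = 1) (v : Param d) : ‖v‖ ^ 2 / 2 ≤ lyapunov u v := by
  rw [lyapunov, norm_sq_eq_inner_sq_add hu v]
  nlinarith [sq_nonneg ‖perp u v‖]

theorem lyapunov_nonneg (hu : ‖u‖ = 1) (v : Param d) : 0 ≤ lyapunov u v :=
  le_trans (by positivity) (half_norm_sq_le_lyapunov hu v)

theorem lyapunov_le (u v : Param d) : lyapunov u v ≤ ‖v‖ ^ 2 := by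
  rw [lyapunov]; nlinarith [sq_nonneg ⟪u, v⟫_ℝ]

end StepScales

/-- The noiseless step approximates a gradient step seen from a corrected reference point. -/
theorem Edge.norm_gradient_step_sub_le {L : Param d → ℝ} {θ u : Param d}
    {η R ρ a ν μ κ δ ε ν' k : ℝ} (h : Edge L θ u η R ρ a ν)
    (hs : StepScales (hess L θ) u (Edge.sperp L θ u) η κ ε δ ν' k)
    (hκ : κ = ⟪third L θ u u, u⟫_ℝ)
    (hμ : ∀ v w, ⟪u, v⟫_ℝ = 0 → ⟪u, w⟫_ℝ = 0 → ‖third L θ v w‖ ≤ μ * ‖v‖ * ‖w‖) (hμ0 : 0 ≤ μ)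
    {v : Param d} (hv : ‖v‖ < R) :
    ‖v + (η * δ ^ 2 / 2) • Edge.sperp L θ u - η • (gradient L (θ + v) - gradient L θ)
      - noiselessStep (hess L θ) u (Edge.sperp L θ u) η κ δ v‖ ≤
      2 * η * μ * ‖v‖ ^ 2 + a * (η * ρ) ^ 2 * ‖v‖ ^ 3 := by
  have hη := h.η_pos
  set g := Edge.sperp L θ u with hg
  set x := ⟪u, v⟫_ℝ with hx
  set w := perp u v with hw
  have huw : ⟪u, w⟫_ℝ = 0 := inner_perp_right h.unit v
  have hvdec : v = x • u + w := inner_smul_add_perp u v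
  have hwn : ‖w‖ ≤ ‖v‖ := norm_perp_le h.unit v
  have hxn : |x| ≤ ‖v‖ := hs.abs_inner_u_le v
  set T := third L θ with hT
  have hgS : T u u = g + κ • u := by
    rw [hg, Edge.sperp, perp, hκ, real_inner_comm]; abel
  have hTuw : ⟪u, T u w⟫_ℝ = ⟪g, v⟫_ℝ := by
    rw [← hs.inner_g_perp v, ← hw, hg, Edge.inner_sperp_of_perp huw, hT, h.third_symm,
      real_inner_comm, h.third_symm]
  have hTdec : T v v = x ^ 2 • (g + κ • u) + (2 * x) • (⟪g, v⟫_ℝ • u + perp u (T u w)) + T w w := by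
    have h1 : T v v = x ^ 2 • T u u + (2 * x) • T u w + T w w := by
      conv_lhs => rw [hvdec]
      simp only [map_add, map_smul, add_apply, smul_apply]
      rw [show T w u = T u w from h.third_comm w u]
      module
    rw [h1, hgS]
    congr 3
    rw [← hTuw]; exact inner_smul_add_perp u _
  have hHdec : hess L θ v = (x * (2 / η)) • u + hess L θ w := by
    conv_lhs => rw [hvdec]
    rw [map_add, map_smul, h.eig, smul_smul]
  -- By symmetry of the third derivative, pairing `T u w` with `z ⊥ u` is pairing `T w z` with `u`,
  -- so the bound on the complement applies.
  have hperpT : ‖perp u (T u w)‖ ≤ μ * ‖w‖ := by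
    set z := perp u (T u w) with hz
    have huz : ⟪u, z⟫_ℝ = 0 := inner_perp_right h.unit _
    have h1 : ‖z‖ ^ 2 = ⟪T w z, u⟫_ℝ := by
      have h2 : ⟪z, z⟫_ℝ = ⟪T u w, z⟫_ℝ := by
        have h3 : T u w = ⟪u, T u w⟫_ℝ • u + z := inner_smul_add_perp u _
        conv_rhs => rw [h3]
        rw [inner_add_left, real_inner_smul_left, huz, mul_zero, zero_add]
      rw [← real_inner_self_eq_norm_sq, h2, hT, h.third_comm u w, h.third_symm, real_inner_comm]
    have h3 : ‖z‖ * ‖z‖ ≤ μ * ‖w‖ * ‖z‖ := by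
      rw [← pow_two, h1]
      refine (real_inner_le_norm _ _).trans ?_
      rw [h.unit, mul_one]
      exact hμ w z huw huz
    rcases (norm_nonneg z).eq_or_lt with h0 | h0
    · rw [← h0]; positivity
    · exact le_of_mul_le_mul_right h3 h0
  set E := gradient L (θ + v) - gradient L θ - hess L θ v - (1 / 2 : ℝ) • T v v with hE
  have hEn : ‖E‖ ≤ a * (η * ρ ^ 2) * ‖v‖ ^ 3 := h.norm_gradient_taylor_two_le hv
  -- The eigenvalue `2/η` flips the sign of `x`, and the components of `T v v` along `g` and `u`
  -- reproduce the feedback, interaction and `κ` terms. Only components of `T` controlled by `μ`,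
  -- and the Taylor remainder, are left.
  have hmain : v + (η * δ ^ 2 / 2) • g - η • (gradient L (θ + v) - gradient L θ)
      - noiselessStep (hess L θ) u g η κ δ v =
      -((η * x) • perp u (T u w)) - (η / 2) • T w w - η • E := by
    have h1 : gradient L (θ + v) - gradient L θ = E + hess L θ v + (1 / 2 : ℝ) • T v v := by
      rw [hE]; abel
    rw [h1, hs.noiselessStep_eq, hTdec, hHdec]
    have h2 : η • ((x * (2 / η)) • u) = (2 * x) • u := by
      rw [smul_smul]; congr 1; field_simp
    have h3 : η • (E + ((x * (2 / η)) • u + hess L θ w) + (1 / 2 : ℝ) •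
        (x ^ 2 • (g + κ • u) + (2 * x) • (⟪g, v⟫_ℝ • u + perp u (T u w)) + T w w)) =
        η • E + ((2 * x) • u + η • hess L θ w) + η • (1 / 2 : ℝ) •
        (x ^ 2 • (g + κ • u) + (2 * x) • (⟪g, v⟫_ℝ • u + perp u (T u w)) + T w w) := by
      rw [smul_add, smul_add, smul_add, h2]
    rw [h3]
    conv_lhs => enter [1, 1, 1]; rw [hvdec]
    rw [← hx, ← hw]
    module
  rw [hmain]
  refine (norm_sub_le _ _).trans ?_
  have h4 := norm_sub_le (-((η * x) • perp u (T u w))) ((η / 2) • T w w)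
  rw [norm_neg, norm_smul, norm_smul, Real.norm_eq_abs, Real.norm_eq_abs, abs_mul, abs_of_pos hη,
    abs_of_pos (by positivity : 0 < η / 2)] at h4
  rw [norm_smul, Real.norm_eq_abs, abs_of_pos hη]
  have h5 : η * |x| * ‖perp u (T u w)‖ ≤ η * μ * ‖v‖ ^ 2 := by
    calc η * |x| * ‖perp u (T u w)‖ ≤ η * ‖v‖ * (μ * ‖v‖) := by
          gcongr; exact hperpT.trans (by gcongr)
      _ = _ := by ring
  have h6 : η / 2 * ‖T w w‖ ≤ η * μ * ‖v‖ ^ 2 := by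
    have h7 : ‖T w w‖ ≤ μ * ‖v‖ ^ 2 := by
      refine (hμ w w huw huw).trans ?_
      rw [mul_assoc, ← pow_two]; gcongr
    have h8 : 0 ≤ μ * ‖v‖ ^ 2 := by positivity
    nlinarith
  have h9 : η * ‖E‖ ≤ a * (η * ρ) ^ 2 * ‖v‖ ^ 3 := by
    calc η * ‖E‖ ≤ η * (a * (η * ρ ^ 2) * ‖v‖ ^ 3) := by gcongr
      _ = _ := by ring
  linarith

end Step

/-! ### Coupling of SGD with the predicted dynamics -/

section Coupling

variable {d n : ℕ}

/-- One noiseless step of the frozen predicted dynamics of a problem. -/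
noncomputable def Problem.step (p : Problem d n) (v : Param d) : Param d :=
  noiselessStep (hess p.L (p.ref 0)) (p.u 0) (p.gradSperp 0) p.η (p.kappa 0) p.δ v

/-- One noiseless step of the displacement of SGD from the reference trajectory. -/
noncomputable def Problem.dispStep (p : Problem d n) (t : ℕ) (v : Param d) : Param d :=
  v - p.η • (gradient p.L (p.ref t + v) - gradient p.L (p.ref t))
    - (p.ref (t + 1) - (p.ref t - p.η • gradient p.L (p.ref t)))

variable {c : Constants} {p : Problem d n}

theorem Frozen.predicted_succ (h : Frozen c p) (v₀ : Param d) (ξ : ℕ → Param d) {t : ℕ}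
    (ht : t < p.T) : p.predicted v₀ ξ (t + 1) = p.step (p.predicted v₀ ξ t) - p.η • ξ t := by
  rw [Problem.predicted, Problem.step, noiselessStep, h.u_const _ ht, h.u_const _ ht.le,
    h.hess_const _ ht.le, h.gradSperp_const _ ht.le, h.kappa_const _ ht.le, h.deltaAt_eq ht.le,
    h.delta_eq]

theorem Landscape.stepScales (h : Landscape c p) (hf : Frozen c p) (hgap : c.cgap < 2)
    (hβ : 0 < c.cβ) (hε : 2 * |c.Cnw| * p.ε ≤ 1) :
    StepScales (hess p.L (p.ref 0)) (p.u 0) (p.gradSperp 0) p.η (p.kappa 0) p.ε p.δ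
      (2 * |c.Cnw|) (|c.cκ| * (2 / c.cβ)) where
  η_pos := h.η_pos
  ε_pos := h.eps_pos hf
  δ_pos := hf.delta_pos
  ν_nonneg := by positivity
  k_nonneg := by positivity
  unit := h.unit
  symm := (h.edge hf hgap hε (Nat.zero_le _)).hess_symm
    (h.edge hf hgap hε (Nat.zero_le _)).self_mem
  eig := h.hess_u hf (Nat.zero_le _)
  orth := inner_perp_right h.unit _
  ker := hf.gradSperp_ker
  hess_perp w hw := by
    have hη := h.η_pos
    have := h.hess_perp_le hf hgap hε (Nat.zero_le _) hw
    calc p.η * ‖hess p.L (p.ref 0) w‖ ≤ p.η * (2 * |c.Cnw| * p.ε / p.η * ‖w‖) := by gcongr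
      _ = _ := by field_simp
  g_le := h.eta_gradSperp_delta_le hf
  κ_le := by
    have hη := h.η_pos
    have hδ := hf.delta_pos
    have he := h.eps_pos hf
    have hρ := h.ρ3_pos
    have h1 : |p.kappa 0| ≤ |c.cκ| * (p.ε * p.ρ3) :=
      hf.kappa_le.trans (by gcongr; exact le_abs_self _)
    have h2 := h.eta_rho_delta_le hf hβ
    calc p.η * |p.kappa 0| * p.δ ≤ p.η * (|c.cκ| * (p.ε * p.ρ3)) * p.δ := by gcongr
      _ = |c.cκ| * p.ε * (p.η * p.ρ3 * p.δ) := by ring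
      _ ≤ |c.cκ| * p.ε * (2 / c.cβ * p.ε) := by gcongr
      _ = _ := by ring

theorem Landscape.lt_radius (h : Landscape c p) (hf : Frozen c p) (hβ : 0 < c.cβ) {K : ℝ}
    (hK : 0 ≤ K) (hε : K * (2 / c.cβ) * p.ε < (2 - c.cgap) / 4) : K * p.δ < radius c p := by
  have hη := h.η_pos
  have hρ := h.ρ3_pos
  have h2 := h.eta_rho_delta_le hf hβ
  rw [radius, lt_div_iff₀ (by positivity)]
  calc K * p.δ * (4 * p.η * p.ρ3) = 4 * (K * (p.η * p.ρ3 * p.δ)) := by ring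
    _ ≤ 4 * (K * (2 / c.cβ * p.ε)) := by gcongr
    _ = 4 * (K * (2 / c.cβ) * p.ε) := by ring
    _ < 4 * ((2 - c.cgap) / 4) := by gcongr
    _ = _ := by ring

/-- The displacement step agrees with the predicted step up to `O(ε² δ)`. -/
theorem exists_dispStep_bound (c : Constants) (hgap : c.cgap < 2) (hα : 0 < c.cα)
    (hβ : 0 < c.cβ) {K : ℝ} (hK : 0 ≤ K) : ∃ C ε₀ : ℝ, 0 < C ∧ 0 < ε₀ ∧
      ∀ (d n : ℕ) (p : Problem d n), Landscape c p → Frozen c p → p.ε ≤ ε₀ → ∀ t < p.T,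
        ∀ v : Param d, ‖v‖ ≤ K * p.δ → ‖p.dispStep t v - p.step v‖ ≤ C * (p.ε ^ 2 * p.δ) := by
  obtain ⟨C₁, ε₁, hC₁, hε₁, key⟩ := exists_reference_step_bound c hgap hα hβ
  set b := 2 / c.cβ with hb
  have hb0 : 0 < b := by positivity
  have hgap' : 0 < 2 - c.cgap := by linarith
  obtain ⟨ε₀, ⟨⟨hx1, hx2⟩, hx3⟩, hx0⟩ := (((eventually_mul_lt (2 * |c.Cnw|) one_pos).and
    (eventually_mul_lt 1 hε₁)).and
    (eventually_mul_lt (K * b) (by positivity : 0 < (2 - c.cgap) / 4))).and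
    self_mem_nhdsWithin |>.exists
  have hx0' : 0 < ε₀ := hx0
  refine ⟨2 * |c.Cnw| * b * K ^ 2 + |c.C4| * b ^ 2 * K ^ 3 + C₁, ε₀, by positivity, hx0', ?_⟩
  intro d n p hl hf hε t ht v hv
  have he := hl.eps_pos hf
  have hη := hl.η_pos
  have hρ := hl.ρ3_pos
  have hδ := hf.delta_pos
  have hnw : 2 * |c.Cnw| * p.ε ≤ 1 := le_trans (by gcongr) hx1.le
  have hedge := hl.edge hf hgap hnw ht.le
  have hscales := hl.stepScales hf hgap hβ hnw
  have hbρ := hl.eta_rho_delta_le hf hβ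
  have hvR : ‖v‖ < Landscape.radius c p :=
    hv.trans_lt (hl.lt_radius hf hβ hK (lt_of_le_of_lt (by gcongr) hx3))
  have hζ := key d n p hl hf (by linarith) t ht
  have hs := hl.gradSperp_eq hf hgap hnw ht.le
  rw [← hf.hess_const t ht.le, ← hs] at hscales
  have hmain := hedge.norm_gradient_step_sub_le (μ := |c.Cnw| * p.ε * p.ρ3) hscales
    (hl.inner_third_unit hf hgap hnw ht.le).symm
    (by
      intro v w hv hw
      rw [← hf.u_const t ht.le] at hv hw
      refine (hl.nonworst_third t ht.le v w hv hw).trans ?_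
      calc c.Cnw * p.ε * (p.ρ3 * ‖v‖ * ‖w‖) ≤ |c.Cnw| * p.ε * (p.ρ3 * ‖v‖ * ‖w‖) := by
            gcongr; exact le_abs_self _
        _ = _ := by ring) (by positivity) hvR
  rw [hs, hf.hess_const t ht.le] at hmain
  -- The correction `(η δ²/2) ∇S^⊥` in the reference step supplies the constant part of the feedback
  -- `δ² - x²`.
  have hsplit : p.dispStep t v - p.step v =
      (v + (p.η * p.δ ^ 2 / 2) • p.gradSperp 0
        - p.η • (gradient p.L (p.ref t + v) - gradient p.L (p.ref t)) - p.step v)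
      - (p.ref (t + 1) - (p.ref t - p.η • gradient p.L (p.ref t))
          + (p.η * p.δ ^ 2 / 2) • p.gradSperp 0) := by
    rw [Problem.dispStep]; abel
  rw [hsplit]
  refine (norm_sub_le _ _).trans ((add_le_add hmain hζ).trans ?_)
  have h1 : 2 * p.η * (|c.Cnw| * p.ε * p.ρ3) * ‖v‖ ^ 2 ≤
      2 * |c.Cnw| * b * K ^ 2 * (p.ε ^ 2 * p.δ) := by
    calc 2 * p.η * (|c.Cnw| * p.ε * p.ρ3) * ‖v‖ ^ 2
        ≤ 2 * p.η * (|c.Cnw| * p.ε * p.ρ3) * (K * p.δ) ^ 2 := by gcongr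
      _ = 2 * |c.Cnw| * K ^ 2 * p.ε * p.δ * (p.η * p.ρ3 * p.δ) := by ring
      _ ≤ 2 * |c.Cnw| * K ^ 2 * p.ε * p.δ * (b * p.ε) := by gcongr
      _ = _ := by ring
  have h2 : |c.C4| * (p.η * p.ρ3) ^ 2 * ‖v‖ ^ 3 ≤ |c.C4| * b ^ 2 * K ^ 3 * (p.ε ^ 2 * p.δ) := by
    calc |c.C4| * (p.η * p.ρ3) ^ 2 * ‖v‖ ^ 3 ≤ |c.C4| * (p.η * p.ρ3) ^ 2 * (K * p.δ) ^ 3 := by gcongr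
      _ = |c.C4| * K ^ 3 * p.δ * (p.η * p.ρ3 * p.δ) ^ 2 := by ring
      _ ≤ |c.C4| * K ^ 3 * p.δ * (b * p.ε) ^ 2 := by gcongr
      _ = _ := by ring
  linarith

theorem disp_succ {Ω : Type*} (p : Problem d n) (θ₀ : Ω → Param d) (B : ℕ → Ω → Finset (Fin n))
    (t : ℕ) (ω : Ω) :
    disp p θ₀ B (t + 1) ω = p.dispStep t (disp p θ₀ B t ω) - p.η • xi p θ₀ B t ω := by
  have h1 : iter p θ₀ B (t + 1) ω =
      iter p θ₀ B t ω - p.η • batchGrad p.ℓ p.b (B t ω) (iter p θ₀ B t ω) := rfl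
  have h2 : p.ref t + disp p θ₀ B t ω = iter p θ₀ B t ω := by rw [disp]; abel
  have h3 : xi p θ₀ B t ω = batchGrad p.ℓ p.b (B t ω) (iter p θ₀ B t ω)
      - gradient p.L (iter p θ₀ B t ω) := rfl
  rw [Problem.dispStep, h2, h3, disp, disp, h1]
  module

theorem Frozen.dispHat_succ {Ω : Type*} (h : Frozen c p) (θ₀ : Ω → Param d)
    (B : ℕ → Ω → Finset (Fin n)) {t : ℕ} (ht : t < p.T) (ω : Ω) :
    dispHat p θ₀ B (t + 1) ω = p.step (dispHat p θ₀ B t ω) - p.η • xi p θ₀ B t ω :=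
  h.predicted_succ _ _ ht

theorem dispHat_zero {Ω : Type*} (p : Problem d n) (θ₀ : Ω → Param d)
    (B : ℕ → Ω → Finset (Fin n)) (ω : Ω) : dispHat p θ₀ B 0 ω = disp p θ₀ B 0 ω := rfl

/-- As long as the predicted dynamics stay at distance `O(δ)`, SGD is `O(ε δ)`-close to them. -/
theorem exists_coupling_bound (c : Constants) (hgap : c.cgap < 2) (hα : 0 < c.cα)
    (hβ : 0 < c.cβ) {K : ℝ} (hK : 0 ≤ K) : ∃ K₁ ε₀ : ℝ, 0 ≤ K₁ ∧ 0 < ε₀ ∧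
      ∀ (d n : ℕ) (p : Problem d n) (Ω : Type*) (θ₀ : Ω → Param d) (B : ℕ → Ω → Finset (Fin n)),
        Landscape c p → Frozen c p → p.ε ≤ ε₀ → ∀ ω : Ω,
        (∀ t ≤ p.T, ‖dispHat p θ₀ B t ω‖ ≤ K * p.δ) → ∀ t ≤ p.T,
          ‖disp p θ₀ B t ω - dispHat p θ₀ B t ω‖ ≤ K₁ * (p.ε * p.δ) ∧
          ‖disp p θ₀ B t ω‖ ≤ (K + 1) * p.δ := by
  -- The step estimates are needed at the SGD displacement itself, which lies within `K₁ ε δ ≤ δ` of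
  -- the predicted one; hence the radius `(K + 1) δ`.
  have hK1 : 0 ≤ K + 1 := by linarith
  obtain ⟨C, ε₁, hC, hε₁, key⟩ := exists_dispStep_bound c hgap hα hβ hK1
  set A := 2 * |c.Cnw| + (6 + |c.cκ| * (2 / c.cβ)) * (K + 1) with hA
  have hA0 : 0 ≤ A := by positivity
  set K₁ := |c.cT| * Real.exp (A * |c.cT|) * C with hK₁
  obtain ⟨ε₀, ⟨⟨⟨hx1, hx2⟩, hx3⟩, hx4⟩, hx0⟩ := ((((eventually_mul_lt (2 * |c.Cnw|) one_pos).and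
    (eventually_mul_lt 1 hε₁)).and (eventually_mul_lt K₁ one_pos)).and
    (eventually_mul_lt 1 one_pos)).and self_mem_nhdsWithin |>.exists
  refine ⟨K₁, ε₀, by positivity, hx0, ?_⟩
  intro d n p Ω θ₀ B hl hf hε ω hhat
  have he := hl.eps_pos hf
  have hδ := hf.delta_pos
  have hnw : 2 * |c.Cnw| * p.ε ≤ 1 := le_trans (by gcongr) hx1.le
  have hscales := hl.stepScales hf hgap hβ hnw
  have hTε : p.T * p.ε ≤ |c.cT| := (hl.T_mul_eps_le hf).trans (le_abs_self _)
  set e : ℕ → ℝ := fun t => ‖disp p θ₀ B t ω - dispHat p θ₀ B t ω‖ with hedef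
  -- Since `t ε` is bounded, `(1 + A ε)^t` is bounded, and `t` errors of size `ε² δ` add up to `O(ε
  -- δ)`.
  have hpow : ∀ t ≤ p.T, t * (C * (p.ε ^ 2 * p.δ)) * (1 + A * p.ε) ^ t ≤ K₁ * (p.ε * p.δ) := by
    intro t ht
    have htT : t * p.ε ≤ |c.cT| := le_trans (by gcongr) hTε
    have h1 : (1 + A * p.ε) ^ t ≤ Real.exp (A * |c.cT|) := by
      calc (1 + A * p.ε) ^ t ≤ Real.exp (A * p.ε) ^ t := by
            gcongr; linarith [Real.add_one_le_exp (A * p.ε)]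
        _ = Real.exp (A * (t * p.ε)) := by rw [← Real.exp_nat_mul]; ring_nf
        _ ≤ _ := by gcongr
    calc t * (C * (p.ε ^ 2 * p.δ)) * (1 + A * p.ε) ^ t
        = (t * p.ε) * (1 + A * p.ε) ^ t * C * (p.ε * p.δ) := by ring
      _ ≤ |c.cT| * Real.exp (A * |c.cT|) * C * (p.ε * p.δ) := by gcongr
      _ = _ := rfl
  have hdisp : ∀ t ≤ p.T, e t ≤ K₁ * (p.ε * p.δ) → ‖disp p θ₀ B t ω‖ ≤ (K + 1) * p.δ := by
    intro t ht het
    have h1 : ‖disp p θ₀ B t ω‖ ≤ e t + ‖dispHat p θ₀ B t ω‖ := by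
      simpa using norm_add_le (disp p θ₀ B t ω - dispHat p θ₀ B t ω) (dispHat p θ₀ B t ω)
    have h2 : K₁ * (p.ε * p.δ) ≤ 1 * p.δ := by
      rw [← mul_assoc]
      have : K₁ * p.ε ≤ 1 := le_trans (by gcongr) hx3.le
      gcongr
    have := hhat t ht
    linarith
  -- Discrete Grönwall with a bootstrap: the bound at time `t` keeps SGD in the ball where the step
  -- estimates hold, and these give the bound at `t + 1`.
  have hmain : ∀ t ≤ p.T, e t ≤ t * (C * (p.ε ^ 2 * p.δ)) * (1 + A * p.ε) ^ t := by
    intro t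
    induction t with
    | zero => intro _; simp [hedef, dispHat_zero]
    | succ t ih =>
      intro ht
      have ht' : t < p.T := ht
      have het := ih ht'.le
      have hv := hdisp t ht'.le (het.trans (hpow t ht'.le))
      have h1 := key d n p hl hf (by linarith) t ht' _ hv
      have h2 := hscales.norm_step_sub_le (K := K + 1) (by linarith) hv
        ((hhat t ht'.le).trans (by gcongr; linarith))
      have h3 : e (t + 1) ≤ C * (p.ε ^ 2 * p.δ) + (1 + A * p.ε) * e t := by
        have h4 : disp p θ₀ B (t + 1) ω - dispHat p θ₀ B (t + 1) ω =
            (p.dispStep t (disp p θ₀ B t ω) - p.step (disp p θ₀ B t ω)) +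
            (p.step (disp p θ₀ B t ω) - p.step (dispHat p θ₀ B t ω)) := by
          rw [disp_succ, hf.dispHat_succ θ₀ B ht']; abel
        simp only [hedef, h4]
        exact (norm_add_le _ _).trans (add_le_add h1 h2)
      have h5 : 1 ≤ (1 + A * p.ε) ^ (t + 1) := one_le_pow₀ (by nlinarith)
      have h6 : 0 ≤ C * (p.ε ^ 2 * p.δ) := by positivity
      calc e (t + 1) ≤ C * (p.ε ^ 2 * p.δ) + (1 + A * p.ε) * e t := h3
        _ ≤ C * (p.ε ^ 2 * p.δ) * (1 + A * p.ε) ^ (t + 1) +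
            (1 + A * p.ε) * (t * (C * (p.ε ^ 2 * p.δ)) * (1 + A * p.ε) ^ t) := 
          add_le_add (le_mul_of_one_le_right h6 h5) (mul_le_mul_of_nonneg_left het (by positivity))
        _ = _ := by push_cast; ring
  intro t ht
  have h1 := (hmain t ht).trans (hpow t ht)
  exact ⟨h1, hdisp t ht h1⟩

end Coupling

open scoped ENNReal

/-! ### Averaging over a uniform batch independent of the past -/

section Averaging

variable {Ω : Type*} {n b : ℕ}

theorem measurable_finset_apply {m : MeasurableSpace Ω} {E : Type*} [MeasurableSpace E]
    {A : Ω → Finset (Fin n)} (hA : ∀ S, MeasurableSet {ω | A ω = S}) {h : Finset (Fin n) → Ω → E}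
    (hh : ∀ S, Measurable (h S)) : Measurable fun ω => h (A ω) ω := by
  intro U hU
  have : (fun ω => h (A ω) ω) ⁻¹' U = ⋃ S, {ω | A ω = S} ∩ h S ⁻¹' U := by
    ext ω; simp
  rw [this]
  exact MeasurableSet.iUnion fun S => (hA S).inter (hh S hU)

/-- Under `μ`, the batch `A` is uniform among the batches of size `b` and independent of the
σ-algebra `m`. -/
structure UniformBatch (m : MeasurableSpace Ω) {m0 : MeasurableSpace Ω} (μ : Measure Ω)
    (A : Ω → Finset (Fin n)) (b : ℕ) : Prop where
  le : m ≤ m0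
  size_le : b ≤ n
  measurable : ∀ S, MeasurableSet {ω | A ω = S}
  unif : ∀ S : Finset (Fin n), S.card = b → ∀ E, MeasurableSet[m] E →
    μ ({ω | A ω = S} ∩ E) = μ E / ((n.choose b : ℕ) : ℝ≥0∞)

/-- The batches of size `b`. -/
abbrev batches (n b : ℕ) : Finset (Finset (Fin n)) := Finset.univ.powersetCard b

theorem card_batches (n b : ℕ) : (batches n b).card = n.choose b := by simp [batches]

namespace UniformBatch

variable {m m0 : MeasurableSpace Ω} {μ : Measure Ω} {A : Ω → Finset (Fin n)}

theorem choose_ne_zero (h : UniformBatch m μ A b) : ((n.choose b : ℕ) : ℝ≥0∞) ≠ 0 := by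
  simpa using (Nat.choose_pos h.size_le).ne'

theorem ae_mem_batches [IsFiniteMeasure μ] (h : UniformBatch m μ A b) :
    ∀ᵐ ω ∂μ, A ω ∈ batches n b := by
  have hms : MeasurableSet {ω | A ω ∈ batches n b} := by
    have : {ω | A ω ∈ batches n b} = ⋃ S ∈ batches n b, {ω | A ω = S} := by ext ω; simp
    rw [this]
    exact Finset.measurableSet_biUnion _ fun S _ => h.measurable S
  have h1 : μ {ω | A ω ∈ batches n b} = μ Set.univ := by
    have e : {ω | A ω ∈ batches n b} = ⋃ S ∈ batches n b, {ω | A ω = S} := by ext ω; simp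
    rw [e, measure_biUnion_finset]
    · have : ∀ S ∈ batches n b, μ {ω | A ω = S} = μ Set.univ / ((n.choose b : ℕ) : ℝ≥0∞) := by
        intro S hS
        have := h.unif S (Finset.mem_powersetCard.1 hS).2 Set.univ MeasurableSet.univ
        rwa [Set.inter_univ] at this
      rw [Finset.sum_congr rfl this, Finset.sum_const, card_batches, nsmul_eq_mul]
      exact ENNReal.mul_div_cancel h.choose_ne_zero (ENNReal.natCast_ne_top _)
    · intro S _ S' _ hne
      refine Set.disjoint_left.2 fun ω h1 h2 => hne ?_
      exact h1.symm.trans h2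
    · exact fun S _ => h.measurable S
  rw [ae_iff]
  have h2 := measure_compl hms (measure_ne_top μ _)
  rw [h1, tsub_self] at h2
  exact h2

/-- Uniformity and independence in the form used for integrals: on the σ-algebra `m`, restriction to
one value of the batch is multiplication by a constant. -/
theorem trim_restrict (h : UniformBatch m μ A b) {S : Finset (Fin n)} (hS : S ∈ batches n b) :
    (μ.restrict {ω | A ω = S}).trim h.le =
      ((n.choose b : ℕ) : ℝ≥0∞)⁻¹ • μ.trim h.le := by
  refine @Measure.ext _ m _ _ fun E hE => ?_
  rw [trim_measurableSet_eq h.le hE, Measure.restrict_apply (h.le _ hE), Set.inter_comm,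
    h.unif S (Finset.mem_powersetCard.1 hS).2 E hE, Measure.smul_apply, trim_measurableSet_eq h.le hE,
    smul_eq_mul, ENNReal.div_eq_inv_mul]

theorem apply_eq_sum_indicator {E : Type*} [AddCommMonoid E] (f : Finset (Fin n) → Ω → E) {ω : Ω}
    (hω : A ω ∈ batches n b) :
    f (A ω) ω = ∑ S ∈ batches n b, Set.indicator {ω | A ω = S} (f S) ω := by
  rw [Finset.sum_eq_single (A ω)]
  · exact (Set.indicator_of_mem (s := {ω' | A ω' = A ω}) rfl _).symm
  · intro S _ hS
    exact Set.indicator_of_notMem (fun h' => hS h'.symm) _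
  · exact fun h' => absurd hω h'

theorem lintegral_apply [IsFiniteMeasure μ] (h : UniformBatch m μ A b)
    {f : Finset (Fin n) → Ω → ℝ≥0∞} (hf : ∀ S, Measurable[m] (f S)) :
    ∫⁻ ω, f (A ω) ω ∂μ =
      ∫⁻ ω, ((n.choose b : ℕ) : ℝ≥0∞)⁻¹ * ∑ S ∈ batches n b, f S ω ∂μ := by
  have hf0 : ∀ S, Measurable (f S) := fun S => (hf S).mono h.le le_rfl
  have h1 : ∫⁻ ω, f (A ω) ω ∂μ =
      ∫⁻ ω, ∑ S ∈ batches n b, Set.indicator {ω | A ω = S} (f S) ω ∂μ :=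
    lintegral_congr_ae (h.ae_mem_batches.mono fun ω hω => apply_eq_sum_indicator f hω)
  rw [h1, lintegral_finsetSum _ fun S _ => (hf0 S).indicator (h.measurable S),
    lintegral_const_mul _ (Finset.measurable_sum _ fun S _ => hf0 S),
    lintegral_finsetSum _ fun S _ => hf0 S, Finset.mul_sum]
  refine Finset.sum_congr rfl fun S hS => ?_
  rw [lintegral_indicator (h.measurable S), ← lintegral_trim h.le (hf S), h.trim_restrict hS,
    lintegral_smul_measure, lintegral_trim h.le (hf S), smul_eq_mul]

/-- The finite norm integral is a positive multiple of the sum over all batches, so each of its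
terms is finite. -/
theorem integrable_of_apply [IsFiniteMeasure μ] (h : UniformBatch m μ A b)
    {f : Finset (Fin n) → Ω → ℝ} (hf : ∀ S, Measurable[m] (f S))
    (hint : Integrable (fun ω => f (A ω) ω) μ) {S : Finset (Fin n)} (hS : S ∈ batches n b) :
    Integrable (f S) μ := by
  refine ⟨((hf S).mono h.le le_rfl).aestronglyMeasurable, ?_⟩
  have h1 := hint.2
  rw [hasFiniteIntegral_iff_enorm] at h1 ⊢
  rw [h.lintegral_apply (f := fun S ω => ‖f S ω‖ₑ)
    (fun S => measurable_enorm.comp (hf S))] at h1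
  have hm : Measurable fun ω => ∑ S ∈ batches n b, ‖f S ω‖ₑ :=
    Finset.measurable_sum _ fun S _ => ((hf S).mono h.le le_rfl).enorm
  rw [lintegral_const_mul _ hm] at h1
  have h2 : ∫⁻ ω, ∑ S ∈ batches n b, ‖f S ω‖ₑ ∂μ < ∞ := by
    by_contra h3
    rw [not_lt, top_le_iff] at h3
    rw [h3, ENNReal.mul_top (by simp)] at h1
    exact lt_irrefl _ h1
  refine lt_of_le_of_lt (lintegral_mono fun ω => ?_) h2
  exact Finset.single_le_sum (f := fun S => ‖f S ω‖ₑ) (fun _ _ => zero_le) hS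

theorem integral_apply [IsFiniteMeasure μ] (h : UniformBatch m μ A b)
    {f : Finset (Fin n) → Ω → ℝ} (hf : ∀ S, Measurable[m] (f S))
    (hint : Integrable (fun ω => f (A ω) ω) μ) :
    ∫ ω, f (A ω) ω ∂μ = ∫ ω, ((n.choose b : ℕ) : ℝ)⁻¹ * ∑ S ∈ batches n b, f S ω ∂μ := by
  have hi : ∀ S ∈ batches n b, Integrable (f S) μ := fun S hS => h.integrable_of_apply hf hint hS
  have h1 : ∫ ω, f (A ω) ω ∂μ =
      ∫ ω, ∑ S ∈ batches n b, Set.indicator {ω | A ω = S} (f S) ω ∂μ :=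
    integral_congr_ae (h.ae_mem_batches.mono fun ω hω => apply_eq_sum_indicator f hω)
  rw [h1, integral_finsetSum _ fun S hS => (hi S hS).indicator (h.measurable S),
    integral_const_mul, integral_finsetSum _ hi, Finset.mul_sum]
  refine Finset.sum_congr rfl fun S hS => ?_
  have hsm : StronglyMeasurable[m] (f S) := (hf S).stronglyMeasurable
  rw [integral_indicator (h.measurable S), integral_trim h.le hsm, h.trim_restrict hS,
    integral_smul_measure, ← integral_trim h.le hsm, smul_eq_mul, ENNReal.toReal_inv,
    ENNReal.toReal_natCast]

/-- Conditioning on an event of the σ-algebra `m` preserves uniformity. -/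
theorem cond (h : UniformBatch m μ A b) {G : Set Ω} (hG : MeasurableSet[m] G) :
    UniformBatch m μ[|G] A b where
  le := h.le
  size_le := h.size_le
  measurable := h.measurable
  unif S hS E hE := by
    rw [cond_apply (h.le _ hG), cond_apply (h.le _ hG)]
    have : G ∩ ({ω | A ω = S} ∩ E) = {ω | A ω = S} ∩ (G ∩ E) := by
      rw [← Set.inter_assoc, Set.inter_comm G, Set.inter_assoc]
    rw [this, h.unif S hS _ (hG.inter hE), mul_div_assoc]

end UniformBatch

end Averaging

/-! ### Adaptedness of the trajectories and unbiasedness of the batch gradients -/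

section Adapted

variable {d n : ℕ} {Ω : Type*}

theorem measurable_gradient (f : Param d → ℝ) : Measurable (gradient f) :=
  (InnerProductSpace.toDual ℝ (Param d)).symm.continuous.measurable.comp (measurable_fderiv ℝ f)

theorem measurable_batchGrad (ℓ : Fin n → Param d → ℝ) (b : ℕ) (S : Finset (Fin n)) :
    Measurable (batchGrad ℓ b S) :=
  (Finset.measurable_sum S fun i _ => measurable_gradient (ℓ i)).fun_const_smul ((b : ℝ)⁻¹)

theorem measurable_gradNoise (ℓ : Fin n → Param d → ℝ) (b : ℕ) (S : Finset (Fin n)) :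
    Measurable (gradNoise ℓ b S) :=
  (measurable_batchGrad ℓ b S).sub (measurable_gradient _)

variable {θ₀ : Ω → Param d} {B : ℕ → Ω → Finset (Fin n)}

theorem past_mono {s t : ℕ} (hst : s ≤ t) : past θ₀ B s ≤ past θ₀ B t :=
  sup_le_sup_left (iSup_le fun i : Fin s =>
    le_iSup (fun j : Fin t => MeasurableSpace.comap (B j) ⊤) ⟨i, i.2.trans_le hst⟩) _

theorem measurableSet_past_batch {s t : ℕ} (hst : s < t) (S : Finset (Fin n)) :
    MeasurableSet[past θ₀ B t] {ω | B s ω = S} := by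
  have h1 : MeasurableSpace.comap (B s) ⊤ ≤ past θ₀ B t :=
    le_sup_of_le_right (le_iSup (fun j : Fin t => MeasurableSpace.comap (B j) ⊤) ⟨s, hst⟩)
  exact h1 _ ⟨{S}, trivial, rfl⟩

theorem measurable_past_init (t : ℕ) : Measurable[past θ₀ B t] θ₀ :=
  fun _ hU => le_sup_left (a := MeasurableSpace.comap θ₀ inferInstance) _ ⟨_, hU, rfl⟩

theorem measurable_past_iter (p : Problem d n) (t : ℕ) :
    Measurable[past θ₀ B t] (iter p θ₀ B t) := by
  induction t with
  | zero => exact measurable_past_init 0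
  | succ t ih =>
    have h1 : Measurable[past θ₀ B (t + 1)] (iter p θ₀ B t) := ih.mono (past_mono t.le_succ) le_rfl
    have h2 : Measurable[past θ₀ B (t + 1)]
        fun ω => batchGrad p.ℓ p.b (B t ω) (iter p θ₀ B t ω) :=
      @measurable_finset_apply _ _ (past θ₀ B (t + 1)) _ _ (B t)
        (fun S => measurableSet_past_batch t.lt_succ_self S)
        (fun S ω => batchGrad p.ℓ p.b S (iter p θ₀ B t ω))
        (fun S => (measurable_batchGrad p.ℓ p.b S).comp h1)
    exact h1.sub (h2.fun_const_smul p.η)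

theorem measurable_past_disp (p : Problem d n) (t : ℕ) :
    Measurable[past θ₀ B t] (disp p θ₀ B t) :=
  (measurable_past_iter p t).sub_const (p.ref t)

theorem measurable_past_xi (p : Problem d n) {s t : ℕ} (hst : s < t) :
    Measurable[past θ₀ B t] (xi p θ₀ B s) :=
  @measurable_finset_apply _ _ (past θ₀ B t) _ _ (B s)
    (fun S => measurableSet_past_batch hst S)
    (fun S ω => gradNoise p.ℓ p.b S (iter p θ₀ B s ω))
    (fun S => (measurable_gradNoise p.ℓ p.b S).comp
      ((measurable_past_iter p s).mono (past_mono hst.le) le_rfl))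

theorem continuous_perp (u : Param d) : Continuous (perp u) := by
  unfold perp; fun_prop

theorem Problem.continuous_step (p : Problem d n) : Continuous p.step := by
  have := continuous_perp (p.u 0)
  unfold Problem.step noiselessStep
  fun_prop

theorem measurable_past_dispHat {c : Constants} {p : Problem d n} (hf : Frozen c p) {t : ℕ}
    (ht : t ≤ p.T) : Measurable[past θ₀ B t] (dispHat p θ₀ B t) := by
  induction t with
  | zero => exact measurable_past_disp p 0
  | succ t ih =>
    have h1 : Measurable[past θ₀ B (t + 1)] (dispHat p θ₀ B t) :=
      (ih (Nat.le_of_succ_le ht)).mono (past_mono t.le_succ) le_rfl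
    have h2 : dispHat p θ₀ B (t + 1) =
        fun ω => p.step (dispHat p θ₀ B t ω) - p.η • xi p θ₀ B t ω :=
      funext fun ω => hf.dispHat_succ θ₀ B ht ω
    rw [h2]
    exact (p.continuous_step.measurable.comp h1).sub
      ((measurable_past_xi p t.lt_succ_self).fun_const_smul p.η)

theorem measurableSet_norm_le {m : MeasurableSpace Ω} {f : Ω → Param d} (hf : Measurable f) (C : ℝ) :
    MeasurableSet {ω | ‖f ω‖ ≤ C} :=
  measurableSet_le hf.norm measurable_const

/-- The predicted displacement has stayed in the ball of radius `K δ` up to time `t`. -/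
def predictedBounded (p : Problem d n) (θ₀ : Ω → Param d) (B : ℕ → Ω → Finset (Fin n)) (K : ℝ)
    (t : ℕ) : Set Ω :=
  {ω | ∀ s ≤ t, ‖dispHat p θ₀ B s ω‖ ≤ K * p.δ}

theorem measurableSet_past_predictedBounded {c : Constants} {p : Problem d n} (hf : Frozen c p)
    (K : ℝ) {t : ℕ} (ht : t ≤ p.T) :
    MeasurableSet[past θ₀ B t] (predictedBounded p θ₀ B K t) := by
  have : predictedBounded p θ₀ B K t =
      ⋂ s ∈ Finset.range (t + 1), {ω | ‖dispHat p θ₀ B s ω‖ ≤ K * p.δ} := by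
    ext ω; simp [predictedBounded]
  rw [this]
  refine @Finset.measurableSet_biInter _ _ (past θ₀ B t) _ _ fun s hs => ?_
  have hst : s ≤ t := Nat.lt_succ_iff.1 (Finset.mem_range.1 hs)
  exact measurableSet_norm_le
    ((measurable_past_dispHat hf (hst.trans ht)).mono (past_mono hst) le_rfl) _

theorem measurableSet_past_good {c : Constants} {p : Problem d n} (hf : Frozen c p)
    (K : ℝ) {t : ℕ} (ht : t ≤ p.T) : MeasurableSet[past θ₀ B t] (good p θ₀ B K t) := by
  have : good p θ₀ B K t =
      ⋂ s ∈ Finset.range (t + 1), ({ω | ‖disp p θ₀ B s ω‖ ≤ K * p.δ} ∩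
        ({ω | ‖dispHat p θ₀ B s ω‖ ≤ K * p.δ} ∩
          {ω | ‖disp p θ₀ B s ω - dispHat p θ₀ B s ω‖ ≤ K * (p.ε * p.δ)})) := by
    ext ω; simp [good]
  rw [this]
  refine @Finset.measurableSet_biInter _ _ (past θ₀ B t) _ _ fun s hs => ?_
  have hst : s ≤ t := Nat.lt_succ_iff.1 (Finset.mem_range.1 hs)
  have h1 : Measurable[past θ₀ B t] (disp p θ₀ B s) :=
    (measurable_past_disp p s).mono (past_mono hst) le_rfl
  have h2 : Measurable[past θ₀ B t] (dispHat p θ₀ B s) :=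
    (measurable_past_dispHat hf (hst.trans ht)).mono (past_mono hst) le_rfl
  exact (measurableSet_norm_le h1 _).inter ((measurableSet_norm_le h2 _).inter
    (measurableSet_norm_le (h1.sub h2) _))

theorem Sampling.past_le [MeasurableSpace Ω] {c : Constants} {p : Problem d n} {P : Measure Ω}
    (h : Sampling c p P θ₀ B) (t : ℕ) : past θ₀ B t ≤ ‹MeasurableSpace Ω› := by
  refine sup_le h.measurable_init.comap_le (iSup_le fun s => ?_)
  rintro _ ⟨U, -, rfl⟩
  have : B s ⁻¹' U = ⋃ S ∈ U, {ω | B s ω = S} := by ext ω; simp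
  rw [this]
  exact MeasurableSet.biUnion (Set.to_countable _) fun S _ => h.measurable_batch s S

theorem Sampling.uniformBatch [MeasurableSpace Ω] {c : Constants} {p : Problem d n} {P : Measure Ω}
    (h : Sampling c p P θ₀ B) (hl : Landscape c p) (t : ℕ) :
    UniformBatch (past θ₀ B t) P (B t) p.b where
  le := h.past_le t
  size_le := hl.b_le_n
  measurable := h.measurable_batch t
  unif := h.uniform_indep t

/-- Uniformly drawn batches of size `b` give unbiased gradients. -/
theorem sum_gradNoise {ℓ : Fin n → Param d → ℝ} (hℓ : ∀ i, Differentiable ℝ (ℓ i)) {b : ℕ}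
    (hb : 1 ≤ b) (hbn : b ≤ n) (θ : Param d) : ∑ S ∈ batches n b, gradNoise ℓ b S θ = 0 := by
  have hgrad : gradient (loss ℓ) θ = (n : ℝ)⁻¹ • ∑ i, gradient (ℓ i) θ := by
    refine HasGradientAt.gradient ?_
    rw [hasGradientAt_iff_hasFDerivAt, map_smul, map_sum]
    have h1 : HasFDerivAt (fun x => ∑ i, ℓ i x)
        (∑ i, InnerProductSpace.toDual ℝ (Param d) (gradient (ℓ i) θ)) θ :=
      HasFDerivAt.fun_sum fun i _ => ((hℓ i θ).hasGradientAt).hasFDerivAt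
    exact h1.const_mul _
  -- Double counting: each index lies in `choose (n - 1) (b - 1)` of the batches.
  have hdouble : ∑ S ∈ batches n b, ∑ i ∈ S, gradient (ℓ i) θ =
      ((n - 1).choose (b - 1) : ℝ) • ∑ i, gradient (ℓ i) θ := by
    have h1 : ∑ S ∈ batches n b, ∑ i ∈ S, gradient (ℓ i) θ =
        ∑ i, ∑ S ∈ (batches n b).filter (i ∈ ·), gradient (ℓ i) θ := by
      refine Finset.sum_comm' ?_
      intro S i; simp [and_comm]
    rw [h1, Finset.smul_sum]
    refine Finset.sum_congr rfl fun i _ => ?_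
    rw [Finset.sum_const, ← Nat.cast_smul_eq_nsmul ℝ]
    congr 2
    have h2 : (batches n b).filter (i ∈ ·) =
        ((Finset.univ.erase i).powersetCard (b - 1)).image (insert i) := by
      ext S
      simp only [Finset.mem_filter, Finset.mem_powersetCard, Finset.mem_image]
      constructor
      · rintro ⟨⟨-, hc⟩, hi⟩
        refine ⟨S.erase i, ⟨Finset.erase_subset_erase _ (Finset.subset_univ _), ?_⟩,
          Finset.insert_erase hi⟩
        rw [Finset.card_erase_of_mem hi, hc]
      · rintro ⟨S', ⟨hs, hc⟩, rfl⟩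
        have hi : i ∉ S' := fun h => Finset.notMem_erase i _ (hs h)
        refine ⟨⟨Finset.subset_univ _, ?_⟩, Finset.mem_insert_self _ _⟩
        rw [Finset.card_insert_of_notMem hi, hc]; omega
    rw [h2, Finset.card_image_of_injOn, Finset.card_powersetCard,
      Finset.card_erase_of_mem (Finset.mem_univ _), Finset.card_univ, Fintype.card_fin]
    intro S hS S' hS' hSS
    have hn : ∀ S ∈ ((Finset.univ.erase i).powersetCard (b - 1) : Finset (Finset (Fin n))),
        i ∉ S := fun S hS h => Finset.notMem_erase i _ ((Finset.mem_powersetCard.1 hS).1 h)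
    have := congrArg (Finset.erase · i) hSS
    simpa [Finset.erase_insert (hn S hS), Finset.erase_insert (hn S' hS')] using this
  simp only [gradNoise, batchGrad, Finset.sum_sub_distrib, ← Finset.smul_sum, hdouble, hgrad,
    Finset.sum_const, card_batches]
  rw [← Nat.cast_smul_eq_nsmul ℝ, smul_smul, smul_smul, ← sub_smul]
  have hn : 1 ≤ n := hb.trans hbn
  have hnat : n * (n - 1).choose (b - 1) = n.choose b * b := by
    obtain ⟨n, rfl⟩ := Nat.exists_eq_add_of_le' hn
    obtain ⟨b, rfl⟩ := Nat.exists_eq_add_of_le' hb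
    exact Nat.add_one_mul_choose_eq n b
  have hreal : (n : ℝ) * ((n - 1).choose (b - 1) : ℕ) = (n.choose b : ℕ) * (b : ℝ) := by
    exact_mod_cast hnat
  have hb0 : (b : ℝ) ≠ 0 := by positivity
  have hn0 : (n : ℝ) ≠ 0 := by positivity
  have : (b : ℝ)⁻¹ * ((n - 1).choose (b - 1) : ℕ) - (n : ℝ)⁻¹ * (n.choose b : ℕ) = 0 := by
    field_simp
    linarith
  rw [this, zero_smul]

end Adapted

/-! ### Confinement of the predicted dynamics and the probability of the coupling event -/

section Stability

variable {d n : ℕ}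

/-- Transfers an inequality between real averages to `ℝ≥0∞`, where the Lyapunov estimate needs no
integrability. -/
theorem ofReal_average_le {ι : Type*} (s : Finset ι) {N : ℕ} (hN : 0 < N) {f q : ι → ℝ}
    {a x e b : ℝ} (hf : ∀ i, 0 ≤ f i) (hq : ∀ i, 0 ≤ q i) (ha : 0 ≤ a) (hx : 0 ≤ x) (he : 0 ≤ e)
    (hb : 0 ≤ b) (h : (N : ℝ)⁻¹ * ∑ i ∈ s, f i ≤ a * x + e + b * ((N : ℝ)⁻¹ * ∑ i ∈ s, q i)) :
    (N : ℝ≥0∞)⁻¹ * ∑ i ∈ s, ENNReal.ofReal (f i) ≤ ENNReal.ofReal a * ENNReal.ofReal x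
      + ENNReal.ofReal e + ENNReal.ofReal b * ((N : ℝ≥0∞)⁻¹ * ∑ i ∈ s, ENNReal.ofReal (q i)) := by
  have hN' : (0 : ℝ) < N := by exact_mod_cast hN
  have hcast : (N : ℝ≥0∞)⁻¹ = ENNReal.ofReal (N : ℝ)⁻¹ := by
    rw [ENNReal.ofReal_inv_of_pos hN', ENNReal.ofReal_natCast]
  have hsq : 0 ≤ ∑ i ∈ s, q i := Finset.sum_nonneg fun i _ => hq i
  have h1 : 0 ≤ (N : ℝ)⁻¹ := by positivity
  have h2 : 0 ≤ a * x := by positivity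
  have h3 : 0 ≤ a * x + e := by positivity
  have h4 : 0 ≤ b * ((N : ℝ)⁻¹ * ∑ i ∈ s, q i) := by positivity
  rw [hcast, ← ENNReal.ofReal_sum_of_nonneg fun i _ => hf i,
    ← ENNReal.ofReal_sum_of_nonneg fun i _ => hq i, ← ENNReal.ofReal_mul h1,
    ← ENNReal.ofReal_mul h1, ← ENNReal.ofReal_mul ha, ← ENNReal.ofReal_mul hb,
    ← ENNReal.ofReal_add h2 he, ← ENNReal.ofReal_add h3 h4]
  exact ENNReal.ofReal_le_ofReal h

open StepScales in
/-- Averaging the Lyapunov function over mean-zero noise. -/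
theorem average_lyapunov_sub_le {ι : Type*} (s : Finset ι) (u m : Param d) (η : ℝ) (ξ : ι → Param d) (hξ : ∑ i ∈ s, ξ i = 0) :
    ∑ i ∈ s, lyapunov u (m - η • ξ i) ≤ s.card * lyapunov u m + η ^ 2 * ∑ i ∈ s, ‖ξ i‖ ^ 2 := by
  have h1 : ∀ i, lyapunov u (m - η • ξ i) = lyapunov u m
      - (2 * η * ⟪m, ξ i⟫_ℝ - η * ⟪u, m⟫_ℝ * ⟪u, ξ i⟫_ℝ) + η ^ 2 * lyapunov u (ξ i) := by
    intro i
    simp only [lyapunov]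
    rw [norm_sub_sq_real, inner_sub_right, real_inner_smul_right, real_inner_smul_right, norm_smul,
      Real.norm_eq_abs, mul_pow, sq_abs]
    ring
  have h2 : ∑ i ∈ s, (2 * η * ⟪m, ξ i⟫_ℝ - η * ⟪u, m⟫_ℝ * ⟪u, ξ i⟫_ℝ) = 0 := by
    rw [Finset.sum_sub_distrib, ← Finset.mul_sum, ← Finset.mul_sum, ← inner_sum, ← inner_sum, hξ]
    simp
  simp only [h1]
  rw [Finset.sum_add_distrib, Finset.sum_sub_distrib, h2, Finset.sum_const, nsmul_eq_mul, sub_zero,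
    ← Finset.mul_sum]
  gcongr with i
  exact lyapunov_le _ _

variable {Ω : Type*} {c : Constants} {p : Problem d n} {θ₀ : Ω → Param d}
  {B : ℕ → Ω → Finset (Fin n)}

open Classical in
/-- Lyapunov function of the predicted dynamics, frozen at the level `(K δ)² / 2` after the exit
from the ball of radius `K δ`. -/
noncomputable def stoppedLyapunov (p : Problem d n) (θ₀ : Ω → Param d) (B : ℕ → Ω → Finset (Fin n))
    (K : ℝ) (t : ℕ) (ω : Ω) : ℝ :=
  if ω ∈ predictedBounded p θ₀ B K t then StepScales.lyapunov (p.u 0) (dispHat p θ₀ B t ω)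
  else (K * p.δ) ^ 2 / 2

theorem predictedBounded_succ (K : ℝ) (t : ℕ) (ω : Ω) :
    ω ∈ predictedBounded p θ₀ B K (t + 1) ↔
      ω ∈ predictedBounded p θ₀ B K t ∧ ‖dispHat p θ₀ B (t + 1) ω‖ ≤ K * p.δ := by
  constructor
  · exact fun h => ⟨fun s hs => h s (hs.trans t.le_succ), h _ le_rfl⟩
  · rintro ⟨h1, h2⟩ s hs
    rcases Nat.le_succ_iff.1 hs with h | rfl
    · exact h1 s h
    · exact h2

/-- At the exit from the ball the Lyapunov function is at least the frozen level, so stopping can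
only lower the process. -/
theorem half_sq_le_lyapunov_of_lt {u v : Param d} (hu : ‖u‖ = 1) {r : ℝ} (hr : 0 ≤ r)
    (h : r < ‖v‖) : r ^ 2 / 2 ≤ StepScales.lyapunov u v := by
  refine le_trans ?_ (StepScales.half_norm_sq_le_lyapunov hu v)
  gcongr

theorem stoppedLyapunov_nonneg (hl : Landscape c p) (K : ℝ) (t : ℕ) (ω : Ω) :
    0 ≤ stoppedLyapunov p θ₀ B K t ω := by
  rw [stoppedLyapunov]
  split_ifs
  · exact StepScales.lyapunov_nonneg hl.unit _
  · positivity

variable [MeasurableSpace Ω] {P : Measure Ω}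

-- Before the exit, averaging over the batch cancels the terms linear in the noise, so only `η²
-- E‖ξ‖² = O(ε δ²)` is added. After the exit the process is constant. The event of no exit so far
-- belongs to the past, which makes the averaging legitimate.
set_option maxHeartbeats 800000 in
open Classical in
theorem lintegral_stoppedLyapunov_succ_le [IsProbabilityMeasure P] (hl : Landscape c p)
    (hf : Frozen c p) (hs : Sampling c p P θ₀ B) {K A : ℝ} (hK : 0 ≤ K) (hA : 0 ≤ A)
    (hstep : ∀ v, ‖v‖ ≤ K * p.δ → StepScales.lyapunov (p.u 0) (p.step v) ≤
      (1 + A * p.ε) * StepScales.lyapunov (p.u 0) v + 2 * p.ε * p.δ ^ 2)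
    {t : ℕ} (ht : t < p.T) :
    ∫⁻ ω, ENNReal.ofReal (stoppedLyapunov p θ₀ B K (t + 1) ω) ∂P ≤
      ENNReal.ofReal (1 + A * p.ε) * ∫⁻ ω, ENNReal.ofReal (stoppedLyapunov p θ₀ B K t ω) ∂P
        + ENNReal.ofReal ((2 + |c.Cξ|) * (p.ε * p.δ ^ 2)) := by
  have he := hl.eps_pos hf
  have hη := hl.η_pos
  have hδ := hf.delta_pos
  have hu := hl.unit
  have hU := hs.uniformBatch hl t
  have hN : (0 : ℝ) < (n.choose p.b : ℕ) := by exact_mod_cast Nat.choose_pos hl.b_le_n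
  set N := ((n.choose p.b : ℕ) : ℝ) with hNdef
  set F := predictedBounded p θ₀ B K t with hF
  set m : Ω → Param d := fun ω => p.step (dispHat p θ₀ B t ω) with hm
  set ξ : Finset (Fin n) → Ω → Param d := fun S ω => gradNoise p.ℓ p.b S (iter p θ₀ B t ω) with hξ
  set M : ℝ := (K * p.δ) ^ 2 / 2 with hM
  set f : Finset (Fin n) → Ω → ℝ := fun S ω =>
    if ω ∈ F then StepScales.lyapunov (p.u 0) (m ω - p.η • ξ S ω) else M with hfdef
  have hFm : MeasurableSet[past θ₀ B t] F := measurableSet_past_predictedBounded hf K ht.le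
  have hξm : ∀ S, Measurable[past θ₀ B t] (ξ S) := fun S =>
    (measurable_gradNoise p.ℓ p.b S).comp (measurable_past_iter p t)
  have hmm : Measurable[past θ₀ B t] m :=
    p.continuous_step.measurable.comp (measurable_past_dispHat hf ht.le)
  have hlm : Measurable (StepScales.lyapunov (p.u 0)) := by
    have : Continuous (StepScales.lyapunov (p.u 0)) := by unfold StepScales.lyapunov; fun_prop
    exact this.measurable
  have hfm : ∀ S, Measurable[past θ₀ B t] (f S) := fun S =>
    Measurable.ite hFm (hlm.comp (hmm.sub ((hξm S).fun_const_smul p.η))) measurable_const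
  have hstopm : Measurable (stoppedLyapunov p θ₀ B K t) :=
    Measurable.ite (hU.le _ hFm)
      (hlm.comp ((measurable_past_dispHat hf ht.le).mono hU.le le_rfl)) measurable_const
  -- one step of the stopped process
  have h1 : ∀ ω, stoppedLyapunov p θ₀ B K (t + 1) ω ≤ f (B t ω) ω := by
    intro ω
    have hsucc : dispHat p θ₀ B (t + 1) ω = m ω - p.η • ξ (B t ω) ω := hf.dispHat_succ θ₀ B ht ω
    simp only [stoppedLyapunov, predictedBounded_succ, hfdef, ← hsucc]
    by_cases hω : ω ∈ F
    · by_cases h2 : ‖dispHat p θ₀ B (t + 1) ω‖ ≤ K * p.δ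
      · simp [hω, h2, ← hF]
      · rw [if_neg (fun h => h2 h.2), if_pos hω]
        exact half_sq_le_lyapunov_of_lt hu (by positivity) (not_le.1 h2)
    · rw [if_neg (fun h => hω h.1), if_neg hω]
  -- averaging over the batch
  have h2 : ∀ ω, ((n.choose p.b : ℕ) : ℝ≥0∞)⁻¹ * ∑ S ∈ batches n p.b, ENNReal.ofReal (f S ω) ≤
      ENNReal.ofReal (1 + A * p.ε) * ENNReal.ofReal (stoppedLyapunov p θ₀ B K t ω)
        + ENNReal.ofReal (2 * (p.ε * p.δ ^ 2)) +
        ENNReal.ofReal (p.η ^ 2) *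
          (((n.choose p.b : ℕ) : ℝ≥0∞)⁻¹ * ∑ S ∈ batches n p.b, ‖ξ S ω‖ₑ ^ 2) := by
    intro ω
    have hfnn : ∀ S, 0 ≤ f S ω := by
      intro S
      simp only [hfdef]
      split_ifs
      · exact StepScales.lyapunov_nonneg hu _
      · positivity
    have hnorm : ∀ S, ‖ξ S ω‖ₑ ^ 2 = ENNReal.ofReal (‖ξ S ω‖ ^ 2) := by
      intro S
      rw [← ofReal_norm, ENNReal.ofReal_pow (norm_nonneg _)]
    have hst0 := stoppedLyapunov_nonneg (θ₀ := θ₀) (B := B) hl K t ω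
    simp only [hnorm]
    refine ofReal_average_le (batches n p.b) (Nat.choose_pos hl.b_le_n) hfnn
      (fun S => sq_nonneg _) (by positivity) hst0 (by positivity) (by positivity) ?_
    rw [inv_mul_le_iff₀ hN]
    have hexp : N * ((1 + A * p.ε) * stoppedLyapunov p θ₀ B K t ω + 2 * (p.ε * p.δ ^ 2) +
        p.η ^ 2 * (N⁻¹ * ∑ S ∈ batches n p.b, ‖ξ S ω‖ ^ 2)) =
        N * ((1 + A * p.ε) * stoppedLyapunov p θ₀ B K t ω + 2 * (p.ε * p.δ ^ 2)) +
        p.η ^ 2 * ∑ S ∈ batches n p.b, ‖ξ S ω‖ ^ 2 := by field_simp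
    rw [hexp]
    by_cases hω : ω ∈ F
    · have h3 := average_lyapunov_sub_le (batches n p.b) (p.u 0) (m ω) p.η (fun S => ξ S ω)
        (sum_gradNoise hl.differentiable hl.one_le_b hl.b_le_n _)
      rw [card_batches, ← hNdef] at h3
      have h4 := hstep (dispHat p θ₀ B t ω) (hω t le_rfl)
      have h5 : stoppedLyapunov p θ₀ B K t ω =
          StepScales.lyapunov (p.u 0) (dispHat p θ₀ B t ω) := if_pos hω
      have h6 : ∀ S, f S ω = StepScales.lyapunov (p.u 0) (m ω - p.η • ξ S ω) := fun S => if_pos hω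
      simp only [h6]
      rw [h5]
      refine h3.trans ?_
      gcongr
      linarith
    · have h5 : stoppedLyapunov p θ₀ B K t ω = M := if_neg hω
      have h6 : ∀ S, f S ω = M := fun S => if_neg hω
      simp only [h6]
      rw [Finset.sum_const, card_batches, nsmul_eq_mul, ← hNdef, h5]
      have h7 : 0 ≤ p.η ^ 2 * ∑ S ∈ batches n p.b, ‖ξ S ω‖ ^ 2 :=
        mul_nonneg (sq_nonneg _) (Finset.sum_nonneg fun _ _ => sq_nonneg _)
      have h8 : M ≤ (1 + A * p.ε) * M + 2 * (p.ε * p.δ ^ 2) := by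
        have : 0 ≤ A * p.ε * M := by positivity
        have : 0 ≤ 2 * (p.ε * p.δ ^ 2) := by positivity
        linarith
      have := mul_le_mul_of_nonneg_left h8 hN.le
      linarith
  have hξ2 : ∀ S, Measurable[past θ₀ B t] fun ω => ‖ξ S ω‖ₑ ^ 2 := fun S =>
    (measurable_enorm.comp (hξm S)).pow_const 2
  have h3 : ENNReal.ofReal (p.η ^ 2) * ∫⁻ ω, ((n.choose p.b : ℕ) : ℝ≥0∞)⁻¹ *
      ∑ S ∈ batches n p.b, ‖ξ S ω‖ₑ ^ 2 ∂P ≤ ENNReal.ofReal (|c.Cξ| * (p.ε * p.δ ^ 2)) := by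
    rw [← hU.lintegral_apply hξ2]
    refine (mul_le_mul_right (hs.noise_le t ht) _).trans ?_
    rw [← ENNReal.ofReal_mul (by positivity)]
    refine ENNReal.ofReal_le_ofReal ?_
    have : p.η ^ 2 * (c.Cξ * (p.ε * p.δ ^ 2 / p.η ^ 2)) = c.Cξ * (p.ε * p.δ ^ 2) := by field_simp
    rw [this]
    gcongr
    exact le_abs_self _
  calc ∫⁻ ω, ENNReal.ofReal (stoppedLyapunov p θ₀ B K (t + 1) ω) ∂P
      ≤ ∫⁻ ω, ENNReal.ofReal (f (B t ω) ω) ∂P :=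
        lintegral_mono fun ω => ENNReal.ofReal_le_ofReal (h1 ω)
    _ = ∫⁻ ω, ((n.choose p.b : ℕ) : ℝ≥0∞)⁻¹ * ∑ S ∈ batches n p.b, ENNReal.ofReal (f S ω) ∂P :=
        hU.lintegral_apply (f := fun S ω => ENNReal.ofReal (f S ω))
          fun S => ENNReal.measurable_ofReal.comp (hfm S)
    _ ≤ _ := lintegral_mono h2
    _ = ENNReal.ofReal (1 + A * p.ε) * ∫⁻ ω, ENNReal.ofReal (stoppedLyapunov p θ₀ B K t ω) ∂P
        + ENNReal.ofReal (2 * (p.ε * p.δ ^ 2)) +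
        ENNReal.ofReal (p.η ^ 2) * ∫⁻ ω, ((n.choose p.b : ℕ) : ℝ≥0∞)⁻¹ *
          ∑ S ∈ batches n p.b, ‖ξ S ω‖ₑ ^ 2 ∂P := by
        have hm1 : Measurable fun ω => ENNReal.ofReal (stoppedLyapunov p θ₀ B K t ω) :=
          hstopm.ennreal_ofReal
        have hm2 : Measurable fun ω => ((n.choose p.b : ℕ) : ℝ≥0∞)⁻¹ *
            ∑ S ∈ batches n p.b, ‖ξ S ω‖ₑ ^ 2 :=
          (Finset.measurable_sum _ fun S _ => (hξ2 S).mono hU.le le_rfl).const_mul _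
        rw [lintegral_add_right _ (hm2.const_mul _), lintegral_add_right _ measurable_const,
          lintegral_const_mul _ hm1, lintegral_const_mul _ hm2, lintegral_const, measure_univ,
          mul_one]
    _ ≤ ENNReal.ofReal (1 + A * p.ε) * ∫⁻ ω, ENNReal.ofReal (stoppedLyapunov p θ₀ B K t ω) ∂P
        + ENNReal.ofReal (2 * (p.ε * p.δ ^ 2)) + ENNReal.ofReal (|c.Cξ| * (p.ε * p.δ ^ 2)) := by
        gcongr
    _ = _ := by
        rw [add_assoc, ← ENNReal.ofReal_add (by positivity) (by positivity)]
        congr 2; ring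

theorem lintegral_stoppedLyapunov_le [IsProbabilityMeasure P] (hl : Landscape c p)
    (hf : Frozen c p) (hs : Sampling c p P θ₀ B) {K A : ℝ} (hK : 0 ≤ K) (hA : 0 ≤ A)
    (hstep : ∀ v, ‖v‖ ≤ K * p.δ → StepScales.lyapunov (p.u 0) (p.step v) ≤
      (1 + A * p.ε) * StepScales.lyapunov (p.u 0) v + 2 * p.ε * p.δ ^ 2)
    {t : ℕ} (ht : t ≤ p.T) :
    ∫⁻ ω, ENNReal.ofReal (stoppedLyapunov p θ₀ B K t ω) ∂P ≤ ENNReal.ofReal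
      ((1 + A * p.ε) ^ t * (|c.c0| * p.δ ^ 2 + t * ((2 + |c.Cξ|) * (p.ε * p.δ ^ 2)))) := by
  have he := hl.eps_pos hf
  have hδ := hf.delta_pos
  induction t with
  | zero =>
    have h1 : ∀ᵐ ω ∂P, ENNReal.ofReal (stoppedLyapunov p θ₀ B K 0 ω) ≤
        ENNReal.ofReal (|c.c0| * p.δ ^ 2) := by
      filter_upwards [hs.init_le] with ω hω
      refine ENNReal.ofReal_le_ofReal ?_
      have h2 : ‖dispHat p θ₀ B 0 ω‖ ^ 2 ≤ |c.c0| * p.δ ^ 2 :=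
        hω.trans (by gcongr; exact le_abs_self _)
      rw [stoppedLyapunov]
      split_ifs with h
      · exact (StepScales.lyapunov_le _ _).trans h2
      -- If the start is already outside the ball, the frozen level is below the initial Lyapunov
      -- value, so no relation between `K` and `c0` is needed.
      · have h3 : K * p.δ < ‖dispHat p θ₀ B 0 ω‖ := by
          by_contra h4
          refine h fun s hs => ?_
          rw [Nat.le_zero.1 hs]
          exact not_lt.1 h4
        have h4 := half_sq_le_lyapunov_of_lt hl.unit (by positivity) h3
        exact h4.trans ((StepScales.lyapunov_le _ _).trans h2)
    refine (lintegral_mono_ae h1).trans (le_of_eq ?_)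
    simp
  | succ t ih =>
    refine (lintegral_stoppedLyapunov_succ_le hl hf hs hK hA hstep ht).trans ?_
    refine (add_le_add_left (mul_le_mul_right (ih (Nat.le_of_succ_le ht)) _) _).trans ?_
    rw [← ENNReal.ofReal_mul (by positivity), ← ENNReal.ofReal_add (by positivity) (by positivity)]
    refine ENNReal.ofReal_le_ofReal ?_
    have h5 : 1 ≤ (1 + A * p.ε) ^ (t + 1) := one_le_pow₀ (by nlinarith)
    have h6 : 0 ≤ (2 + |c.Cξ|) * (p.ε * p.δ ^ 2) := by positivity
    have h7 := mul_le_mul_of_nonneg_right h5 h6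
    push_cast
    rw [pow_succ (1 + A * p.ε) t] at h7 ⊢
    linarith

/-- With probability at least `1 - r` the predicted dynamics stay at distance `O(δ)`. -/
theorem exists_predictedBounded_prob (c : Constants) (hgap : c.cgap < 2) (hβ : 0 < c.cβ) {r : ℝ}
    (hr : 0 < r) : ∃ K ε₀ : ℝ, 0 ≤ K ∧ 0 < ε₀ ∧ ∀ (d n : ℕ) (p : Problem d n) (Ω : Type*)
      [MeasurableSpace Ω] (P : Measure Ω) [IsProbabilityMeasure P] (θ₀ : Ω → Param d)
      (B : ℕ → Ω → Finset (Fin n)), Landscape c p → Frozen c p → Sampling c p P θ₀ B →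
      p.ε ≤ ε₀ → ENNReal.ofReal (1 - r) ≤ P (predictedBounded p θ₀ B K p.T) := by
  set ν := 2 * |c.Cnw| with hν
  set k := |c.cκ| * (2 / c.cβ) with hk
  have hk0 : 0 ≤ k := by positivity
  set A := 2 * ν + ν ^ 2 + 2 with hA
  have hA0 : 0 ≤ A := by positivity
  set E := Real.exp (A * |c.cT|) * (|c.c0| + |c.cT| * (2 + |c.Cξ|)) + 1 with hE
  have hE0 : 0 < E := by positivity
  -- The mean of the stopped process is at most `E δ²` and its level after exit is `K² δ² / 2`;
  -- Markov's inequality gives probability `2E / K² = r`. There is no circularity, because `E` does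
  -- not involve `K`.
  set K := √(2 * E / r) with hK
  have hK0 : 0 < K := Real.sqrt_pos.2 (by positivity)
  have hK2 : K ^ 2 = 2 * E / r := Real.sq_sqrt (by positivity)
  obtain ⟨ε₀, ⟨⟨⟨hx1, hx2⟩, hx3⟩, hx4⟩, hx0⟩ := ((((eventually_mul_lt ν one_pos).and
    (eventually_mul_lt 1 one_pos)).and
    (eventually_mul_lt ((2 * K + k * K) ^ 2 + 2 * (k * K)) one_pos)).and
    (eventually_mul_lt ((1 + K ^ 2) ^ 2) one_pos)).and self_mem_nhdsWithin |>.exists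
  refine ⟨K, ε₀, hK0.le, hx0, ?_⟩
  intro d n p Ω _ P _ θ₀ B hl hf hs hε
  have he := hl.eps_pos hf
  have hδ := hf.delta_pos
  have hnw : 2 * |c.Cnw| * p.ε ≤ 1 := le_trans (by gcongr) hx1.le
  have hscales := hl.stepScales hf hgap hβ hnw
  have hstep : ∀ v, ‖v‖ ≤ K * p.δ → StepScales.lyapunov (p.u 0) (p.step v) ≤
      (1 + A * p.ε) * StepScales.lyapunov (p.u 0) v + 2 * p.ε * p.δ ^ 2 := by
    intro v hv
    refine hscales.lyapunov_step_le (by linarith) ?_ ?_ hv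
    · calc (2 * K + k * K) ^ 2 * p.ε + 2 * (k * K * p.ε)
          = ((2 * K + k * K) ^ 2 + 2 * (k * K)) * p.ε := by ring
        _ ≤ ((2 * K + k * K) ^ 2 + 2 * (k * K)) * ε₀ := by gcongr
        _ ≤ 1 := hx3.le
    · exact le_trans (by gcongr) hx4.le
  have hJ := lintegral_stoppedLyapunov_le hl hf hs hK0.le hA0 hstep le_rfl
  have hTε : p.T * p.ε ≤ |c.cT| := (hl.T_mul_eps_le hf).trans (le_abs_self _)
  have hbound : (1 + A * p.ε) ^ p.T *
      (|c.c0| * p.δ ^ 2 + p.T * ((2 + |c.Cξ|) * (p.ε * p.δ ^ 2))) ≤ E * p.δ ^ 2 := by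
    have h1 : (1 + A * p.ε) ^ p.T ≤ Real.exp (A * |c.cT|) := by
      calc (1 + A * p.ε) ^ p.T ≤ Real.exp (A * p.ε) ^ p.T := by
            gcongr; linarith [Real.add_one_le_exp (A * p.ε)]
        _ = Real.exp (A * (p.T * p.ε)) := by rw [← Real.exp_nat_mul]; ring_nf
        _ ≤ _ := by gcongr
    calc (1 + A * p.ε) ^ p.T *
          (|c.c0| * p.δ ^ 2 + p.T * ((2 + |c.Cξ|) * (p.ε * p.δ ^ 2)))
        = (1 + A * p.ε) ^ p.T * (|c.c0| + (p.T * p.ε) * (2 + |c.Cξ|)) * p.δ ^ 2 := by ring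
      _ ≤ Real.exp (A * |c.cT|) * (|c.c0| + |c.cT| * (2 + |c.Cξ|)) * p.δ ^ 2 := by gcongr
      _ ≤ E * p.δ ^ 2 := by gcongr; linarith
  set F := predictedBounded p θ₀ B K p.T with hF
  have hFm : MeasurableSet F := hs.past_le p.T _ (measurableSet_past_predictedBounded hf K le_rfl)
  set M : ℝ := (K * p.δ) ^ 2 / 2 with hM
  have hM0 : 0 < M := by positivity
  have hmarkov : ENNReal.ofReal M * P Fᶜ ≤ ENNReal.ofReal (E * p.δ ^ 2) := by
    calc ENNReal.ofReal M * P Fᶜ = ∫⁻ ω, Fᶜ.indicator (fun _ => ENNReal.ofReal M) ω ∂P := by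
          rw [lintegral_indicator hFm.compl, setLIntegral_const]
      _ ≤ ∫⁻ ω, ENNReal.ofReal (stoppedLyapunov p θ₀ B K p.T ω) ∂P := by
          refine lintegral_mono fun ω => ?_
          by_cases hω : ω ∈ F
          · rw [Set.indicator_of_notMem (by simpa using hω)]; exact zero_le
          · rw [Set.indicator_of_mem hω, stoppedLyapunov, if_neg hω]
      _ ≤ _ := hJ.trans (ENNReal.ofReal_le_ofReal hbound)
  have hEM : E * p.δ ^ 2 = M * r := by
    rw [hM, mul_pow, hK2]; field_simp
  rw [hEM, ENNReal.ofReal_mul hM0.le] at hmarkov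
  have hFc : P Fᶜ ≤ ENNReal.ofReal r := by
    rwa [ENNReal.mul_le_mul_iff_right (by simpa using hM0) ENNReal.ofReal_ne_top] at hmarkov
  have h1 : 1 - P Fᶜ = P F := by
    rw [← measure_univ (μ := P), ← measure_compl hFm.compl (measure_ne_top _ _), compl_compl]
  rw [← h1, ENNReal.ofReal_sub _ hr.le, ENNReal.ofReal_one]
  exact tsub_le_tsub_left hFc 1

theorem good_mono {Ω : Type*} {p : Problem d n} {θ₀ : Ω → Param d} {B : ℕ → Ω → Finset (Fin n)}
    {K K' : ℝ} (hδ : 0 ≤ p.δ) (hε : 0 ≤ p.ε) (hK : K ≤ K') {s t : ℕ} (hst : s ≤ t) :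
    good p θ₀ B K t ⊆ good p θ₀ B K' s := by
  intro ω hω i hi
  obtain ⟨h1, h2, h3⟩ := hω i (hi.trans hst)
  exact ⟨h1.trans (by gcongr), h2.trans (by gcongr), h3.trans (by gcongr)⟩

/-- High-probability coupling of SGD with the predicted dynamics. -/
theorem exists_good_prob (c : Constants) (hgap : c.cgap < 2) (hα : 0 < c.cα) (hβ : 0 < c.cβ)
    {r : ℝ} (hr : 0 < r) : ∃ K ε₀ : ℝ, 0 < K ∧ 0 < ε₀ ∧ ∀ (d n : ℕ) (p : Problem d n) (Ω : Type*)
      [MeasurableSpace Ω] (P : Measure Ω) [IsProbabilityMeasure P] (θ₀ : Ω → Param d)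
      (B : ℕ → Ω → Finset (Fin n)), Landscape c p → Frozen c p → Sampling c p P θ₀ B →
      p.ε ≤ ε₀ → ENNReal.ofReal (1 - r) ≤ P (good p θ₀ B K p.T) := by
  obtain ⟨K, ε₁, hK, hε₁, h1⟩ := exists_predictedBounded_prob c hgap hβ hr
  obtain ⟨K₁, ε₂, hK₁, hε₂, h2⟩ := exists_coupling_bound c hgap hα hβ hK
  -- This constant dominates the predicted radius `K`, the SGD radius `K + 1` and the coupling
  -- constant `K₁`.
  refine ⟨K + 1 + K₁, min ε₁ ε₂, by positivity, lt_min hε₁ hε₂, ?_⟩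
  intro d n p Ω _ P _ θ₀ B hl hf hs hε
  refine (h1 d n p Ω P θ₀ B hl hf hs (hε.trans (min_le_left _ _))).trans (measure_mono ?_)
  intro ω hω s hsT
  have he := hl.eps_pos hf
  have hδ := hf.delta_pos
  obtain ⟨h3, h4⟩ := h2 d n p Ω θ₀ B hl hf (hε.trans (min_le_right _ _)) ω hω s hsT
  refine ⟨h4.trans ?_, (hω s hsT).trans ?_, h3.trans ?_⟩ <;>
    exact mul_le_mul_of_nonneg_right (by linarith) (by positivity)

end Stability

/-! ### Stationary moments and the equilibrium sharpness -/

section Equilibrium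

variable {d n : ℕ} {Ω : Type*} {c : Constants} {p : Problem d n} {θ₀ : Ω → Param d}
  {B : ℕ → Ω → Finset (Fin n)} {t : ℕ}

section Noise

variable [MeasurableSpace Ω] {P Q : Measure Ω}

theorem Sampling.memLp_xi (hs : Sampling c p P θ₀ B) (ht : t < p.T) : MemLp (xi p θ₀ B t) 2 P := by
  refine ⟨((measurable_past_xi p t.lt_succ_self).mono (hs.past_le (t + 1))
    le_rfl).aestronglyMeasurable, ?_⟩
  rw [eLpNorm_lt_top_iff_lintegral_rpow_enorm_lt_top (by norm_num) (by norm_num)]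
  simpa using (hs.noise_le t ht).trans_lt ENNReal.ofReal_lt_top

theorem MemLp.cond {E : Type*} [NormedAddCommGroup E] {f : Ω → E} (hf : MemLp f 2 P) {G : Set Ω}
    (hG : P G ≠ 0) : MemLp f 2 P[|G] :=
  (hf.restrict G).smul_measure (ENNReal.inv_ne_top.2 hG)

/-- The gradient noise has mean zero given the past. -/
theorem integral_mul_inner_xi [IsFiniteMeasure Q] (hl : Landscape c p)
    (hU : UniformBatch (past θ₀ B t) Q (B t) p.b) (hξ : MemLp (xi p θ₀ B t) 2 Q) {φ : Ω → ℝ}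
    (hφ : Measurable[past θ₀ B t] φ) {C : ℝ} (hC : ∀ᵐ ω ∂Q, |φ ω| ≤ C) (z : Param d) :
    Integrable (fun ω => φ ω * ⟪z, xi p θ₀ B t ω⟫_ℝ) Q ∧
      ∫ ω, φ ω * ⟪z, xi p θ₀ B t ω⟫_ℝ ∂Q = 0 := by
  have h1 : Integrable (fun ω => φ ω * ⟪z, xi p θ₀ B t ω⟫_ℝ) Q :=
    ((hξ.const_inner (𝕜 := ℝ) z).integrable (by norm_num)).bdd_mul
      (hφ.mono hU.le le_rfl).aestronglyMeasurable hC
  refine ⟨h1, ?_⟩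
  have hm : ∀ S, Measurable[past θ₀ B t]
      fun ω => φ ω * ⟪z, gradNoise p.ℓ p.b S (iter p θ₀ B t ω)⟫_ℝ := fun S =>
    hφ.mul ((measurable_const.inner measurable_id : Measurable fun x : Param d => ⟪z, x⟫_ℝ).comp
      ((measurable_gradNoise p.ℓ p.b S).comp (measurable_past_iter p t)))
  have h2 := hU.integral_apply
    (f := fun S ω => φ ω * ⟪z, gradNoise p.ℓ p.b S (iter p θ₀ B t ω)⟫_ℝ) hm h1
  have h3 : ∀ ω, ∑ S ∈ batches n p.b, φ ω * ⟪z, gradNoise p.ℓ p.b S (iter p θ₀ B t ω)⟫_ℝ = 0 := by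
    intro ω
    rw [← Finset.mul_sum, ← inner_sum,
      sum_gradNoise hl.differentiable hl.one_le_b hl.b_le_n, inner_zero_right, mul_zero]
  refine h2.trans ?_
  simp only [h3, mul_zero, integral_zero]

/-- The second moment of the projected gradient noise is the mean noise variance. -/
theorem integral_inner_xi_sq [IsFiniteMeasure Q]
    (hU : UniformBatch (past θ₀ B t) Q (B t) p.b) (hξ : MemLp (xi p θ₀ B t) 2 Q) :
    Integrable (fun ω => ⟪p.u t, xi p θ₀ B t ω⟫_ℝ ^ 2) Q ∧
      ∫ ω, ⟪p.u t, xi p θ₀ B t ω⟫_ℝ ^ 2 ∂Q = sigmaSq p Q θ₀ B t := by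
  have h1 : Integrable (fun ω => ⟪p.u t, xi p θ₀ B t ω⟫_ℝ ^ 2) Q :=
    (hξ.const_inner (𝕜 := ℝ) (p.u t)).integrable_sq
  refine ⟨h1, ?_⟩
  have hm : ∀ S, Measurable[past θ₀ B t]
      fun ω => ⟪p.u t, gradNoise p.ℓ p.b S (iter p θ₀ B t ω)⟫_ℝ ^ 2 := fun S =>
    ((measurable_const.inner measurable_id : Measurable fun x : Param d => ⟪p.u t, x⟫_ℝ).comp
      ((measurable_gradNoise p.ℓ p.b S).comp (measurable_past_iter p t))).pow_const 2
  exact hU.integral_apply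
    (f := fun S ω => ⟪p.u t, gradNoise p.ℓ p.b S (iter p θ₀ B t ω)⟫_ℝ ^ 2) hm h1

end Noise

theorem xHat_succ (hf : Frozen c p) (hs : StepScales (hess p.L (p.ref 0)) (p.u 0) (p.gradSperp 0)
    p.η (p.kappa 0) p.ε p.δ (2 * |c.Cnw|) (|c.cκ| * (2 / c.cβ))) (ht : t < p.T) (ω : Ω) :
    xHat p θ₀ B (t + 1) ω = -((1 + p.η * yHat p θ₀ B t ω) * xHat p θ₀ B t ω
      + p.η / 2 * p.kappa 0 * xHat p θ₀ B t ω ^ 2) - p.η * ⟪p.u t, xi p θ₀ B t ω⟫_ℝ := by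
  rw [xHat, xHat, yHat, hf.dispHat_succ θ₀ B ht, hf.u_const _ ht, hf.u_const _ ht.le,
    hf.gradSperp_const _ ht.le, inner_sub_right, real_inner_smul_right, Problem.step,
    hs.inner_u_step]

theorem yHat_succ (hf : Frozen c p) (hs : StepScales (hess p.L (p.ref 0)) (p.u 0) (p.gradSperp 0)
    p.η (p.kappa 0) p.ε p.δ (2 * |c.Cnw|) (|c.cκ| * (2 / c.cβ))) (ht : t < p.T) (ω : Ω) :
    yHat p θ₀ B (t + 1) ω = yHat p θ₀ B t ω
      + p.η * ((p.δ ^ 2 - xHat p θ₀ B t ω ^ 2) / 2) * ‖p.gradSperp 0‖ ^ 2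
      - p.η * ⟪p.gradSperp 0, xi p θ₀ B t ω⟫_ℝ := by
  rw [xHat, yHat, yHat, hf.dispHat_succ θ₀ B ht, hf.u_const _ ht.le, hf.gradSperp_const _ ht,
    hf.gradSperp_const _ ht.le, inner_sub_right, real_inner_smul_right, Problem.step,
    hs.inner_g_step]

theorem measurable_past_xHat (hf : Frozen c p) (ht : t ≤ p.T) :
    Measurable[past θ₀ B t] (xHat p θ₀ B t) :=
  (measurable_const.inner measurable_id : Measurable fun x : Param d => ⟪p.u t, x⟫_ℝ).comp
    (measurable_past_dispHat hf ht)

theorem measurable_past_yHat (hf : Frozen c p) (ht : t ≤ p.T) :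
    Measurable[past θ₀ B t] (yHat p θ₀ B t) :=
  (measurable_const.inner measurable_id : Measurable fun x : Param d => ⟪p.gradSperp t, x⟫_ℝ).comp
    (measurable_past_dispHat hf ht)

theorem Edge.continuousOn_sharpness {L : Param d → ℝ} {θ u : Param d} {η R ρ a ν : ℝ}
    (h : Edge L θ u η R ρ a ν) : ContinuousOn (sharpness L) (Metric.ball θ R) := by
  have hρ := h.ρ_pos
  have hu : u ≠ 0 := (h.spectralGap le_rfl (by norm_num)).ne_zero
  refine (LipschitzOnWith.of_dist_le_mul (K := ρ.toNNReal) ?_).continuousOn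
  intro x hx y hy
  rw [Real.dist_eq, Real.coe_toNNReal _ hρ.le, dist_eq_norm]
  exact (abs_topEig_sub_le (h.hess_symm hx) (h.hess_symm hy) hu).trans (h.norm_hess_sub_le hy hx)

/-- On the coupling event the sharpness is `2 / η + ŷ` up to `O(ε² / η)`. -/
theorem abs_sharpness_sub_yHat_le (hl : Landscape c p) (hf : Frozen c p) (hgap : c.cgap < 2)
    (hβ : 0 < c.cβ) (hnw : 2 * |c.Cnw| * p.ε ≤ 1) {K : ℝ} (hK : 0 ≤ K)
    (hR : K * (2 / c.cβ) * p.ε < (2 - c.cgap) / 4) (hq : K * (2 / c.cβ) * p.ε ≤ 1 / 4)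
    (ht : t ≤ p.T) {ω : Ω} (hω : ω ∈ good p θ₀ B K t) :
    p.η * |sharpness p.L (iter p θ₀ B t ω) - (2 / p.η + yHat p θ₀ B t ω)| ≤
      (2 * K + |c.cκ| * (2 / c.cβ) * K + (|c.C4| + 2) * (2 / c.cβ * K) ^ 2) * p.ε ^ 2 := by
  obtain ⟨hv, -, hd⟩ := hω t le_rfl
  have hedge := hl.edge hf hgap hnw ht
  have hs := hl.stepScales hf hgap hβ hnw
  have he := hs.ε_pos
  have hη := hs.η_pos
  have hδ := hs.δ_pos
  have hρ := hl.ρ3_pos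
  have hκle := hs.κ_le
  have hgle := hs.g_le
  have hbρ := hl.eta_rho_delta_le hf hβ
  set b := 2 / c.cβ with hb
  set v := disp p θ₀ B t ω with hvdef
  have hiter : iter p θ₀ B t ω = p.ref t + v := by rw [hvdef, disp]; abel
  have hvR : ‖v‖ < Landscape.radius c p := hv.trans_lt (hl.lt_radius hf hβ hK hR)
  have hηv : p.η * p.ρ3 * ‖v‖ ≤ b * K * p.ε := by
    calc p.η * p.ρ3 * ‖v‖ ≤ p.η * p.ρ3 * (K * p.δ) := by gcongr
      _ = K * (p.η * p.ρ3 * p.δ) := by ring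
      _ ≤ K * (b * p.ε) := by gcongr
      _ = _ := by ring
  have h1 := hedge.abs_sharpness_sub_le hvR (hηv.trans (by linarith))
  have h2 : ⟪third p.L (p.ref t) (p.u 0) (p.u 0), v⟫_ℝ =
      ⟪p.gradSperp 0, v⟫_ℝ + p.kappa 0 * ⟪p.u 0, v⟫_ℝ := by
    rw [← hl.gradSperp_eq hf hgap hnw ht, Edge.sperp, perp, inner_sub_left, real_inner_smul_left,
      real_inner_comm _ (p.u 0), hl.inner_third_unit hf hgap hnw ht]
    ring
  have h3 : yHat p θ₀ B t ω = ⟪p.gradSperp 0, v⟫_ℝ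
      - ⟪p.gradSperp 0, v - dispHat p θ₀ B t ω⟫_ℝ := by
    rw [yHat, hf.gradSperp_const t ht, inner_sub_right]; ring
  have h4 : p.η * |⟪p.gradSperp 0, v - dispHat p θ₀ B t ω⟫_ℝ| ≤ 2 * K * p.ε ^ 2 := by
    calc p.η * |⟪p.gradSperp 0, v - dispHat p θ₀ B t ω⟫_ℝ|
        ≤ p.η * (‖p.gradSperp 0‖ * (K * (p.ε * p.δ))) := by
          gcongr
          exact (abs_real_inner_le_norm _ _).trans (by gcongr)
      _ = K * p.ε * (p.η * ‖p.gradSperp 0‖ * p.δ) := by ring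
      _ ≤ K * p.ε * (2 * p.ε) := by gcongr
      _ = _ := by ring
  have h5 : p.η * |p.kappa 0 * ⟪p.u 0, v⟫_ℝ| ≤ |c.cκ| * b * K * p.ε ^ 2 := by
    rw [abs_mul]
    calc p.η * (|p.kappa 0| * |⟪p.u 0, v⟫_ℝ|) ≤ p.η * (|p.kappa 0| * (K * p.δ)) := by
          gcongr; exact (hs.abs_inner_u_le v).trans hv
      _ = K * (p.η * |p.kappa 0| * p.δ) := by ring
      _ ≤ K * (|c.cκ| * b * p.ε ^ 2) := by gcongr
      _ = _ := by ring
  have h6 : p.η * ((|c.C4| + 2) * (p.η * p.ρ3 ^ 2) * ‖v‖ ^ 2) ≤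
      (|c.C4| + 2) * (b * K) ^ 2 * p.ε ^ 2 := by
    calc p.η * ((|c.C4| + 2) * (p.η * p.ρ3 ^ 2) * ‖v‖ ^ 2)
        = (|c.C4| + 2) * (p.η * p.ρ3 * ‖v‖) ^ 2 := by ring
      _ ≤ (|c.C4| + 2) * (b * K * p.ε) ^ 2 := by gcongr
      _ = _ := by ring
  rw [hiter]
  -- Three errors, each `O(ε²/η)`: the sharpness remainder, the small component `κ` of the sharpness
  -- gradient, and the coupling error seen along `∇S^⊥`.
  have h7 : sharpness p.L (p.ref t + v) - (2 / p.η + yHat p θ₀ B t ω) =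
      (sharpness p.L (p.ref t + v) -
        (2 / p.η + ⟪third p.L (p.ref t) (p.u 0) (p.u 0), v⟫_ℝ))
      + p.kappa 0 * ⟪p.u 0, v⟫_ℝ + ⟪p.gradSperp 0, v - dispHat p θ₀ B t ω⟫_ℝ := by
    rw [h2, h3]; ring
  rw [h7]
  have h8 := mul_le_mul_of_nonneg_left ((abs_add_three _ _ _ : |(sharpness p.L (p.ref t + v) -
        (2 / p.η + ⟪third p.L (p.ref t) (p.u 0) (p.u 0), v⟫_ℝ))
      + p.kappa 0 * ⟪p.u 0, v⟫_ℝ + ⟪p.gradSperp 0, v - dispHat p θ₀ B t ω⟫_ℝ| ≤ _)) hη.le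
  have h9 := mul_le_mul_of_nonneg_left h1 hη.le
  linarith

variable [MeasurableSpace Ω] {P Q : Measure Ω}

/-- Moments of the predicted dynamics at stationarity. -/
theorem stationary_moments [IsProbabilityMeasure Q] (hl : Landscape c p) (hf : Frozen c p)
    (hs : StepScales (hess p.L (p.ref 0)) (p.u 0) (p.gradSperp 0)
      p.η (p.kappa 0) p.ε p.δ (2 * |c.Cnw|) (|c.cκ| * (2 / c.cβ)))
    (hU : UniformBatch (past θ₀ B t) Q (B t) p.b) (hle : past θ₀ B (t + 1) ≤ ‹MeasurableSpace Ω›)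
    (hξ : MemLp (xi p θ₀ B t) 2 Q) (ht : t < p.T) {K : ℝ} (hK : 0 ≤ K) (hε : p.ε ≤ 1)
    (hbd : ∀ᵐ ω ∂Q, ‖dispHat p θ₀ B t ω‖ ≤ K * p.δ)
    (hstat : Stationary p Q θ₀ B t) (hdec : Decorrelated c p Q θ₀ B t) :
    Integrable (fun ω => xHat p θ₀ B t ω ^ 2) Q ∧ ∫ ω, xHat p θ₀ B t ω ^ 2 ∂Q = p.δ ^ 2 ∧
    Integrable (fun ω => yHat p θ₀ B t ω) Q ∧
    p.η * |(∫ ω, yHat p θ₀ B t ω ∂Q) + p.η * sigmaSq p Q θ₀ B t / (2 * p.δ ^ 2)| ≤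
      (((1 + 2 * K) * (|c.cκ| * (2 / c.cβ)) * K ^ 3 + (|c.cκ| * (2 / c.cβ)) ^ 2 * K ^ 4)
        + |c.Cdec| + 4 * K ^ 2) * p.ε ^ 2 := by
  have he := hs.ε_pos
  have hη := hs.η_pos
  have hδ := hs.δ_pos
  have hk := hs.k_nonneg
  have hκle := hs.κ_le
  set k := |c.cκ| * (2 / c.cβ) with hkdef
  set κ := p.kappa 0 with hκdef
  set X := xHat p θ₀ B t with hX
  set Y := yHat p θ₀ B t with hY
  set X' := xHat p θ₀ B (t + 1) with hX'
  set Y' := yHat p θ₀ B (t + 1) with hY'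
  set W : Ω → ℝ := fun ω => ⟪p.u t, xi p θ₀ B t ω⟫_ℝ with hW
  have hXm : Measurable[past θ₀ B t] X := measurable_past_xHat hf ht.le
  have hYm : Measurable[past θ₀ B t] Y := measurable_past_yHat hf ht.le
  have hXm0 : Measurable X := hXm.mono hU.le le_rfl
  have hYm0 : Measurable Y := hYm.mono hU.le le_rfl
  have hXm1 : Measurable X' := (measurable_past_xHat hf ht).mono hle le_rfl
  have hYm1 : Measurable Y' := (measurable_past_yHat hf ht).mono hle le_rfl
  have hXb : ∀ᵐ ω ∂Q, |X ω| ≤ K * p.δ := hbd.mono fun ω hω => by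
    rw [hX, xHat, hf.u_const t ht.le]
    exact (hs.abs_inner_u_le _).trans hω
  have hYb : ∀ᵐ ω ∂Q, |p.η * Y ω| ≤ 2 * K * p.ε := hbd.mono fun ω hω => by
    rw [hY, yHat, hf.gradSperp_const t ht.le]
    exact hs.abs_eta_inner_g_le hω
  have hXi : Integrable (fun ω => X ω ^ 2) Q := by
    refine Integrable.of_bound (hXm0.pow_const 2).aestronglyMeasurable ((K * p.δ) ^ 2) ?_
    filter_upwards [hXb] with ω hω
    rw [Real.norm_eq_abs, abs_pow]
    gcongr
  have hYi : Integrable Y Q := by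
    refine Integrable.of_bound hYm0.aestronglyMeasurable (2 * K * p.ε / p.η) ?_
    filter_upwards [hYb] with ω hω
    rw [abs_mul, abs_of_pos hη] at hω
    rw [Real.norm_eq_abs, le_div_iff₀ hη]; linarith
  -- Stationarity is used only through two test functions, the second coordinate and the square of
  -- the first.
  have hmap : ∀ φ : ℝ × ℝ → ℝ, Measurable φ →
      ∫ ω, φ (X' ω, Y' ω) ∂Q = ∫ ω, φ (X ω, Y ω) ∂Q := by
    intro φ hφ
    have h1 := integral_map (μ := Q) (hXm1.prodMk hYm1).aemeasurable hφ.aestronglyMeasurable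
    have h2 := integral_map (μ := Q) (hXm0.prodMk hYm0).aemeasurable hφ.aestronglyMeasurable
    rw [← h1, ← h2]
    rw [Stationary] at hstat
    rw [hstat]
  -- the mean of `y`
  have hXmean : ∫ ω, X ω ^ 2 ∂Q = p.δ ^ 2 := by
    have h1 := hmap Prod.snd measurable_snd
    have hone : Measurable[past θ₀ B t] fun _ : Ω => (1 : ℝ) := measurable_const
    have h2 := integral_mul_inner_xi hl hU hξ hone (C := 1) (by simp) (p.gradSperp 0)
    simp only [one_mul] at h2
    simp only at h1
    have h3 : ∀ ω, Y' ω = Y ω + (p.η * ‖p.gradSperp 0‖ ^ 2 / 2) * (p.δ ^ 2 - X ω ^ 2)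
        - p.η * ⟪p.gradSperp 0, xi p θ₀ B t ω⟫_ℝ := by
      intro ω
      rw [hY', yHat_succ hf hs ht]; ring
    simp only [h3] at h1
    have hC : Integrable (fun ω => p.δ ^ 2 - X ω ^ 2) Q := (integrable_const _).sub hXi
    have hB : Integrable (fun ω => p.η * ‖p.gradSperp 0‖ ^ 2 / 2 * (p.δ ^ 2 - X ω ^ 2)) Q :=
      hC.const_mul _
    have hA : Integrable
        (fun ω => Y ω + p.η * ‖p.gradSperp 0‖ ^ 2 / 2 * (p.δ ^ 2 - X ω ^ 2)) Q := hYi.add hB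
    rw [integral_sub hA (h2.1.const_mul _), integral_add hYi hB, integral_const_mul,
      integral_const_mul, h2.2, integral_sub (integrable_const _) hXi] at h1
    simp only [integral_const, probReal_univ, one_smul, mul_zero, sub_zero, add_eq_left,
      mul_eq_zero] at h1
    have hg := hf.norm_gradSperp_pos
    rcases h1 with h1 | h1
    · have : 0 < p.η * ‖p.gradSperp 0‖ ^ 2 / 2 := by positivity
      linarith
    · linarith
  -- the second moment of `x`
  set M : Ω → ℝ := fun ω => -((1 + p.η * Y ω) * X ω + p.η / 2 * κ * X ω ^ 2) with hM
  -- `M² = N + D`, with `D` collecting the terms that contain `κ`; these are `O(ε² δ²)` because `η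
  -- |κ| δ ≤ k ε²`.
  set D : Ω → ℝ := fun ω => (1 + p.η * Y ω) * X ω * (p.η * κ * X ω ^ 2)
    + (p.η * κ) ^ 2 * X ω ^ 4 / 4 with hD
  set N : Ω → ℝ := fun ω => (1 + p.η * Y ω) ^ 2 * X ω ^ 2 with hN
  have hMm : Measurable[past θ₀ B t] M :=
    (((measurable_const.add (hYm.const_mul p.η)).mul hXm).add ((hXm.pow_const 2).const_mul _)).neg
  have hNm : Measurable N :=
    ((measurable_const.add (hYm0.const_mul p.η)).pow_const 2).mul (hXm0.pow_const 2)
  have hDm : Measurable D :=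
    (((measurable_const.add (hYm0.const_mul p.η)).mul hXm0).mul
      ((hXm0.pow_const 2).const_mul _)).add (((hXm0.pow_const 4).const_mul _).div_const 4)
  have h1Y : ∀ᵐ ω ∂Q, |1 + p.η * Y ω| ≤ 1 + 2 * K := hYb.mono fun ω hω => by
    refine (abs_add_le _ _).trans ?_
    rw [abs_one]
    have : 2 * K * p.ε ≤ 2 * K * 1 := by gcongr
    linarith
  have hNi : Integrable N Q := by
    refine Integrable.of_bound hNm.aestronglyMeasurable ((1 + 2 * K) ^ 2 * (K * p.δ) ^ 2) ?_
    filter_upwards [hXb, h1Y] with ω h1 h2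
    rw [Real.norm_eq_abs, hN, abs_mul, abs_pow, abs_pow]
    gcongr
  set CD := (1 + 2 * K) * k * K ^ 3 + k ^ 2 * K ^ 4 with hCD
  have hDb : ∀ᵐ ω ∂Q, |D ω| ≤ CD * (p.ε ^ 2 * p.δ ^ 2) := by
    filter_upwards [hXb, h1Y] with ω h1 h2
    have h3 : |(1 + p.η * Y ω) * X ω * (p.η * κ * X ω ^ 2)| ≤
        (1 + 2 * K) * k * K ^ 3 * (p.ε ^ 2 * p.δ ^ 2) := by
      rw [abs_mul, abs_mul, abs_mul, abs_mul, abs_pow, abs_of_pos hη]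
      calc |1 + p.η * Y ω| * |X ω| * (p.η * |κ| * |X ω| ^ 2)
          ≤ (1 + 2 * K) * (K * p.δ) * (p.η * |κ| * (K * p.δ) ^ 2) := by gcongr
        _ = (1 + 2 * K) * K ^ 3 * p.δ ^ 2 * (p.η * |κ| * p.δ) := by ring
        _ ≤ (1 + 2 * K) * K ^ 3 * p.δ ^ 2 * (k * p.ε ^ 2) := by gcongr
        _ = _ := by ring
    have h4 : |(p.η * κ) ^ 2 * X ω ^ 4 / 4| ≤ k ^ 2 * K ^ 4 * (p.ε ^ 2 * p.δ ^ 2) := by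
      rw [abs_div, abs_mul, abs_pow, abs_pow, abs_mul, abs_of_pos hη,
        abs_of_pos (by norm_num : (0 : ℝ) < 4)]
      calc (p.η * |κ|) ^ 2 * |X ω| ^ 4 / 4 ≤ (p.η * |κ|) ^ 2 * (K * p.δ) ^ 4 / 4 := by gcongr
        _ = K ^ 4 * p.δ ^ 2 * (p.η * |κ| * p.δ) ^ 2 / 4 := by ring
        _ ≤ K ^ 4 * p.δ ^ 2 * (k * p.ε ^ 2) ^ 2 / 4 := by gcongr
        _ = k ^ 2 * K ^ 4 * (p.ε ^ 2 * p.δ ^ 2) * (p.ε ^ 2 / 4) := by ring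
        _ ≤ k ^ 2 * K ^ 4 * (p.ε ^ 2 * p.δ ^ 2) * 1 := by gcongr; nlinarith
        _ = _ := mul_one _
    refine (abs_add_le _ _).trans ((add_le_add h3 h4).trans (le_of_eq ?_))
    rw [hCD]; ring
  have hDi : Integrable D Q := Integrable.of_bound hDm.aestronglyMeasurable _ hDb
  have hMb : ∀ᵐ ω ∂Q, |M ω| ≤ (1 + 2 * K) * (K * p.δ) + p.η / 2 * |κ| * (K * p.δ) ^ 2 := by
    filter_upwards [hXb, h1Y] with ω h1 h2
    rw [hM, abs_neg]
    refine (abs_add_le _ _).trans ?_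
    rw [abs_mul, abs_mul, abs_mul, abs_pow, abs_of_pos (by positivity : 0 < p.η / 2)]
    gcongr
  have hMW := integral_mul_inner_xi hl hU hξ hMm hMb (p.u t)
  have hW2 := integral_inner_xi_sq (p := p) hU hξ
  set σ := sigmaSq p Q θ₀ B t with hσ
  set y := ∫ ω, Y ω ∂Q with hy
  have hbal : p.δ ^ 2 = (∫ ω, N ω ∂Q) + (∫ ω, D ω ∂Q) + p.η ^ 2 * σ := by
    have h1 := hmap (fun q => q.1 ^ 2) (measurable_fst.pow_const 2)
    simp only at h1
    have h3 : ∀ ω, X' ω ^ 2 = (N ω + D ω - 2 * p.η * (M ω * W ω)) + p.η ^ 2 * W ω ^ 2 := by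
      intro ω
      rw [hX', xHat_succ hf hs ht]
      simp only [hM, hN, hD, hW, ← hX, ← hY, ← hκdef]
      ring
    simp only [h3] at h1
    have hMW1 : Integrable (fun ω => 2 * p.η * (M ω * W ω)) Q := hMW.1.const_mul _
    have hND : Integrable (fun ω => N ω + D ω) Q := hNi.add hDi
    have hNDM : Integrable (fun ω => N ω + D ω - 2 * p.η * (M ω * W ω)) Q := hND.sub hMW1
    rw [integral_add hNDM (hW2.1.const_mul _), integral_sub hND hMW1, integral_add hNi hDi, integral_const_mul,
      integral_const_mul, hMW.2, hW2.2, hXmean] at h1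
    linarith
  have hDint : |∫ ω, D ω ∂Q| ≤ CD * (p.ε ^ 2 * p.δ ^ 2) := by
    simpa using norm_integral_le_of_norm_le_const (μ := Q) (f := D) hDb
  have hdec' : |(∫ ω, N ω ∂Q) - (1 + p.η * y) ^ 2 * p.δ ^ 2| ≤
      |c.Cdec| * (p.ε ^ 2 * p.δ ^ 2) := by
    have h := hdec
    rw [Decorrelated, ← hX, ← hY, hXmean] at h
    refine h.trans ?_
    gcongr
    exact le_abs_self _
  have hyb : |p.η * y| ≤ 2 * K * p.ε := by
    have := norm_integral_le_of_norm_le_const (μ := Q) (f := fun ω => p.η * Y ω) hYb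
    rw [integral_const_mul] at this
    simpa using this
  have hyb2 : (p.η * y) ^ 2 ≤ 4 * K ^ 2 * p.ε ^ 2 := by
    rw [← sq_abs]
    calc |p.η * y| ^ 2 ≤ (2 * K * p.ε) ^ 2 := by gcongr
      _ = _ := by ring
  refine ⟨hXi, hXmean, hYi, ?_⟩
  -- Expanding `(1 + η y)² δ²` in the balance `hbal` cancels `δ²`. The linear term and the noise
  -- variance form the left side, and `(η y)² δ²` joins the errors.
  have hkey : 2 * p.δ ^ 2 * (p.η * (y + p.η * σ / (2 * p.δ ^ 2))) =
      -(((∫ ω, N ω ∂Q) - (1 + p.η * y) ^ 2 * p.δ ^ 2) + (∫ ω, D ω ∂Q)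
        + (p.η * y) ^ 2 * p.δ ^ 2) := by
    have : 2 * p.δ ^ 2 * (p.η * (y + p.η * σ / (2 * p.δ ^ 2))) =
      2 * p.δ ^ 2 * p.η * y + p.η ^ 2 * σ := by field_simp
    rw [this]
    linarith
  have habs : 2 * p.δ ^ 2 * (p.η * |y + p.η * σ / (2 * p.δ ^ 2)|) ≤
      (CD + |c.Cdec| + 4 * K ^ 2) * p.ε ^ 2 * p.δ ^ 2 := by
    have h1 : 2 * p.δ ^ 2 * (p.η * |y + p.η * σ / (2 * p.δ ^ 2)|) =
        |2 * p.δ ^ 2 * (p.η * (y + p.η * σ / (2 * p.δ ^ 2)))| := by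
      rw [abs_mul (2 * p.δ ^ 2), abs_mul p.η, abs_of_pos hη,
        abs_of_pos (by positivity : 0 < 2 * p.δ ^ 2)]
    rw [h1, hkey, abs_neg]
    have h2 := abs_add_three ((∫ ω, N ω ∂Q) - (1 + p.η * y) ^ 2 * p.δ ^ 2) (∫ ω, D ω ∂Q)
      ((p.η * y) ^ 2 * p.δ ^ 2)
    have h3 : |(p.η * y) ^ 2 * p.δ ^ 2| ≤ 4 * K ^ 2 * p.ε ^ 2 * p.δ ^ 2 := by
      rw [abs_of_nonneg (by positivity)]
      gcongr
    linarith
  have hpos : 0 ≤ p.η * |y + p.η * σ / (2 * p.δ ^ 2)| := by positivity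
  refine le_of_mul_le_mul_right ?_ (by positivity : 0 < p.δ ^ 2)
  have : 0 ≤ p.δ ^ 2 * (p.η * |y + p.η * σ / (2 * p.δ ^ 2)|) := by positivity
  linarith

/-- Continuity of the sharpness is available only on the ball of regularity, so it is replaced by
`0` outside, where the iterate almost surely does not go. -/
theorem aestronglyMeasurable_sharpness_iter (hl : Landscape c p) (hf : Frozen c p)
    (hgap : c.cgap < 2) (hnw : 2 * |c.Cnw| * p.ε ≤ 1) (hle : past θ₀ B t ≤ ‹MeasurableSpace Ω›)
    (ht : t ≤ p.T) (hball : ∀ᵐ ω ∂Q, ‖disp p θ₀ B t ω‖ < Landscape.radius c p) :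
    AEStronglyMeasurable (fun ω => sharpness p.L (iter p θ₀ B t ω)) Q := by
  classical
  have hedge := hl.edge hf hgap hnw ht
  set U := Metric.ball (p.ref t) (Landscape.radius c p) with hU
  have h1 : Measurable (U.piecewise (sharpness p.L) 0) :=
    hedge.continuousOn_sharpness.measurable_piecewise continuousOn_const measurableSet_ball
  refine (h1.comp ((measurable_past_iter p t).mono hle le_rfl)).aestronglyMeasurable.congr ?_
  filter_upwards [hball] with ω hω
  have : iter p θ₀ B t ω ∈ U := by
    rw [hU, Metric.mem_ball, dist_eq_norm]; exact hω
  exact Set.piecewise_eq_of_mem _ _ _ this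

end Equilibrium

end StochasticSelfStabilization

/-! ### Assembly of the theorem -/

open StochasticSelfStabilization in
theorem theorem2 (c : Constants) (hgap : c.cgap < 2) (hα : 0 < c.cα) (hβ : 0 < c.cβ)
    (r : ℝ) (hr : 0 < r) (hr1 : r < 1) :
    ∃ K₀ : ℝ, 0 < K₀ ∧ ∀ K : ℝ, K₀ ≤ K → ∃ C ε₀ : ℝ, 0 < C ∧ 0 < ε₀ ∧
      ∀ (d n : ℕ) (p : Problem d n) (Ω : Type*) [MeasurableSpace Ω] (P : Measure Ω)
        [IsProbabilityMeasure P] (θ₀ : Ω → Param d) (B : ℕ → Ω → Finset (Fin n)),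
        Landscape c p → Frozen c p → Sampling c p P θ₀ B → p.ε ≤ ε₀ →
        ENNReal.ofReal (1 - r) ≤ P (good p θ₀ B K p.T) ∧
        ∀ t : ℕ, t + 1 ≤ p.T → ∀ Q : Measure Ω, Q = P[|good p θ₀ B K t] →
          Stationary p Q θ₀ B t → Decorrelated c p Q θ₀ B t →
          (Integrable (fun ω => xHat p θ₀ B t ω ^ 2) Q ∧
            ∫ ω, xHat p θ₀ B t ω ^ 2 ∂Q = p.δ ^ 2 ∧
            p.δ ^ 2 = 2 * p.alpha 0 / p.beta 0) ∧
          (Integrable (fun ω => yHat p θ₀ B t ω) Q ∧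
            |(∫ ω, yHat p θ₀ B t ω ∂Q)
              - (-(p.η * p.beta 0 * sigmaSq p Q θ₀ B t / (4 * p.alpha 0)))|
              ≤ C * (p.ε ^ 2 / p.η)) ∧
          (Integrable (fun ω => sharpness p.L (iter p θ₀ B t ω)) Q ∧
            |(∫ ω, sharpness p.L (iter p θ₀ B t ω) ∂Q)
              - (2 / p.η - p.η * p.beta 0 * sigmaSq p Q θ₀ B t / (4 * p.alpha 0))|
              ≤ C * (p.ε ^ 2 / p.η)) := by
  obtain ⟨K₀, ε₁, hK₀, hε₁, hprob⟩ := exists_good_prob c hgap hα hβ hr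
  refine ⟨K₀, hK₀, fun K hK => ?_⟩
  have hK0 : 0 ≤ K := hK₀.le.trans hK
  set C₁ := (((1 + 2 * K) * (|c.cκ| * (2 / c.cβ)) * K ^ 3 + (|c.cκ| * (2 / c.cβ)) ^ 2 * K ^ 4)
        + |c.Cdec| + 4 * K ^ 2) with hC₁
  set C₂ := (2 * K + |c.cκ| * (2 / c.cβ) * K + (|c.C4| + 2) * (2 / c.cβ * K) ^ 2) with hC₂
  have hC₁0 : 0 ≤ C₁ := by positivity
  have hC₂0 : 0 ≤ C₂ := by positivity
  have hgap' : 0 < 2 - c.cgap := by linarith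
  obtain ⟨ε₀, ⟨⟨⟨⟨hx1, hx2⟩, hx3⟩, hx4⟩, hx5⟩, hx0⟩ :=
    (((((eventually_mul_lt (2 * |c.Cnw|) one_pos).and (eventually_mul_lt 1 hε₁)).and
    (eventually_mul_lt (K * (2 / c.cβ)) (by positivity : 0 < (2 - c.cgap) / 4))).and
    (eventually_mul_lt (K * (2 / c.cβ)) (by norm_num : (0 : ℝ) < 1 / 4))).and
    (eventually_mul_lt 1 one_pos)).and self_mem_nhdsWithin |>.exists
  refine ⟨C₁ + C₂ + 1, ε₀, by positivity, hx0, ?_⟩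
  intro d n p Ω _ P _ θ₀ B hl hf hs hε
  have he := hl.eps_pos hf
  have hη := hl.η_pos
  have hδ := hf.delta_pos
  have hnw : 2 * |c.Cnw| * p.ε ≤ 1 := le_trans (by gcongr) hx1.le
  have hR : K * (2 / c.cβ) * p.ε < (2 - c.cgap) / 4 := lt_of_le_of_lt (by gcongr) hx3
  have hq : K * (2 / c.cβ) * p.ε ≤ 1 / 4 := le_trans (by gcongr) hx4.le
  -- Enlarging `K` and shortening the time enlarge the event, so the probability bound at `K₀` and
  -- the final time serves every `K ≥ K₀` and every `t`.
  have hgood : ∀ t ≤ p.T, ENNReal.ofReal (1 - r) ≤ P (good p θ₀ B K t) := fun t ht =>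
    (hprob d n p Ω P θ₀ B hl hf hs (by linarith)).trans
      (measure_mono (good_mono hδ.le he.le hK ht))
  refine ⟨hgood p.T le_rfl, ?_⟩
  rintro t ht Q rfl hstat hdec
  have htT : t < p.T := ht
  have hGm := measurableSet_past_good (θ₀ := θ₀) (B := B) hf K htT.le
  have hG0 : P (good p θ₀ B K t) ≠ 0 := by
    have h1 : 0 < ENNReal.ofReal (1 - r) := by simpa using hr1
    exact (h1.trans_le (hgood t htT.le)).ne'
  have hQ : IsProbabilityMeasure P[|good p θ₀ B K t] := cond_isProbabilityMeasure hG0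
  -- The event `G_t` depends only on the batches before step `t`, so conditioning on it leaves the
  -- batch `B t` uniform and independent of the past.
  have hU := (hs.uniformBatch hl t).cond hGm
  have hmem : ∀ᵐ ω ∂P[|good p θ₀ B K t], ω ∈ good p θ₀ B K t := ae_cond_mem (hs.past_le t _ hGm)
  obtain ⟨hXi, hXmean, hYi, hYmean⟩ := stationary_moments hl hf (hl.stepScales hf hgap hβ hnw) hU
    (hs.past_le (t + 1)) (MemLp.cond (hs.memLp_xi htT) hG0) htT hK0 (by linarith)
    (hmem.mono fun ω hω => (hω t le_rfl).2.1) hstat hdec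
  set Q := P[|good p θ₀ B K t] with hQdef
  rw [← hC₁] at hYmean
  -- The identity `δ² = 2α/β` turns the coefficient given by the balance of second moments into the
  -- stated one.
  have hcoef : p.η * p.beta 0 * sigmaSq p Q θ₀ B t / (4 * p.alpha 0) =
      p.η * sigmaSq p Q θ₀ B t / (2 * p.δ ^ 2) := by
    have := hf.alpha_pos
    have := hf.beta_pos
    rw [hf.delta_sq]; field_simp; ring
  rw [hcoef]
  have hYb : |(∫ ω, yHat p θ₀ B t ω ∂Q) + p.η * sigmaSq p Q θ₀ B t / (2 * p.δ ^ 2)| ≤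
      C₁ * (p.ε ^ 2 / p.η) := by
    rw [← mul_div_assoc, le_div_iff₀ hη]; linarith
  have hq0 : 0 ≤ p.ε ^ 2 / p.η := by positivity
  have hSb : ∀ᵐ ω ∂Q, ‖sharpness p.L (iter p θ₀ B t ω) - (2 / p.η + yHat p θ₀ B t ω)‖ ≤
      C₂ * (p.ε ^ 2 / p.η) := by
    filter_upwards [hmem] with ω hω
    have := abs_sharpness_sub_yHat_le hl hf hgap hβ hnw hK0 hR hq htT.le hω
    rw [← mul_div_assoc, le_div_iff₀ hη, Real.norm_eq_abs]
    linarith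
  have hSm := aestronglyMeasurable_sharpness_iter hl hf hgap hnw (hs.past_le t) htT.le
    (hmem.mono fun ω hω => (hω t le_rfl).1.trans_lt (hl.lt_radius hf hβ hK0 hR))
  have hlin : Integrable (fun ω => 2 / p.η + yHat p θ₀ B t ω) Q := (integrable_const _).add hYi
  have hdiff : Integrable
      (fun ω => sharpness p.L (iter p θ₀ B t ω) - (2 / p.η + yHat p θ₀ B t ω)) Q :=
    Integrable.of_bound (hSm.sub hlin.aestronglyMeasurable) _ hSb
  have hSi : Integrable (fun ω => sharpness p.L (iter p θ₀ B t ω)) Q := by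
    refine (hdiff.add hlin).congr (Filter.Eventually.of_forall fun ω => ?_)
    simp
  refine ⟨⟨hXi, hXmean, hf.delta_sq⟩, ⟨hYi, ?_⟩, hSi, ?_⟩
  · rw [sub_neg_eq_add]
    refine hYb.trans ?_
    gcongr
    linarith
  · have h1 := norm_integral_le_of_norm_le_const hSb
    rw [integral_sub hSi hlin, integral_add (integrable_const _) hYi, Real.norm_eq_abs] at h1
    simp only [integral_const, probReal_univ, one_smul, mul_one] at h1
    have h2 : (∫ ω, sharpness p.L (iter p θ₀ B t ω) ∂Q)
        - (2 / p.η - p.η * sigmaSq p Q θ₀ B t / (2 * p.δ ^ 2)) =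
        ((∫ ω, sharpness p.L (iter p θ₀ B t ω) ∂Q) - (2 / p.η + ∫ ω, yHat p θ₀ B t ω ∂Q))
        + ((∫ ω, yHat p θ₀ B t ω ∂Q) + p.η * sigmaSq p Q θ₀ B t / (2 * p.δ ^ 2)) := by ring
    rw [h2]
    refine (abs_add_le _ _).trans ((add_le_add h1 hYb).trans ?_)
    have e1 : (C₁ + C₂ + 1) * (p.ε ^ 2 / p.η) =
        C₂ * (p.ε ^ 2 / p.η) + C₁ * (p.ε ^ 2 / p.η) + p.ε ^ 2 / p.η := by ring
    linarith
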